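/- Fix $T\ge 0$, $\mu>0$, $\lambda>0$ and consider the Navier–Stokes–Poisson system for $n(t,x)>0$, $u(t,x)$, $\phi(t,x)$, $$\partial_t n+\partial_x(nu)=0,\qquad \partial_t(nu)+\partial_x(nu^2+Tn)=\mu\,\partial_{xx}u-n\,\partial_x\phi,\qquad -\lambda^2\partial_{xx}\phi=n-e^{\phi}.$$ Let $n_->0$ and $u_-\in\mathbb R$. There exist positive constants $\hat\varepsilon_0,\bar C,\underline C,\theta$ and $C_k$ $(k=0,1,2,\dots)$, depending only on $T,\mu,\lambda,n_-,u_-$, such that the following holds. Suppose that $n_+,u_+,s\in\mathbb R$ satisfy the Rankine–Hugoniot conditions $$-s(n_+-n_-)+n_+u_+-n_-u_-=0,$$ $$-s(n_+u_+-n_-u_-)+n_+u_+^2-n_-u_-^2+(T+1)(n_+-n_-)=0,$$ that the shock belongs to the second characteristic family, that is $s>u_-$, and that $n_+<n_-$ and $|n_+-n_-|\le\hat\varepsilon_0$. Put $\phi_\pm=\log n_\pm$. Then the system has a smooth travelling wave solution $[\bar n,\bar u,\bar\phi](\xi)$, $\xi=x-st$, with $\bar n>0$; that is, $[\bar n,\bar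 u,\bar\phi]$ solves the profile equations $$-s\bar n'+(\bar n\bar u)'=0,\qquad -s(\bar n\bar u)'+(\bar n\bar u^2+T\bar n)'=\mu\bar u''-\bar n\bar\phi',\qquad -\lambda^2\bar\phi''=\bar n-e^{\bar\phi}$$ on $\mathbb R$, and $[\bar n,\bar u,\bar\phi](\xi)\to[n_\pm,u_\pm,\phi_\pm]$ as $\xi\to\pm\infty$. It is unique up to a shift of $\xi$ among smooth solutions of the profile equations with positive density and these limits. For all $\xi\in\mathbb R$, $$\bar n'=\frac{\bar n^2\,\bar u'}{n_-|u_--s|},\qquad \underline C\,\bar n'\le\bar\phi'\le\bar C\,\bar n'<0,$$ and, for a suitable choice of the shift and every $k=0,1,2,\dots$, $$\left|\frac{d^k}{d\xi^k}\big[\bar n-n_-,\bar u-u_-,\bar\phi-\phi_-\big](\xi)\right|\le C_k|n_+-n_-|^{k+1}e^{-\theta|n_+-n_-||\xi|}\quad(\xi<0),$$ $$\left|\frac{d^k}{d\xi^k}\big[\bar n-n_+,\bar u-u_+,\bar\phi-\phi_+\big](\xi)\right|\le C_k|n_+-n_-|^{k+1}e^{-\theta|n_+-n_-||\xi|}\quad(\xi>0).$$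 Here $|[a,b,c]|=|a|+|b|+|c|$. -/

import Mathlib

open Filter Topology
open scoped ContDiff

/-- The one-dimensional Navier-Stokes-Poisson system for the ions, with temperature `T`,
viscosity `μ` and Debye length `lam`, for smooth functions `n`, `u`, `φ` of `(t, x)` with `n > 0`:
  `n_t + (n u)_x = 0`,
  `(n u)_t + (n u ^ 2 + T n)_x = μ u_xx - n φ_x`,
  `- lam ^ 2 φ_xx = n - exp φ`. -/
structure SolvesNSP (T μ lam : ℝ) (n u φ : ℝ → ℝ → ℝ) : Prop where
  smooth_n : ContDiff ℝ ∞ (Function.uncurry n)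
  smooth_u : ContDiff ℝ ∞ (Function.uncurry u)
  smooth_φ : ContDiff ℝ ∞ (Function.uncurry φ)
  pos : ∀ t x, 0 < n t x
  mass : ∀ t x,
    deriv (fun τ => n τ x) t + deriv (fun y => n t y * u t y) x = 0
  momentum : ∀ t x,
    deriv (fun τ => n τ x * u τ x) t + deriv (fun y => n t y * u t y ^ 2 + T * n t y) x
      = μ * iteratedDeriv 2 (fun y => u t y) x - n t x * deriv (fun y => φ t y) x
  poisson : ∀ t x,
    -lam ^ 2 * iteratedDeriv 2 (fun y => φ t y) x = n t x - Real.exp (φ t x)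

/-- The Rankine-Hugoniot conditions of the quasi-neutral Euler system, between the left state
`(nm, um)` and the right state `(np, up)`, with shock speed `s`. -/
def RankineHugoniot (T s nm um np up : ℝ) : Prop :=
  -s * (np - nm) + (np * up - nm * um) = 0 ∧
  -s * (np * up - nm * um) + (np * up ^ 2 - nm * um ^ 2) + (T + 1) * (np - nm) = 0

/-- `(n, u, φ)`, as functions of the variable `ξ = x - s t`, is a smooth profile of a travelling
wave of speed `s` of the Navier-Stokes-Poisson system: it solves the profile equations, `n > 0`,
and it connects `(nm, um, log nm)` at `-∞` to `(np, up, log np)` at `+∞`. -/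
structure IsProfile (T μ lam s nm um np up : ℝ) (n u φ : ℝ → ℝ) : Prop where
  smooth_n : ContDiff ℝ ∞ n
  smooth_u : ContDiff ℝ ∞ u
  smooth_φ : ContDiff ℝ ∞ φ
  pos : ∀ ξ, 0 < n ξ
  mass : ∀ ξ, -s * deriv n ξ + deriv (fun η => n η * u η) ξ = 0
  momentum : ∀ ξ,
    -s * deriv (fun η => n η * u η) ξ + deriv (fun η => n η * u η ^ 2 + T * n η) ξ
      = μ * iteratedDeriv 2 u ξ - n ξ * deriv φ ξ
  poisson : ∀ ξ, -lam ^ 2 * iteratedDeriv 2 φ ξ = n ξ - Real.exp (φ ξ)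
  left_n : Tendsto n atBot (𝓝 nm)
  left_u : Tendsto u atBot (𝓝 um)
  left_φ : Tendsto φ atBot (𝓝 (Real.log nm))
  right_n : Tendsto n atTop (𝓝 np)
  right_u : Tendsto u atTop (𝓝 up)
  right_φ : Tendsto φ atTop (𝓝 (Real.log np))

/-- The sum of the absolute values, at `ξ`, of the `k`-th derivatives of the three deviations
`n - n₀`, `u - u₀` and `φ - log n₀` from the constant state `(n₀, u₀, log n₀)`. -/
noncomputable def deviation (k : ℕ) (n u φ : ℝ → ℝ) (n₀ u₀ ξ : ℝ) : ℝ :=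
  |iteratedDeriv k (fun η => n η - n₀) ξ| + |iteratedDeriv k (fun η => u η - u₀) ξ|
    + |iteratedDeriv k (fun η => φ η - Real.log n₀) ξ|

/-- A differentiable function that satisfies `V' ≥ σ V` wherever it is positive, is positive
somewhere, and is bounded above on the right, cannot exist. -/
theorem false_of_growth {V V' : ℝ → ℝ} {σ t₀ B : ℝ} (hσ : 0 < σ)
    (hV : ∀ t, HasDerivAt V (V' t) t) (hg : ∀ t, t₀ ≤ t → 0 < V t → σ * V t ≤ V' t)
    (h0 : 0 < V t₀) (hB : ∀ t, t₀ ≤ t → V t ≤ B) : False := by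
  have key : ∀ t, t₀ ≤ t → V t₀ * Real.exp (σ / 2 * (t - t₀)) ≤ V t := by
    intro t ht
    have hE : ∀ x, HasDerivAt (fun x => -(V t₀ * Real.exp (σ / 2 * (x - t₀))))
        (-(V t₀ * (Real.exp (σ / 2 * (x - t₀)) * (σ / 2)))) x := by
      intro x
      have h1 : HasDerivAt (fun x => σ / 2 * (x - t₀)) (σ / 2) x := by
        simpa using ((hasDerivAt_id x).sub_const t₀).const_mul (σ / 2)
      exact (h1.exp.const_mul (V t₀)).neg
    have := image_le_of_deriv_right_lt_deriv_boundary (f := fun x => -V x) (f' := fun x => -V' x)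
      (a := t₀) (b := t) (fun x _ => (hV x).neg.continuousAt.continuousWithinAt)
      (fun x _ => (hV x).neg.hasDerivWithinAt) (by simp) hE
      (fun x hx hxe => by
        have hE0 := Real.exp_pos (σ / 2 * (x - t₀))
        have hVx : V x = V t₀ * Real.exp (σ / 2 * (x - t₀)) := by linarith
        have hpos : 0 < V t₀ * Real.exp (σ / 2 * (x - t₀)) := by positivity
        have := hg x hx.1 (by rw [hVx]; exact hpos)
        rw [hVx] at this
        nlinarith [mul_pos hσ hpos]) (Set.right_mem_Icc.2 ht)
    linarith
  have hlim : Tendsto (fun t => V t₀ * Real.exp (σ / 2 * (t - t₀))) atTop atTop := by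
    refine Tendsto.const_mul_atTop h0 (Real.tendsto_exp_atTop.comp ?_)
    exact Tendsto.const_mul_atTop (by positivity) (tendsto_atTop_add_const_right _ _ tendsto_id)
  obtain ⟨t, ht1, ht2⟩ := ((hlim.eventually_gt_atTop B).and (eventually_ge_atTop t₀)).exists
  linarith [key t ht2, hB t ht2]

/-- A bounded solution of `f' = σ f + g` inherits the weighted bound of `g`, for a weight that
varies at a rate smaller than `σ`. -/
theorem le_of_unstable {f g ρ : ℝ → ℝ} {σ β K B : ℝ} (hβ : 0 ≤ β) (hβσ : β < σ)
    (hf : ∀ t, HasDerivAt f (σ * f t + g t) t) (hB : ∀ t, f t ≤ B)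
    (hK : 0 ≤ K) (hρ0 : ∀ t, 0 ≤ ρ t) (hρ : ∀ t₀ t, t₀ ≤ t → ρ t ≤ ρ t₀ * Real.exp (β * (t - t₀)))
    (hg : ∀ t, -(K * ρ t) ≤ g t) (t₀ : ℝ) : f t₀ ≤ K * ρ t₀ / (σ - β) := by
  by_contra! hlt
  set c := K * ρ t₀ / (σ - β) with hc
  have hd : 0 < σ - β := by linarith
  have hc0 : 0 ≤ c := div_nonneg (mul_nonneg hK (hρ0 _)) hd.le
  have hcd : c * (σ - β) = K * ρ t₀ := by rw [hc]; field_simp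
  have hE : ∀ x, HasDerivAt (fun x => c * Real.exp (β * (x - t₀)))
      (c * (Real.exp (β * (x - t₀)) * β)) x := by
    intro x
    have h1 : HasDerivAt (fun x => β * (x - t₀)) β x := by
      simpa using ((hasDerivAt_id x).sub_const t₀).const_mul β
    exact h1.exp.const_mul c
  refine false_of_growth (V := fun t => f t - c * Real.exp (β * (t - t₀))) (t₀ := t₀) (B := B)
    (by linarith : 0 < σ) (fun t => (hf t).sub (hE t)) ?_ (by simpa using hlt) ?_
  · intro t ht _
    have h1 := mul_le_mul_of_nonneg_left (hρ t₀ t ht) hK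
    have h2 := hg t
    have h3 : K * (ρ t₀ * Real.exp (β * (t - t₀)))
        = c * (σ - β) * Real.exp (β * (t - t₀)) := by rw [hcd]; ring
    nlinarith
  · intro t _
    have : 0 ≤ c * Real.exp (β * (t - t₀)) := by positivity
    linarith [hB t]

theorem abs_le_of_unstable {f g ρ : ℝ → ℝ} {σ β K B : ℝ} (hβ : 0 ≤ β) (hβσ : β < σ)
    (hf : ∀ t, HasDerivAt f (σ * f t + g t) t) (hB : ∀ t, |f t| ≤ B)
    (hK : 0 ≤ K) (hρ0 : ∀ t, 0 ≤ ρ t) (hρ : ∀ t₀ t, t₀ ≤ t → ρ t ≤ ρ t₀ * Real.exp (β * (t - t₀)))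
    (hg : ∀ t, |g t| ≤ K * ρ t) (t₀ : ℝ) : |f t₀| ≤ K * ρ t₀ / (σ - β) := by
  refine abs_le.2 ⟨?_, ?_⟩
  · have := le_of_unstable (f := fun t => -f t) (g := fun t => -g t) hβ hβσ
      (fun t => ((hf t).neg).congr_deriv (by ring)) (fun t => (neg_le_abs _).trans (hB t)) hK hρ0 hρ
      (fun t => by linarith [le_abs_self (g t), hg t]) t₀
    linarith
  · exact le_of_unstable hβ hβσ hf (fun t => (le_abs_self _).trans (hB t)) hK hρ0 hρ
      (fun t => (neg_le_neg (hg t)).trans (neg_abs_le _)) t₀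

theorem abs_le_of_stable {f g ρ : ℝ → ℝ} {σ β K B : ℝ} (hβ : 0 ≤ β) (hβσ : β < σ)
    (hf : ∀ t, HasDerivAt f (-(σ * f t) + g t) t) (hB : ∀ t, |f t| ≤ B)
    (hK : 0 ≤ K) (hρ0 : ∀ t, 0 ≤ ρ t) (hρ : ∀ t₀ t, t ≤ t₀ → ρ t ≤ ρ t₀ * Real.exp (β * (t₀ - t)))
    (hg : ∀ t, |g t| ≤ K * ρ t) (t₀ : ℝ) : |f t₀| ≤ K * ρ t₀ / (σ - β) := by
  have := abs_le_of_unstable (f := fun t => f (-t)) (g := fun t => -g (-t)) (ρ := fun t => ρ (-t))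
    hβ hβσ (fun t => ((hf (-t)).scomp t (hasDerivAt_neg t)).congr_deriv (by simp; ring))
    (fun t => hB _) hK (fun t => hρ0 _)
    (fun t₁ t ht => by simpa [add_comm, sub_eq_add_neg] using hρ (-t₁) (-t) (by linarith))
    (fun t => by simpa using hg (-t)) (-t₀)
  simpa using this

/-- One half of the cone condition: along a bounded difference of trajectories the unstable
component is controlled by the other two. -/
theorem cone_unstable {y p q y' p' q' : ℝ → ℝ} {ε κ σ τ σ₀ B : ℝ} (hσ₀ : 0 < σ₀) (hσ : σ₀ ≤ σ)
    (hτ : 0 ≤ τ) (hκ : 0 < κ) (hκ1 : κ ≤ 1) (hε0 : 0 ≤ ε) (hε : 20 * ε ≤ σ₀ * κ)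
    (hy : ∀ t, HasDerivAt y (y' t) t) (hp : ∀ t, HasDerivAt p (p' t) t)
    (hq : ∀ t, HasDerivAt q (q' t) t)
    (hy' : ∀ t, |y' t| ≤ ε * (|y t| + |p t| + |q t|))
    (hp' : ∀ t, |p' t - σ * p t| ≤ ε * (|y t| + |p t| + |q t|))
    (hq' : ∀ t, |q' t + τ * q t| ≤ ε * (|y t| + |p t| + |q t|))
    (hpB : ∀ t, |p t| ≤ B) (t : ℝ) : p t ^ 2 ≤ q t ^ 2 / 2 + κ ^ 2 * y t ^ 2 := by
  by_contra! hlt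
  refine false_of_growth (V := fun t => p t ^ 2 - q t ^ 2 / 2 - κ ^ 2 * y t ^ 2)
    (V' := fun t => 2 * p t * p' t - q t * q' t - 2 * κ ^ 2 * y t * y' t) (t₀ := t) (B := B ^ 2)
    hσ₀ (fun t => ?_) ?_ (by linarith) ?_
  · exact ((((hp t).pow 2).sub (((hq t).pow 2).div_const 2)).sub
      (((hy t).pow 2).const_mul (κ ^ 2))).congr_deriv (by push_cast; ring)
  · intro s _ hV
    set M := |y s| + |p s| + |q s| with hM
    have hM0 : 0 ≤ M := by positivity
    have hpa : 0 ≤ |p s| := abs_nonneg _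
    have hq1 : |q s| ≤ 3 / 2 * |p s| := by
      refine abs_le_of_sq_le_sq' ?_ (by positivity) |>.2
      rw [mul_pow, sq_abs, sq_abs]; nlinarith [sq_nonneg (κ * y s), sq_nonneg (p s)]
    have hy1 : κ * |y s| ≤ |p s| := by
      refine abs_le_of_sq_le_sq' ?_ (by positivity) |>.2
      rw [mul_pow, sq_abs, sq_abs]; nlinarith [sq_nonneg (q s)]
    have hMp : κ * M ≤ 7 / 2 * |p s| := by
      have := mul_le_mul_of_nonneg_right hκ1 hpa
      have h2 := mul_le_mul_of_nonneg_right hκ1 (abs_nonneg (q s))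
      rw [hM]; nlinarith
    have hεM : 20 * (ε * M) ≤ 7 / 2 * σ₀ * |p s| := by
      have := mul_le_mul_of_nonneg_right hε hM0
      nlinarith
    have e1 : -(|p s| * (ε * M)) ≤ p s * (p' s - σ * p s) := by
      refine (neg_le_neg ?_).trans (neg_abs_le _)
      rw [abs_mul]; exact mul_le_mul_of_nonneg_left (hp' s) hpa
    have e2 : q s * (q' s + τ * q s) ≤ |q s| * (ε * M) := by
      refine (le_abs_self _).trans ?_
      rw [abs_mul]; exact mul_le_mul_of_nonneg_left (hq' s) (abs_nonneg _)
    have e3 : y s * y' s ≤ |y s| * (ε * M) := by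
      refine (le_abs_self _).trans ?_
      rw [abs_mul]; exact mul_le_mul_of_nonneg_left (hy' s) (abs_nonneg _)
    have hεM0 : 0 ≤ ε * M := by positivity
    have e4 : κ ^ 2 * (|y s| * (ε * M)) ≤ |p s| * (ε * M) := by
      have : κ * (κ * |y s|) ≤ 1 * |p s| := mul_le_mul hκ1 hy1 (by positivity) (by norm_num)
      nlinarith
    have e5 : |q s| * (ε * M) ≤ 3 / 2 * |p s| * (ε * M) := mul_le_mul_of_nonneg_right hq1 hεM0
    have e6 : κ ^ 2 * (y s * y' s) ≤ κ ^ 2 * (|y s| * (ε * M)) :=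
      mul_le_mul_of_nonneg_left e3 (by positivity)
    have e7 : |p s| * (ε * M) * 20 ≤ 7 / 2 * σ₀ * p s ^ 2 := by
      rw [← sq_abs (p s)]; nlinarith
    have e8 : σ₀ * p s ^ 2 ≤ σ * p s ^ 2 := mul_le_mul_of_nonneg_right hσ (sq_nonneg _)
    have e9 : 0 ≤ τ * q s ^ 2 := by positivity
    have e10 : 0 ≤ σ₀ * (q s ^ 2 / 2) := by positivity
    have e11 : 0 ≤ σ₀ * (κ ^ 2 * y s ^ 2) := by positivity
    nlinarith
  · intro s _
    have : p s ^ 2 ≤ B ^ 2 := sq_le_sq' (abs_le.1 (hpB s)).1 (abs_le.1 (hpB s)).2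
    nlinarith [sq_nonneg (q s), sq_nonneg (κ * y s)]

/-- The cone condition: if `(y, p, q)` is a bounded trajectory of a small perturbation of
`y' = 0`, `p' = σ p`, `q' = -τ q`, then `p` and `q` are controlled by `y`. -/
structure SlowCone (ε σ τ : ℝ) (y p q y' p' q' : ℝ → ℝ) : Prop where
  hy : ∀ t, HasDerivAt y (y' t) t
  hp : ∀ t, HasDerivAt p (p' t) t
  hq : ∀ t, HasDerivAt q (q' t) t
  hy' : ∀ t, |y' t| ≤ ε * (|y t| + |p t| + |q t|)
  hp' : ∀ t, |p' t - σ * p t| ≤ ε * (|y t| + |p t| + |q t|)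
  hq' : ∀ t, |q' t + τ * q t| ≤ ε * (|y t| + |p t| + |q t|)
  bdd_p : ∃ B, ∀ t, |p t| ≤ B
  bdd_q : ∃ B, ∀ t, |q t| ≤ B

namespace SlowCone

variable {ε σ τ : ℝ} {y p q y' p' q' : ℝ → ℝ}

theorem abs_le (h : SlowCone ε σ τ y p q y' p' q') {κ σ₀ : ℝ} (hσ₀ : 0 < σ₀) (hσ : σ₀ ≤ σ)
    (hτ : σ₀ ≤ τ) (hκ : 0 < κ) (hκ1 : κ ≤ 1) (hε0 : 0 ≤ ε) (hε : 20 * ε ≤ σ₀ * κ) (t : ℝ) :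
    |p t| ≤ 2 * κ * |y t| ∧ |q t| ≤ 2 * κ * |y t| := by
  obtain ⟨B₁, hB₁⟩ := h.bdd_p
  obtain ⟨B₂, hB₂⟩ := h.bdd_q
  have h1 := cone_unstable hσ₀ hσ (hσ₀.le.trans hτ) hκ hκ1 hε0 hε h.hy h.hp h.hq h.hy' h.hp' h.hq'
    hB₁ t
  have h2 := cone_unstable (y := fun t => y (-t)) (p := fun t => q (-t)) (q := fun t => p (-t))
    (y' := fun t => -y' (-t)) (p' := fun t => -q' (-t)) (q' := fun t => -p' (-t))
    hσ₀ hτ (hσ₀.le.trans hσ) hκ hκ1 hε0 hε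
    (fun t => ((h.hy (-t)).scomp t (hasDerivAt_neg t)).congr_deriv (by simp))
    (fun t => ((h.hq (-t)).scomp t (hasDerivAt_neg t)).congr_deriv (by simp))
    (fun t => ((h.hp (-t)).scomp t (hasDerivAt_neg t)).congr_deriv (by simp))
    (fun t => by have := h.hy' (-t); rw [abs_neg]; linarith)
    (fun t => by
      have := h.hq' (-t)
      rw [show -q' (-t) - τ * q (-t) = -(q' (-t) + τ * q (-t)) by ring, abs_neg]; linarith)
    (fun t => by
      have := h.hp' (-t)
      rw [show -p' (-t) + σ * p (-t) = -(p' (-t) - σ * p (-t)) by ring, abs_neg]; linarith)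
    (fun t => hB₂ (-t)) (-t)
  simp only [neg_neg] at h2
  have h3 : 0 ≤ κ ^ 2 * y t ^ 2 := by positivity
  constructor
  · refine abs_le_of_sq_le_sq' ?_ (by positivity) |>.2
    rw [mul_pow, mul_pow, sq_abs, sq_abs]; nlinarith
  · refine abs_le_of_sq_le_sq' ?_ (by positivity) |>.2
    rw [mul_pow, mul_pow, sq_abs, sq_abs]; nlinarith

theorem eq_zero (h : SlowCone ε σ τ y p q y' p' q') {σ₀ : ℝ} (hσ₀ : 0 < σ₀) (hσ : σ₀ ≤ σ)
    (hτ : σ₀ ≤ τ) (hε0 : 0 ≤ ε) (hε : 20 * ε ≤ σ₀) {t₀ : ℝ} (h0 : y t₀ = 0) (t : ℝ) : y t = 0 := by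
  have hb : ∀ t, |y' t| ≤ 5 * ε * |y t| := fun t => by
    obtain ⟨h1, h2⟩ := h.abs_le hσ₀ hσ hτ one_pos le_rfl hε0 (by linarith) t
    refine (h.hy' t).trans ?_
    nlinarith [abs_nonneg (y t)]
  have main : ∀ (y y' : ℝ → ℝ) (t₀ : ℝ), (∀ t, HasDerivAt y (y' t) t) →
      (∀ t, |y' t| ≤ 5 * ε * |y t|) → y t₀ = 0 → ∀ t, t₀ ≤ t → y t = 0 := by
    intro y y' t₀ hy hb h0 t ht
    have := norm_le_gronwallBound_of_norm_deriv_right_le (f := y) (f' := y') (δ := 0) (K := 5 * ε)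
      (ε := 0) (a := t₀) (b := t) (fun x _ => (hy x).continuousAt.continuousWithinAt)
      (fun x _ => (hy x).hasDerivWithinAt) (by simp [h0]) (fun x _ => by simpa using hb x) t
      (Set.right_mem_Icc.2 ht)
    simpa [gronwallBound_ε0_δ0] using this
  rcases le_total t₀ t with ht | ht
  · exact main y y' t₀ h.hy hb h0 t ht
  · have := main (fun t => y (-t)) (fun t => -y' (-t)) (-t₀)
      (fun t => ((h.hy (-t)).scomp t (hasDerivAt_neg t)).congr_deriv (by simp))
      (fun t => by simpa using hb (-t)) (by simpa using h0) (-t) (by linarith)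
    simpa using this

theorem pos (h : SlowCone ε σ τ y p q y' p' q') {σ₀ : ℝ} (hσ₀ : 0 < σ₀) (hσ : σ₀ ≤ σ)
    (hτ : σ₀ ≤ τ) (hε0 : 0 ≤ ε) (hε : 20 * ε ≤ σ₀) {t₀ : ℝ} (h0 : 0 < y t₀) (t : ℝ) : 0 < y t := by
  by_contra! hle
  have hc : Continuous y := continuous_iff_continuousAt.2 fun t => (h.hy t).continuousAt
  obtain ⟨s, hs⟩ := mem_range_of_exists_le_of_exists_ge hc ⟨t, hle⟩ ⟨t₀, h0.le⟩
  exact h0.ne' (h.eq_zero hσ₀ hσ hτ hε0 hε hs t₀)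

end SlowCone

/-- The bounded solution of `f' = σ f - G` for bounded `G`. -/
noncomputable def expTail (σ : ℝ) (G : ℝ → ℝ) (t : ℝ) : ℝ :=
  Real.exp (σ * t) * ((∫ s in Set.Ioi (0 : ℝ), Real.exp (-σ * s) * G s)
    - ∫ s in (0 : ℝ)..t, Real.exp (-σ * s) * G s)

theorem hasDerivAt_expTail {σ : ℝ} {G : ℝ → ℝ} (hG : Continuous G) (t : ℝ) :
    HasDerivAt (expTail σ G) (σ * expTail σ G t + -G t) t := by
  have hc : Continuous fun s => Real.exp (-σ * s) * G s := by fun_prop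
  have h1 : HasDerivAt (fun t => ∫ s in (0 : ℝ)..t, Real.exp (-σ * s) * G s)
      (Real.exp (-σ * t) * G t) t :=
    intervalIntegral.integral_hasDerivAt_right (hc.intervalIntegrable _ _)
      hc.stronglyMeasurable.stronglyMeasurableAtFilter hc.continuousAt
  have h2 : HasDerivAt (fun t => Real.exp (σ * t)) (Real.exp (σ * t) * σ) t := by
    have : HasDerivAt (fun t => σ * t) σ t := by simpa using (hasDerivAt_id t).const_mul σ
    exact this.exp
  refine (h2.mul (h1.const_sub _)).congr_deriv ?_
  have : Real.exp (σ * t) * Real.exp (-σ * t) = 1 := by rw [← Real.exp_add]; simp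
  simp only [expTail]
  linear_combination (-G t) * this

theorem abs_expTail_le {σ M : ℝ} (hσ : 0 < σ) {G : ℝ → ℝ} (hG : Continuous G)
    (hM : ∀ t, |G t| ≤ M) (t : ℝ) : |expTail σ G t| ≤ M / σ := by
  have hc : Continuous fun s => Real.exp (-σ * s) * G s := by fun_prop
  have hi : ∀ c, MeasureTheory.IntegrableOn (fun s => M * Real.exp (-σ * s)) (Set.Ioi c) :=
    fun c => (integrableOn_exp_mul_Ioi (by linarith) c).const_mul M
  have hb : ∀ s, ‖Real.exp (-σ * s) * G s‖ ≤ M * Real.exp (-σ * s) := fun s => by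
    rw [norm_mul, Real.norm_eq_abs, Real.norm_eq_abs, abs_of_pos (Real.exp_pos _), mul_comm]
    exact mul_le_mul_of_nonneg_right (hM s) (Real.exp_pos _).le
  have hI : ∀ c, MeasureTheory.IntegrableOn (fun s => Real.exp (-σ * s) * G s) (Set.Ioi c) :=
    fun c => (hi c).mono' hc.aestronglyMeasurable (Eventually.of_forall hb)
  have h1 : expTail σ G t
      = Real.exp (σ * t) * ∫ s in Set.Ioi t, Real.exp (-σ * s) * G s := by
    rw [expTail, ← intervalIntegral.integral_interval_add_Ioi (hI 0) (hI t)]; ring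
  have h2 : ‖∫ s in Set.Ioi t, Real.exp (-σ * s) * G s‖ ≤ M * (Real.exp (-σ * t) / σ) := by
    refine (MeasureTheory.norm_integral_le_of_norm_le (hi t) (Eventually.of_forall hb)).trans ?_
    rw [MeasureTheory.integral_const_mul, integral_exp_mul_Ioi (by linarith)]
    rw [neg_div_neg_eq]
  rw [h1, abs_mul, abs_of_pos (Real.exp_pos _)]
  refine (mul_le_mul_of_nonneg_left h2 (Real.exp_pos _).le).trans ?_
  have : Real.exp (σ * t) * Real.exp (-σ * t) = 1 := by rw [← Real.exp_add]; simp
  calc Real.exp (σ * t) * (M * (Real.exp (-σ * t) / σ))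
      = M / σ * (Real.exp (σ * t) * Real.exp (-σ * t)) := by ring
    _ ≤ M / σ := by rw [this, mul_one]

theorem exp_abs_weight {β : ℝ} (hβ : 0 ≤ β) (s t : ℝ) :
    Real.exp (β * |t|) ≤ Real.exp (β * |s|) * Real.exp (β * |t - s|) := by
  rw [← Real.exp_add, Real.exp_le_exp, ← mul_add]
  refine mul_le_mul_of_nonneg_left ?_ hβ
  calc |t| = |s + (t - s)| := by ring_nf
    _ ≤ _ := abs_add_le _ _

theorem abs_expTail_sub_le {σ β M D : ℝ} (hβ : 0 ≤ β) (hβσ : β < σ) (hD : 0 ≤ D) {G H : ℝ → ℝ}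
    (hG : Continuous G) (hH : Continuous H) (hGM : ∀ t, |G t| ≤ M) (hHM : ∀ t, |H t| ≤ M)
    (hD' : ∀ t, |G t - H t| ≤ D * Real.exp (β * |t|)) (t : ℝ) :
    |expTail σ G t - expTail σ H t| ≤ D * Real.exp (β * |t|) / (σ - β) := by
  have hσ : 0 < σ := by linarith
  refine abs_le_of_unstable (f := fun t => expTail σ G t - expTail σ H t)
    (g := fun t => -(G t - H t)) (ρ := fun t => Real.exp (β * |t|)) (B := M / σ + M / σ) hβ hβσ
    (fun t => ((hasDerivAt_expTail hG t).sub (hasDerivAt_expTail hH t)).congr_deriv (by ring))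
    (fun t => (abs_sub _ _).trans (add_le_add (abs_expTail_le hσ hG hGM t)
      (abs_expTail_le hσ hH hHM t))) hD (fun _ => (Real.exp_pos _).le)
    (fun s t hst => ?_) (fun t => by rw [abs_neg]; exact hD' t) t
  have := exp_abs_weight hβ s t
  rwa [abs_of_nonneg (sub_nonneg.2 hst)] at this

theorem abs_sub_zero_le_exp {f g : ℝ → ℝ} {β D : ℝ} (hβ : 0 < β) (hD : 0 ≤ D)
    (hf : ∀ t, HasDerivAt f (g t) t) (hg : ∀ t, |g t| ≤ D * Real.exp (β * |t|)) (t : ℝ) :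
    |f t - f 0| ≤ D * Real.exp (β * |t|) / β := by
  have main : ∀ (f g : ℝ → ℝ), (∀ t, HasDerivAt f (g t) t) →
      (∀ t, |g t| ≤ D * Real.exp (β * |t|)) → ∀ t, 0 ≤ t →
      |f t - f 0| ≤ D * Real.exp (β * |t|) / β := by
    intro f g hf hg t ht
    have hB : ∀ x, HasDerivAt (fun x => D * Real.exp (β * x) / β) (D * Real.exp (β * x)) x := by
      intro x
      have h1 : HasDerivAt (fun x => β * x) β x := by simpa using (hasDerivAt_id x).const_mul β
      exact ((h1.exp.const_mul D).div_const β).congr_deriv (by field_simp)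
    have := image_norm_le_of_norm_deriv_right_le_deriv_boundary (f := fun t => f t - f 0) (f' := g)
      (a := 0) (b := t) (fun x _ => ((hf x).sub_const _).continuousAt.continuousWithinAt)
      (fun x _ => ((hf x).sub_const _).hasDerivWithinAt) (by simp; positivity) hB
      (fun x hx => by simpa [abs_of_nonneg hx.1] using hg x) (Set.right_mem_Icc.2 ht)
    simpa [abs_of_nonneg ht] using this
  rcases le_total 0 t with ht | ht
  · exact main f g hf hg t ht
  · have := main (fun t => f (-t)) (fun t => -g (-t))
      (fun t => ((hf (-t)).scomp t (hasDerivAt_neg t)).congr_deriv (by simp))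
      (fun t => by simpa using hg (-t)) (-t) (by linarith)
    simpa using this

namespace LyapunovPerron

/-- The data of the Lyapunov-Perron fixed point problem for the system
`y' = f`, `p' = σ p + g`, `q' = -τ q + k`. -/
structure Data where
  (f g k : ℝ × ℝ × ℝ → ℝ)
  (σ τ σ₀ ε M : ℝ)
  ε_nonneg : 0 ≤ ε
  σ₀_pos : 0 < σ₀
  le_σ : σ₀ ≤ σ
  le_τ : σ₀ ≤ τ
  small : 4 * ε ≤ σ₀
  lip_f : ∀ X X', |f X - f X'| ≤ ε * ‖X - X'‖
  lip_g : ∀ X X', |g X - g X'| ≤ ε * ‖X - X'‖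
  lip_k : ∀ X X', |k X - k X'| ≤ ε * ‖X - X'‖
  bdd_f : ∀ X, |f X| ≤ M
  bdd_g : ∀ X, |g X| ≤ M
  bdd_k : ∀ X, |k X| ≤ M

theorem continuous_of_lip {f : ℝ × ℝ × ℝ → ℝ} {ε : ℝ} (hε : 0 ≤ ε)
    (h : ∀ X X', |f X - f X'| ≤ ε * ‖X - X'‖) : Continuous f := by
  refine LipschitzWith.continuous (K := ⟨ε, hε⟩) (LipschitzWith.of_dist_le_mul fun X X' => ?_)
  rw [Real.dist_eq, dist_eq_norm]
  exact h X X'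

variable (d : Data) (y₀ : ℝ)

/-- Removal of the exponential weight. -/
noncomputable def unweight (x : BoundedContinuousFunction ℝ (ℝ × ℝ × ℝ)) (t : ℝ) : ℝ × ℝ × ℝ :=
  Real.exp (d.σ₀ / 2 * |t|) • x t

theorem continuous_unweight (x : BoundedContinuousFunction ℝ (ℝ × ℝ × ℝ)) :
    Continuous (unweight d x) := by
  have := x.continuous
  unfold unweight
  fun_prop

theorem norm_unweight_sub_le (x x' : BoundedContinuousFunction ℝ (ℝ × ℝ × ℝ)) (t : ℝ) :
    ‖unweight d x t - unweight d x' t‖ ≤ dist x x' * Real.exp (d.σ₀ / 2 * |t|) := by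
  rw [unweight, unweight, ← smul_sub, norm_smul, Real.norm_eq_abs, abs_of_pos (Real.exp_pos _),
    mul_comm, ← dist_eq_norm]
  exact mul_le_mul_of_nonneg_right (BoundedContinuousFunction.dist_coe_le_dist t)
    (Real.exp_pos _).le

/-- The Lyapunov-Perron operator on trajectories. -/
noncomputable def op (X : ℝ → ℝ × ℝ × ℝ) (t : ℝ) : ℝ × ℝ × ℝ :=
  (y₀ + ∫ s in (0 : ℝ)..t, d.f (X s),
    expTail d.σ (fun s => -d.g (X s)) t,
    expTail d.τ (fun s => d.k (X (-s))) (-t))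

variable {X : ℝ → ℝ × ℝ × ℝ}

theorem hasDerivAt_fst (hX : Continuous X) (t : ℝ) :
    HasDerivAt (fun t => (op d y₀ X t).1) (d.f (X t)) t := by
  have hc : Continuous fun s => d.f (X s) := (continuous_of_lip d.ε_nonneg d.lip_f).comp hX
  exact (intervalIntegral.integral_hasDerivAt_right (hc.intervalIntegrable _ _)
    hc.stronglyMeasurable.stronglyMeasurableAtFilter hc.continuousAt).const_add _

theorem hasDerivAt_snd (hX : Continuous X) (t : ℝ) :
    HasDerivAt (fun t => (op d y₀ X t).2.1) (d.σ * (op d y₀ X t).2.1 + d.g (X t)) t := by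
  have hc : Continuous fun s => -d.g (X s) :=
    ((continuous_of_lip d.ε_nonneg d.lip_g).comp hX).neg
  exact (hasDerivAt_expTail hc t).congr_deriv (by simp [op])

theorem hasDerivAt_thd (hX : Continuous X) (t : ℝ) :
    HasDerivAt (fun t => (op d y₀ X t).2.2) (-(d.τ * (op d y₀ X t).2.2) + d.k (X t)) t := by
  have hc : Continuous fun s => d.k (X (-s)) :=
    (continuous_of_lip d.ε_nonneg d.lip_k).comp (hX.comp continuous_neg)
  exact ((hasDerivAt_expTail hc (-t)).scomp t (hasDerivAt_neg t)).congr_deriv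
    (by simp [op]; ring)

theorem continuous_op (hX : Continuous X) : Continuous (op d y₀ X) := by
  refine Continuous.prodMk ?_ (Continuous.prodMk ?_ ?_)
  · exact continuous_iff_continuousAt.2 fun t => (hasDerivAt_fst d y₀ hX t).continuousAt
  · exact continuous_iff_continuousAt.2 fun t => (hasDerivAt_snd d y₀ hX t).continuousAt
  · exact continuous_iff_continuousAt.2 fun t => (hasDerivAt_thd d y₀ hX t).continuousAt

theorem σ_pos : 0 < d.σ := d.σ₀_pos.trans_le d.le_σ

theorem τ_pos : 0 < d.τ := d.σ₀_pos.trans_le d.le_τ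

theorem M_nonneg : 0 ≤ d.M := (abs_nonneg _).trans (d.bdd_f 0)

theorem abs_snd_le (hX : Continuous X) (t : ℝ) : |(op d y₀ X t).2.1| ≤ d.M / d.σ :=
  abs_expTail_le (σ_pos d) ((continuous_of_lip d.ε_nonneg d.lip_g).comp hX).neg
    (fun t => (abs_neg _).trans_le (d.bdd_g (X t))) t

theorem abs_thd_le (hX : Continuous X) (t : ℝ) : |(op d y₀ X t).2.2| ≤ d.M / d.τ :=
  abs_expTail_le (τ_pos d) ((continuous_of_lip d.ε_nonneg d.lip_k).comp (hX.comp continuous_neg))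
    (fun _ => d.bdd_k _) (-t)

theorem one_le_weight (t : ℝ) : 1 ≤ Real.exp (d.σ₀ / 2 * |t|) :=
  Real.one_le_exp (mul_nonneg (by linarith [d.σ₀_pos]) (abs_nonneg _))

theorem abs_fst_le (hX : Continuous X) (t : ℝ) :
    |(op d y₀ X t).1| ≤ (|y₀| + d.M / (d.σ₀ / 2)) * Real.exp (d.σ₀ / 2 * |t|) := by
  have hβ : 0 < d.σ₀ / 2 := by linarith [d.σ₀_pos]
  have h1 := abs_sub_zero_le_exp hβ (M_nonneg d) (hasDerivAt_fst d y₀ hX)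
    (fun t => (d.bdd_f _).trans (le_mul_of_one_le_right (M_nonneg d) (one_le_weight d t))) t
  have h0 : (op d y₀ X 0).1 = y₀ := by simp [op]
  rw [h0] at h1
  have h2 := one_le_weight d t
  have h3 := abs_sub_abs_le_abs_sub (op d y₀ X t).1 y₀
  have h4 : d.M * Real.exp (d.σ₀ / 2 * |t|) / (d.σ₀ / 2)
      = d.M / (d.σ₀ / 2) * Real.exp (d.σ₀ / 2 * |t|) := by ring
  nlinarith [abs_nonneg y₀]

/-- The bound of the weighted Lyapunov-Perron operator. -/
noncomputable def bound : ℝ :=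
  max (|y₀| + d.M / (d.σ₀ / 2)) (max (d.M / d.σ) (d.M / d.τ))

/-- The weighted Lyapunov-Perron operator as a self-map of the bounded continuous functions. -/
noncomputable def weightedOp (x : BoundedContinuousFunction ℝ (ℝ × ℝ × ℝ)) :
    BoundedContinuousFunction ℝ (ℝ × ℝ × ℝ) :=
  BoundedContinuousFunction.ofNormedAddCommGroup
    (fun t => (Real.exp (d.σ₀ / 2 * |t|))⁻¹ • op d y₀ (unweight d x) t)
    (by
      have := continuous_op d y₀ (continuous_unweight d x)
      refine Continuous.smul (Continuous.inv₀ (by fun_prop) fun t => (Real.exp_pos _).ne') this)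
    (bound d y₀)
    (fun t => by
      have hX := continuous_unweight d x
      have hE := Real.exp_pos (d.σ₀ / 2 * |t|)
      have h1 := one_le_weight d t
      rw [norm_smul, norm_inv, Real.norm_eq_abs, abs_of_pos hE, inv_mul_le_iff₀ hE, mul_comm]
      refine (norm_prod_le_iff).2 ⟨?_, (norm_prod_le_iff).2 ⟨?_, ?_⟩⟩
      · exact (abs_fst_le d y₀ hX t).trans (mul_le_mul_of_nonneg_right (le_max_left _ _) hE.le)
      · have h2 : d.M / d.σ ≤ bound d y₀ := (le_max_left _ _).trans (le_max_right _ _)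
        have h3 : 0 ≤ d.M / d.σ := div_nonneg (M_nonneg d) (σ_pos d).le
        exact ((abs_snd_le d y₀ hX t).trans h2).trans
          (le_mul_of_one_le_right (h3.trans h2) h1)
      · have h2 : d.M / d.τ ≤ bound d y₀ := (le_max_right _ _).trans (le_max_right _ _)
        have h3 : 0 ≤ d.M / d.τ := div_nonneg (M_nonneg d) (τ_pos d).le
        exact ((abs_thd_le d y₀ hX t).trans h2).trans
          (le_mul_of_one_le_right (h3.trans h2) h1))

theorem contracting_weightedOp : ContractingWith (1 / 2) (weightedOp d y₀) := by
  refine ⟨by rw [← NNReal.coe_lt_coe]; norm_num, LipschitzWith.of_dist_le_mul fun x x' => ?_⟩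
  rw [BoundedContinuousFunction.dist_le (by positivity)]
  intro t
  have hX := continuous_unweight d x
  have hX' := continuous_unweight d x'
  have hE := Real.exp_pos (d.σ₀ / 2 * |t|)
  have hσ₀ := d.σ₀_pos
  have hβ : 0 < d.σ₀ / 2 := by linarith
  have hdist : 0 ≤ dist x x' := dist_nonneg
  have hD : 0 ≤ d.ε * dist x x' := mul_nonneg d.ε_nonneg hdist
  have hl : ∀ (φ : ℝ × ℝ × ℝ → ℝ), (∀ X X', |φ X - φ X'| ≤ d.ε * ‖X - X'‖) → ∀ s,
      |φ (unweight d x s) - φ (unweight d x' s)|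
        ≤ d.ε * dist x x' * Real.exp (d.σ₀ / 2 * |s|) := fun φ hφ s => by
    refine (hφ _ _).trans ?_
    rw [mul_assoc]
    exact mul_le_mul_of_nonneg_left (norm_unweight_sub_le d x x' s) d.ε_nonneg
  have hfin : ∀ ν, d.σ₀ / 2 ≤ ν → d.ε * dist x x' * Real.exp (d.σ₀ / 2 * |t|) / ν
      ≤ 1 / 2 * dist x x' * Real.exp (d.σ₀ / 2 * |t|) := fun ν hν => by
    have hν0 : 0 < ν := hβ.trans_le hν
    rw [div_le_iff₀ hν0]
    have : d.ε ≤ 1 / 2 * ν := by linarith [d.small]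
    have := mul_le_mul_of_nonneg_right this (mul_nonneg hdist hE.le)
    nlinarith
  change dist ((Real.exp (d.σ₀ / 2 * |t|))⁻¹ • op d y₀ (unweight d x) t)
    ((Real.exp (d.σ₀ / 2 * |t|))⁻¹ • op d y₀ (unweight d x') t) ≤ _
  rw [dist_eq_norm, ← smul_sub, norm_smul, norm_inv, Real.norm_eq_abs, abs_of_pos hE,
    inv_mul_le_iff₀ hE, mul_comm]
  have hcoe : ((1 / 2 : NNReal) : ℝ) = 1 / 2 := by norm_num
  rw [hcoe]
  refine (norm_prod_le_iff).2 ⟨?_, (norm_prod_le_iff).2 ⟨?_, ?_⟩⟩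
  · have := abs_sub_zero_le_exp hβ hD
      (fun s => (hasDerivAt_fst d y₀ hX s).sub (hasDerivAt_fst d y₀ hX' s)) (hl d.f d.lip_f) t
    have h0 : (op d y₀ (unweight d x) 0).1 - (op d y₀ (unweight d x') 0).1 = 0 := by simp [op]
    simp only [Pi.sub_apply, h0, sub_zero] at this
    exact this.trans (hfin _ le_rfl)
  · refine (abs_expTail_sub_le hβ.le (by linarith [d.le_σ]) hD
      ((continuous_of_lip d.ε_nonneg d.lip_g).comp hX).neg
      ((continuous_of_lip d.ε_nonneg d.lip_g).comp hX').neg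
      (fun s => (abs_neg _).trans_le (d.bdd_g (unweight d x s)))
      (fun s => (abs_neg _).trans_le (d.bdd_g (unweight d x' s))) (fun s => ?_) t).trans (hfin _ (by linarith [d.le_σ]))
    have := hl d.g d.lip_g s
    rw [abs_sub_comm] at this
    simpa [neg_add_eq_sub] using this
  · have := abs_expTail_sub_le hβ.le (by linarith [d.le_τ]) hD
      ((continuous_of_lip d.ε_nonneg d.lip_k).comp (hX.comp continuous_neg))
      ((continuous_of_lip d.ε_nonneg d.lip_k).comp (hX'.comp continuous_neg))
      (fun _ => d.bdd_k _) (fun _ => d.bdd_k _)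
      (fun s => by simpa using hl d.k d.lip_k (-s)) (-t) (σ := d.τ)
    rw [abs_neg] at this
    exact this.trans (hfin _ (by linarith [d.le_τ]))

/-- Through every value of the slow variable there passes a trajectory along which the two fast
variables remain bounded. -/
theorem exists_trajectory : ∃ Y P Q : ℝ → ℝ, Y 0 = y₀ ∧
    (∀ t, HasDerivAt Y (d.f (Y t, P t, Q t)) t) ∧
    (∀ t, HasDerivAt P (d.σ * P t + d.g (Y t, P t, Q t)) t) ∧
    (∀ t, HasDerivAt Q (-(d.τ * Q t) + d.k (Y t, P t, Q t)) t) ∧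
    (∃ B, ∀ t, |P t| ≤ B) ∧ (∃ B, ∀ t, |Q t| ≤ B) := by
  have hfix := (contracting_weightedOp d y₀).fixedPoint_isFixedPt
  set x := (contracting_weightedOp d y₀).fixedPoint with hx
  have hX := continuous_unweight d x
  have heq : ∀ t, unweight d x t = op d y₀ (unweight d x) t := fun t => by
    have h1 : x t = (Real.exp (d.σ₀ / 2 * |t|))⁻¹ • op d y₀ (unweight d x) t := by
      conv_lhs => rw [← hfix]
      rfl
    conv_lhs => rw [unweight, h1]
    rw [smul_inv_smul₀ (Real.exp_pos _).ne']
  refine ⟨fun t => (op d y₀ (unweight d x) t).1, fun t => (op d y₀ (unweight d x) t).2.1,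
    fun t => (op d y₀ (unweight d x) t).2.2, by simp [op], fun t => ?_, fun t => ?_, fun t => ?_,
    ⟨_, abs_snd_le d y₀ hX⟩, ⟨_, abs_thd_le d y₀ hX⟩⟩
  · exact (hasDerivAt_fst d y₀ hX t).congr_deriv (by rw [heq t])
  · exact (hasDerivAt_snd d y₀ hX t).congr_deriv (by conv_lhs => rw [heq t])
  · exact (hasDerivAt_thd d y₀ hX t).congr_deriv (by conv_lhs => rw [heq t])

end LyapunovPerron

/-- Truncation to the interval `[-r, r]`. -/
noncomputable def clamp (r x : ℝ) : ℝ := max (-r) (min r x)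

theorem abs_clamp_sub_le (r x x' : ℝ) : |clamp r x - clamp r x'| ≤ |x - x'| := by
  refine (abs_max_sub_max_le_max _ _ _ _).trans ?_
  refine max_le (by simp) ?_
  exact (abs_min_sub_min_le_max _ _ _ _).trans (max_le (by simp) le_rfl)

theorem abs_clamp_le {r : ℝ} (hr : 0 ≤ r) (x : ℝ) : |clamp r x| ≤ r :=
  abs_le.2 ⟨le_max_left _ _, max_le (by linarith) (min_le_left _ _)⟩

theorem clamp_eq_self {r x : ℝ} (h : |x| ≤ r) : clamp r x = x := by
  rw [clamp, min_eq_right (abs_le.1 h).2, max_eq_right (abs_le.1 h).1]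

/-- The nonlinear part of the equation for the specific volume. -/
noncomputable def nlVolume (T e v Φ ψ : ℝ) : ℝ :=
  -(T * (v ^ 2 / (1 + v))) - (Real.exp Φ - 1 - Φ) + (T + 1) * e + ψ ^ 2 / 2

/-- The nonlinear part of the Poisson equation. -/
noncomputable def nlPoisson (v Φ : ℝ) : ℝ := (Real.exp Φ - 1 - Φ) - v ^ 2 / (1 + v)

theorem abs_sq_div_sub_le {r v v' : ℝ} (hr : r ≤ 1 / 2) (h : |v| ≤ r) (h' : |v'| ≤ r) :
    |v ^ 2 / (1 + v) - v' ^ 2 / (1 + v')| ≤ 10 * r * |v - v'| := by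
  have h1 := abs_le.1 h
  have h2 := abs_le.1 h'
  have p1 : 1 / 2 ≤ 1 + v := by linarith
  have p2 : 1 / 2 ≤ 1 + v' := by linarith
  have hr0 : 0 ≤ r := (abs_nonneg _).trans h
  have e : v ^ 2 / (1 + v) - v' ^ 2 / (1 + v')
      = (v + v' + v * v') / ((1 + v) * (1 + v')) * (v - v') := by
    field_simp; ring
  rw [e, abs_mul]
  refine mul_le_mul_of_nonneg_right ?_ (abs_nonneg _)
  have hm : 1 / 4 ≤ (1 + v) * (1 + v') := by nlinarith
  rw [abs_div, abs_of_pos (by linarith : 0 < (1 + v) * (1 + v')), div_le_iff₀ (by linarith)]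
  have h3 : |v + v' + v * v'| ≤ r + r + r * r := by
    refine (abs_add_le _ _).trans (add_le_add ((abs_add_le _ _).trans (add_le_add h h')) ?_)
    rw [abs_mul]; exact mul_le_mul h h' (abs_nonneg _) hr0
  nlinarith

theorem abs_exp_sub_le {r x x' : ℝ} (hr : r ≤ 1 / 2) (h : |x| ≤ r) (h' : |x'| ≤ r) :
    |(Real.exp x - 1 - x) - (Real.exp x' - 1 - x')| ≤ 2 * r * |x - x'| := by
  have hd : ∀ s ∈ Set.Icc (-r) r, HasDerivWithinAt (fun s => Real.exp s - 1 - s)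
      (Real.exp s - 1) (Set.Icc (-r) r) s := fun s _ =>
    (((Real.hasDerivAt_exp s).sub_const 1).sub (hasDerivAt_id s)).hasDerivWithinAt
  have hb : ∀ s ∈ Set.Icc (-r) r, ‖Real.exp s - 1‖ ≤ 2 * r := fun s hs => by
    have hs' : |s| ≤ r := abs_le.2 hs
    exact (Real.abs_exp_sub_one_le (by linarith)).trans (by linarith)
  exact (convex_Icc (-r) r).norm_image_sub_le_of_norm_hasDerivWithin_le hd hb (abs_le.1 h')
    (abs_le.1 h)

section

variable {T e r v Φ ψ v' Φ' ψ' : ℝ}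

theorem abs_nlPoisson_sub_le (hr : r ≤ 1 / 2) (h1 : |v| ≤ r) (h1' : |v'| ≤ r) (h2 : |Φ| ≤ r)
    (h2' : |Φ'| ≤ r) :
    |nlPoisson v Φ - nlPoisson v' Φ'| ≤ 10 * r * (|v - v'| + |Φ - Φ'|) := by
  have e1 := abs_sq_div_sub_le hr h1 h1'
  have e2 := abs_exp_sub_le hr h2 h2'
  have hr0 : 0 ≤ r := (abs_nonneg _).trans h1
  have e3 : nlPoisson v Φ - nlPoisson v' Φ'
      = ((Real.exp Φ - 1 - Φ) - (Real.exp Φ' - 1 - Φ'))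
        - (v ^ 2 / (1 + v) - v' ^ 2 / (1 + v')) := by unfold nlPoisson; ring
  rw [e3]
  refine (abs_sub _ _).trans ?_
  nlinarith [abs_nonneg (Φ - Φ'), mul_nonneg hr0 (abs_nonneg (Φ - Φ'))]

theorem abs_nlVolume_sub_le (hT : 0 ≤ T) (hr : r ≤ 1 / 2) (h1 : |v| ≤ r) (h1' : |v'| ≤ r)
    (h2 : |Φ| ≤ r) (h2' : |Φ'| ≤ r) (h3 : |ψ| ≤ r) (h3' : |ψ'| ≤ r) :
    |nlVolume T e v Φ ψ - nlVolume T e v' Φ' ψ'|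
      ≤ 10 * (T + 1) * r * (|v - v'| + |Φ - Φ'| + |ψ - ψ'|) := by
  have e1 := mul_le_mul_of_nonneg_left (abs_sq_div_sub_le hr h1 h1') hT
  have e2 := abs_exp_sub_le hr h2 h2'
  have hr0 : 0 ≤ r := (abs_nonneg _).trans h1
  have e4 : |ψ ^ 2 / 2 - ψ' ^ 2 / 2| ≤ r * |ψ - ψ'| := by
    rw [show ψ ^ 2 / 2 - ψ' ^ 2 / 2 = (ψ + ψ') / 2 * (ψ - ψ') by ring, abs_mul]
    refine mul_le_mul_of_nonneg_right ?_ (abs_nonneg _)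
    rw [abs_le] at *
    constructor <;> linarith [h3.1, h3.2, h3'.1, h3'.2]
  have e3 : nlVolume T e v Φ ψ - nlVolume T e v' Φ' ψ'
      = -(T * (v ^ 2 / (1 + v) - v' ^ 2 / (1 + v')))
        - ((Real.exp Φ - 1 - Φ) - (Real.exp Φ' - 1 - Φ')) + (ψ ^ 2 / 2 - ψ' ^ 2 / 2) := by
    unfold nlVolume; ring
  rw [e3]
  refine (abs_add_le _ _).trans ?_
  have e5 : |-(T * (v ^ 2 / (1 + v) - v' ^ 2 / (1 + v')))
      - ((Real.exp Φ - 1 - Φ) - (Real.exp Φ' - 1 - Φ'))|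
      ≤ T * (10 * r * |v - v'|) + 2 * r * |Φ - Φ'| := by
    refine (abs_sub _ _).trans (add_le_add ?_ e2)
    rw [abs_neg, abs_mul, abs_of_nonneg hT]; exact e1
  have i1 := mul_nonneg hr0 (abs_nonneg (v - v'))
  have i2 := mul_nonneg hr0 (abs_nonneg (Φ - Φ'))
  have i3 := mul_nonneg hr0 (abs_nonneg (ψ - ψ'))
  have i4 := mul_nonneg hT i2
  have i5 := mul_nonneg hT i3
  nlinarith

end

/-- The profile equations in normalised form, for the specific volume `w`, the potential `Φ` and
the field `ψ = Φ'`; the end states are `w = c` and `w = 1 / c`. -/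
structure NormalisedSystem (T a c : ℝ) (w Φ ψ : ℝ → ℝ) : Prop where
  pos : ∀ t, 0 < w t
  hw : ∀ t, HasDerivAt w (-a * ((T + 1) * w t + T / w t + Real.exp (Φ t) - ψ t ^ 2 / 2
    - (T + 1) * (c + 1 / c))) t
  hΦ : ∀ t, HasDerivAt Φ (ψ t) t
  hψ : ∀ t, HasDerivAt ψ (Real.exp (Φ t) - 1 / w t) t

/-- The coordinates that diagonalise the linearised system, in terms of those. -/
noncomputable def fieldOf (σ p q : ℝ) : ℝ := (p + σ * q) / (1 + σ ^ 2)

noncomputable def volumeOf (a σ y p q : ℝ) : ℝ := y - a * fieldOf σ p q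

noncomputable def potentialOf (a σ y p q : ℝ) : ℝ :=
  (σ * p - q) / (1 + σ ^ 2) - volumeOf a σ y p q

noncomputable def clampedVolume (T a σ e r y p q : ℝ) : ℝ :=
  nlVolume T e (clamp r (volumeOf a σ y p q)) (clamp r (potentialOf a σ y p q))
    (clamp r (fieldOf σ p q))

noncomputable def clampedPoisson (a σ r y p q : ℝ) : ℝ :=
  nlPoisson (clamp r (volumeOf a σ y p q)) (clamp r (potentialOf a σ y p q))

/-- The standing assumptions on the parameters. -/
structure Params (T a A σ r κ : ℝ) : Prop where
  T_nonneg : 0 ≤ T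
  a_pos : 0 < a
  a_le : a ≤ A
  σ_pos : 0 < σ
  σ_eq : σ ^ 2 + a * σ = 1
  r_pos : 0 < r
  κ_pos : 0 < κ
  κ_le : κ ≤ 1 / 2
  r_le : 800 * (1 + A) ^ 3 * (T + 1) * r ≤ κ

namespace Params

variable {T a A σ r κ : ℝ} (P : Params T a A σ r κ)

theorem A_pos (P : Params T a A σ r κ) : 0 < A := P.a_pos.trans_le P.a_le

theorem σ_lt (P : Params T a A σ r κ) : σ < 1 := by nlinarith [P.σ_pos, P.σ_eq, P.a_pos, mul_pos P.a_pos P.σ_pos]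

theorem inv_le_σ (P : Params T a A σ r κ) : 1 / (1 + A) ≤ σ := by
  have := P.A_pos
  rw [div_le_iff₀ (by linarith)]
  nlinarith [P.σ_pos, P.σ_eq, P.a_pos, P.a_le, P.σ_lt]

theorem r_small (P : Params T a A σ r κ) : 800 * r ≤ κ := by
  have h1 : (1 : ℝ) ≤ (1 + A) ^ 3 := one_le_pow₀ (by linarith [P.A_pos])
  have h2 : 1 ≤ (1 + A) ^ 3 * (T + 1) := by nlinarith [P.T_nonneg]
  nlinarith [P.r_le, P.r_pos]

theorem r_le_half (P : Params T a A σ r κ) : r ≤ 1 / 2 := by linarith [P.r_small, P.κ_le, P.r_pos]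

theorem abs_field_le (P : Params T a A σ r κ) (p q : ℝ) : |fieldOf σ p q| ≤ |p| + |q| := by
  have h := P.σ_pos
  have h1 := P.σ_lt
  have h0 : (0 : ℝ) < 1 + σ ^ 2 := by positivity
  rw [fieldOf, abs_div, abs_of_pos h0, div_le_iff₀ h0]
  refine (abs_add_le _ _).trans ?_
  rw [abs_mul, abs_of_pos h]
  nlinarith [abs_nonneg p, abs_nonneg q, mul_nonneg (sq_nonneg σ) (abs_nonneg p),
    mul_nonneg (sq_nonneg σ) (abs_nonneg q)]

theorem abs_fast_le (P : Params T a A σ r κ) (p q : ℝ) : |(σ * p - q) / (1 + σ ^ 2)| ≤ |p| + |q| := by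
  have h := P.σ_pos
  have h1 := P.σ_lt
  have h0 : (0 : ℝ) < 1 + σ ^ 2 := by positivity
  rw [abs_div, abs_of_pos h0, div_le_iff₀ h0]
  refine (abs_sub _ _).trans ?_
  rw [abs_mul, abs_of_pos h]
  nlinarith [abs_nonneg p, abs_nonneg q, mul_nonneg (sq_nonneg σ) (abs_nonneg p),
    mul_nonneg (sq_nonneg σ) (abs_nonneg q)]

theorem abs_volume_le (P : Params T a A σ r κ) (y p q : ℝ) : |volumeOf a σ y p q| ≤ |y| + A * (|p| + |q|) := by
  refine (abs_sub _ _).trans (add_le_add le_rfl ?_)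
  rw [abs_mul, abs_of_pos P.a_pos]
  exact mul_le_mul P.a_le (P.abs_field_le p q) (abs_nonneg _) P.A_pos.le

theorem abs_potential_le (P : Params T a A σ r κ) (y p q : ℝ) :
    |potentialOf a σ y p q| ≤ |y| + (1 + A) * (|p| + |q|) := by
  refine (abs_sub _ _).trans ?_
  linarith [P.abs_fast_le p q, P.abs_volume_le y p q]

theorem field_sub (p q p' q' : ℝ) :
    fieldOf σ p q - fieldOf σ p' q' = fieldOf σ (p - p') (q - q') := by
  unfold fieldOf; ring

theorem volume_sub (y p q y' p' q' : ℝ) : volumeOf a σ y p q - volumeOf a σ y' p' q'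
    = volumeOf a σ (y - y') (p - p') (q - q') := by
  unfold volumeOf fieldOf; ring

theorem potential_sub (y p q y' p' q' : ℝ) : potentialOf a σ y p q - potentialOf a σ y' p' q'
    = potentialOf a σ (y - y') (p - p') (q - q') := by
  unfold potentialOf volumeOf fieldOf; ring

theorem abs_clampedVolume_sub_le (P : Params T a A σ r κ) (e y p q y' p' q' : ℝ) :
    |clampedVolume T a σ e r y p q - clampedVolume T a σ e r y' p' q'|
      ≤ 20 * (T + 1) * (1 + A) * r * (|y - y'| + |p - p'| + |q - q'|) := by
  have hr := P.r_pos.le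
  refine (abs_nlVolume_sub_le P.T_nonneg P.r_le_half (abs_clamp_le hr _) (abs_clamp_le hr _)
    (abs_clamp_le hr _) (abs_clamp_le hr _) (abs_clamp_le hr _) (abs_clamp_le hr _)).trans ?_
  have h1 := (abs_clamp_sub_le r (volumeOf a σ y p q) (volumeOf a σ y' p' q')).trans_eq
    (congrArg _ (volume_sub y p q y' p' q'))
  have h2 := (abs_clamp_sub_le r (potentialOf a σ y p q) (potentialOf a σ y' p' q')).trans_eq
    (congrArg _ (potential_sub y p q y' p' q'))
  have h3 := (abs_clamp_sub_le r (fieldOf σ p q) (fieldOf σ p' q')).trans_eq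
    (congrArg _ (field_sub p q p' q'))
  have h1' := h1.trans (P.abs_volume_le _ _ _)
  have h2' := h2.trans (P.abs_potential_le _ _ _)
  have h3' := h3.trans (P.abs_field_le _ _)
  have hc : 0 ≤ 10 * (T + 1) * r := by have := P.T_nonneg; positivity
  have hs : |clamp r (volumeOf a σ y p q) - clamp r (volumeOf a σ y' p' q')|
      + |clamp r (potentialOf a σ y p q) - clamp r (potentialOf a σ y' p' q')|
      + |clamp r (fieldOf σ p q) - clamp r (fieldOf σ p' q')|
      ≤ 2 * (1 + A) * (|y - y'| + |p - p'| + |q - q'|) := by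
    nlinarith [mul_nonneg P.A_pos.le (abs_nonneg (y - y'))]
  refine (mul_le_mul_of_nonneg_left hs hc).trans_eq ?_
  ring

theorem abs_clampedPoisson_sub_le (P : Params T a A σ r κ) (y p q y' p' q' : ℝ) :
    |clampedPoisson a σ r y p q - clampedPoisson a σ r y' p' q'|
      ≤ 20 * (T + 1) * (1 + A) * r * (|y - y'| + |p - p'| + |q - q'|) := by
  have hr := P.r_pos.le
  refine (abs_nlPoisson_sub_le P.r_le_half (abs_clamp_le hr _) (abs_clamp_le hr _)
    (abs_clamp_le hr _) (abs_clamp_le hr _)).trans ?_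
  have h1 := (abs_clamp_sub_le r (volumeOf a σ y p q) (volumeOf a σ y' p' q')).trans_eq
    (congrArg _ (volume_sub y p q y' p' q'))
  have h2 := (abs_clamp_sub_le r (potentialOf a σ y p q) (potentialOf a σ y' p' q')).trans_eq
    (congrArg _ (potential_sub y p q y' p' q'))
  have h1' := h1.trans (P.abs_volume_le _ _ _)
  have h2' := h2.trans (P.abs_potential_le _ _ _)
  have hs : |clamp r (volumeOf a σ y p q) - clamp r (volumeOf a σ y' p' q')|
      + |clamp r (potentialOf a σ y p q) - clamp r (potentialOf a σ y' p' q')|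
      ≤ 2 * (1 + A) * (|y - y'| + |p - p'| + |q - q'|) := by
    nlinarith [mul_nonneg P.A_pos.le (abs_nonneg (y - y')), abs_nonneg (p - p'),
      abs_nonneg (q - q')]
  have hX : 0 ≤ (1 + A) * (|y - y'| + |p - p'| + |q - q'|) := by have := P.A_pos; positivity
  have := mul_le_mul_of_nonneg_left hs (by linarith : 0 ≤ 10 * r)
  nlinarith [mul_nonneg (mul_nonneg P.T_nonneg hr) hX]

/-- A combination of the nonlinear terms with coefficients of size at most `1 + A` has a small
Lipschitz constant. -/
theorem abs_combination_sub_le (P : Params T a A σ r κ) {α β : ℝ} (hα : |α| ≤ 1 + A) (hβ : |β| ≤ 1 + A)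
    (e y p q y' p' q' : ℝ) :
    |(α * clampedVolume T a σ e r y p q + β * clampedPoisson a σ r y p q)
      - (α * clampedVolume T a σ e r y' p' q' + β * clampedPoisson a σ r y' p' q')|
      ≤ 40 * (T + 1) * (1 + A) ^ 2 * r * (|y - y'| + |p - p'| + |q - q'|) := by
  have h1 := P.abs_clampedVolume_sub_le e y p q y' p' q'
  have h2 := P.abs_clampedPoisson_sub_le y p q y' p' q'
  have e : (α * clampedVolume T a σ e r y p q + β * clampedPoisson a σ r y p q)
      - (α * clampedVolume T a σ e r y' p' q' + β * clampedPoisson a σ r y' p' q')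
      = α * (clampedVolume T a σ e r y p q - clampedVolume T a σ e r y' p' q')
        + β * (clampedPoisson a σ r y p q - clampedPoisson a σ r y' p' q') := by ring
  rw [e]
  refine (abs_add_le _ _).trans ?_
  rw [abs_mul, abs_mul]
  have hA := P.A_pos
  have i1 := mul_le_mul hα h1 (abs_nonneg _) (by linarith)
  have i2 := mul_le_mul hβ h2 (abs_nonneg _) (by linarith)
  nlinarith

theorem abs_a_le (P : Params T a A σ r κ) : |a| ≤ 1 + A := by
  rw [abs_of_pos P.a_pos]; linarith [P.a_le]

theorem abs_σa_le (P : Params T a A σ r κ) : |σ * a| ≤ 1 + A := by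
  rw [abs_of_pos (mul_pos P.σ_pos P.a_pos)]
  nlinarith [P.σ_eq, P.A_pos, sq_nonneg σ]

theorem abs_neg_a_le (P : Params T a A σ r κ) : |-a| ≤ 1 + A := by rw [abs_neg]; exact P.abs_a_le

theorem abs_σ_le (P : Params T a A σ r κ) : |σ| ≤ 1 + A := by
  rw [abs_of_pos P.σ_pos]; linarith [P.σ_lt, P.A_pos]

theorem abs_one_le (P : Params T a A σ r κ) : |(1 : ℝ)| ≤ 1 + A := by rw [abs_one]; linarith [P.A_pos]

theorem smallness (P : Params T a A σ r κ) : 20 * (40 * (T + 1) * (1 + A) ^ 2 * r) ≤ 1 / (1 + A) * κ := by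
  have hA : 0 < 1 + A := by linarith [P.A_pos]
  rw [div_mul_eq_mul_div, one_mul, le_div_iff₀ hA]
  nlinarith [P.r_le]

theorem lip_nonneg (P : Params T a A σ r κ) : 0 ≤ 40 * (T + 1) * (1 + A) ^ 2 * r := by
  have := P.T_nonneg
  have := P.A_pos
  have := P.r_pos
  positivity

theorem inv_pos (P : Params T a A σ r κ) : 0 < 1 / (1 + A) := by have := P.A_pos; positivity

theorem inv_le_τ (P : Params T a A σ r κ) : 1 / (1 + A) ≤ σ + a := by linarith [P.inv_le_σ, P.a_pos]

end Params

/-- A trajectory of the truncated system along which the fast variables are bounded. -/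
structure ClampedTraj (T a σ e r : ℝ) (y p q : ℝ → ℝ) : Prop where
  hy : ∀ t, HasDerivAt y (a * clampedVolume T a σ e r (y t) (p t) (q t)
    + a * clampedPoisson a σ r (y t) (p t) (q t)) t
  hp : ∀ t, HasDerivAt p (σ * p t + (σ * a * clampedVolume T a σ e r (y t) (p t) (q t)
    + 1 * clampedPoisson a σ r (y t) (p t) (q t))) t
  hq : ∀ t, HasDerivAt q (-((σ + a) * q t) + (-a * clampedVolume T a σ e r (y t) (p t) (q t)
    + σ * clampedPoisson a σ r (y t) (p t) (q t))) t
  bdd_p : ∃ B, ∀ t, |p t| ≤ B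
  bdd_q : ∃ B, ∀ t, |q t| ≤ B

namespace ClampedTraj

variable {T a A σ r κ e : ℝ} {y p q y' p' q' : ℝ → ℝ}

theorem slowCone (P : Params T a A σ r κ) (h : ClampedTraj T a σ e r y p q)
    (h' : ClampedTraj T a σ e r y' p' q') : ∃ dy dp dq, SlowCone
      (40 * (T + 1) * (1 + A) ^ 2 * r) σ (σ + a) (fun t => y t - y' t) (fun t => p t - p' t)
      (fun t => q t - q' t) dy dp dq := by
  obtain ⟨B₁, hB₁⟩ := h.bdd_p
  obtain ⟨B₂, hB₂⟩ := h.bdd_q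
  obtain ⟨B₃, hB₃⟩ := h'.bdd_p
  obtain ⟨B₄, hB₄⟩ := h'.bdd_q
  refine ⟨_, _, _, fun t => (h.hy t).sub (h'.hy t), fun t => (h.hp t).sub (h'.hp t),
    fun t => (h.hq t).sub (h'.hq t), fun t => ?_, fun t => ?_, fun t => ?_,
    ⟨B₁ + B₃, fun t => (abs_sub _ _).trans (add_le_add (hB₁ t) (hB₃ t))⟩,
    ⟨B₂ + B₄, fun t => (abs_sub _ _).trans (add_le_add (hB₂ t) (hB₄ t))⟩⟩
  · exact P.abs_combination_sub_le P.abs_a_le P.abs_a_le e _ _ _ _ _ _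
  · refine le_trans (le_of_eq (congrArg _ ?_))
      (P.abs_combination_sub_le P.abs_σa_le P.abs_one_le e _ _ _ _ _ _)
    ring
  · refine le_trans (le_of_eq (congrArg _ ?_))
      (P.abs_combination_sub_le P.abs_neg_a_le P.abs_σ_le e _ _ _ _ _ _)
    ring

theorem abs_sub_le (P : Params T a A σ r κ) (h : ClampedTraj T a σ e r y p q)
    (h' : ClampedTraj T a σ e r y' p' q') (t : ℝ) :
    |p t - p' t| ≤ 2 * κ * |y t - y' t| ∧ |q t - q' t| ≤ 2 * κ * |y t - y' t| := by
  obtain ⟨dy, dp, dq, hc⟩ := slowCone P h h'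
  exact hc.abs_le P.inv_pos P.inv_le_σ P.inv_le_τ P.κ_pos (by linarith [P.κ_le]) P.lip_nonneg
    P.smallness t

theorem smallness' (P : Params T a A σ r κ) :
    20 * (40 * (T + 1) * (1 + A) ^ 2 * r) ≤ 1 / (1 + A) := by
  have := P.smallness
  nlinarith [P.κ_le, P.inv_pos]

theorem pos_sub (P : Params T a A σ r κ) (h : ClampedTraj T a σ e r y p q)
    (h' : ClampedTraj T a σ e r y' p' q') {t₀ : ℝ} (h0 : y' t₀ < y t₀) (t : ℝ) : y' t < y t := by
  obtain ⟨dy, dp, dq, hc⟩ := slowCone P h h'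
  exact sub_pos.1 (hc.pos P.inv_pos P.inv_le_σ P.inv_le_τ P.lip_nonneg (smallness' P)
    (sub_pos.2 h0) t)

theorem eq_of_eq (P : Params T a A σ r κ) (h : ClampedTraj T a σ e r y p q)
    (h' : ClampedTraj T a σ e r y' p' q') {t₀ : ℝ} (h0 : y t₀ = y' t₀) (t : ℝ) :
    y t = y' t ∧ p t = p' t ∧ q t = q' t := by
  obtain ⟨dy, dp, dq, hc⟩ := slowCone P h h'
  have h1 := hc.eq_zero P.inv_pos P.inv_le_σ P.inv_le_τ P.lip_nonneg (smallness' P)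
    (sub_eq_zero.2 h0) t
  have h2 := abs_sub_le P h h' t
  rw [h1] at h2
  simp only [abs_zero, mul_zero, abs_nonpos_iff] at h2
  exact ⟨sub_eq_zero.1 h1, sub_eq_zero.1 h2.1, sub_eq_zero.1 h2.2⟩

theorem comp_add (h : ClampedTraj T a σ e r y p q) (s : ℝ) :
    ClampedTraj T a σ e r (fun t => y (t + s)) (fun t => p (t + s)) (fun t => q (t + s)) := by
  obtain ⟨B₁, hB₁⟩ := h.bdd_p
  obtain ⟨B₂, hB₂⟩ := h.bdd_q
  exact ⟨fun t => (h.hy (t + s)).comp_add_const t s, fun t => (h.hp (t + s)).comp_add_const t s,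
    fun t => (h.hq (t + s)).comp_add_const t s, ⟨B₁, fun t => hB₁ _⟩, ⟨B₂, fun t => hB₂ _⟩⟩

theorem abs_deriv_le (P : Params T a A σ r κ) (h : ClampedTraj T a σ e r y p q) (t : ℝ) :
    |deriv p t| ≤ 2 * κ * |deriv y t| ∧ |deriv q t| ≤ 2 * κ * |deriv y t| := by
  have key : ∀ s, |p (t + s) - p t| ≤ 2 * κ * |y (t + s) - y t| ∧
      |q (t + s) - q t| ≤ 2 * κ * |y (t + s) - y t| := fun s => abs_sub_le P (h.comp_add s) h t
  have hy := ((h.hy t).differentiableAt.hasDerivAt.tendsto_slope_zero).abs.const_mul (2 * κ)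
  have hp := ((h.hp t).differentiableAt.hasDerivAt.tendsto_slope_zero).abs
  have hq := ((h.hq t).differentiableAt.hasDerivAt.tendsto_slope_zero).abs
  constructor
  · refine le_of_tendsto_of_tendsto hp hy (Eventually.of_forall fun s => ?_)
    simp only [smul_eq_mul, abs_mul]
    nlinarith [mul_le_mul_of_nonneg_left (key s).1 (abs_nonneg s⁻¹)]
  · refine le_of_tendsto_of_tendsto hq hy (Eventually.of_forall fun s => ?_)
    simp only [smul_eq_mul, abs_mul]
    nlinarith [mul_le_mul_of_nonneg_left (key s).2 (abs_nonneg s⁻¹)]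

theorem exists_through (P : Params T a A σ r κ) (e y₀ : ℝ) :
    ∃ y p q, ClampedTraj T a σ e r y p q ∧ y 0 = y₀ := by
  have hlip : ∀ α β : ℝ, |α| ≤ 1 + A → |β| ≤ 1 + A → ∀ X X' : ℝ × ℝ × ℝ,
      |(α * clampedVolume T a σ e r X.1 X.2.1 X.2.2 + β * clampedPoisson a σ r X.1 X.2.1 X.2.2)
        - (α * clampedVolume T a σ e r X'.1 X'.2.1 X'.2.2
          + β * clampedPoisson a σ r X'.1 X'.2.1 X'.2.2)|
        ≤ 3 * (40 * (T + 1) * (1 + A) ^ 2 * r) * ‖X - X'‖ := fun α β hα hβ X X' => by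
    refine (P.abs_combination_sub_le hα hβ e _ _ _ _ _ _).trans ?_
    have h1 : |X.1 - X'.1| ≤ ‖X - X'‖ := norm_fst_le (X - X')
    have h2 : |X.2.1 - X'.2.1| ≤ ‖X - X'‖ :=
      (norm_fst_le (X - X').2).trans (norm_snd_le (X - X'))
    have h3 : |X.2.2 - X'.2.2| ≤ ‖X - X'‖ :=
      (norm_snd_le (X - X').2).trans (norm_snd_le (X - X'))
    nlinarith [P.lip_nonneg]
  have hr := P.r_pos.le
  have hT := P.T_nonneg
  have hbv : ∀ X : ℝ × ℝ × ℝ, |clampedVolume T a σ e r X.1 X.2.1 X.2.2|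
      ≤ 10 * (T + 1) * r * (r + r + r) + |(T + 1) * e| := fun X => by
    have h0 : |(0 : ℝ)| ≤ r := by simpa using hr
    have h1 := abs_nlVolume_sub_le (e := e) hT P.r_le_half
      (abs_clamp_le hr (volumeOf a σ X.1 X.2.1 X.2.2)) h0
      (abs_clamp_le hr (potentialOf a σ X.1 X.2.1 X.2.2)) h0
      (abs_clamp_le hr (fieldOf σ X.2.1 X.2.2)) h0
    simp only [sub_zero] at h1
    have h2 : nlVolume T e 0 0 0 = (T + 1) * e := by simp [nlVolume]
    rw [h2] at h1
    have h3 : 10 * (T + 1) * r * (|clamp r (volumeOf a σ X.1 X.2.1 X.2.2)|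
        + |clamp r (potentialOf a σ X.1 X.2.1 X.2.2)| + |clamp r (fieldOf σ X.2.1 X.2.2)|)
        ≤ 10 * (T + 1) * r * (r + r + r) := by
      refine mul_le_mul_of_nonneg_left (add_le_add (add_le_add ?_ ?_) ?_) (by positivity) <;>
        exact abs_clamp_le hr _
    have h4 := abs_sub_abs_le_abs_sub (clampedVolume T a σ e r X.1 X.2.1 X.2.2) ((T + 1) * e)
    unfold clampedVolume at h4 ⊢
    linarith
  have hbp : ∀ X : ℝ × ℝ × ℝ, |clampedPoisson a σ r X.1 X.2.1 X.2.2|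
      ≤ 10 * (T + 1) * r * (r + r + r) + |(T + 1) * e| := fun X => by
    have h0 : |(0 : ℝ)| ≤ r := by simpa using hr
    have h1 := abs_nlPoisson_sub_le P.r_le_half
      (abs_clamp_le hr (volumeOf a σ X.1 X.2.1 X.2.2)) h0
      (abs_clamp_le hr (potentialOf a σ X.1 X.2.1 X.2.2)) h0
    simp only [sub_zero] at h1
    have h2 : nlPoisson 0 0 = 0 := by simp [nlPoisson]
    rw [h2, sub_zero] at h1
    have h3 : 10 * r * (|clamp r (volumeOf a σ X.1 X.2.1 X.2.2)|
        + |clamp r (potentialOf a σ X.1 X.2.1 X.2.2)|) ≤ 10 * r * (r + r) := by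
      refine mul_le_mul_of_nonneg_left (add_le_add ?_ ?_) (by positivity) <;>
        exact abs_clamp_le hr _
    have h4 : 0 ≤ T * r * r := by positivity
    unfold clampedPoisson
    nlinarith [abs_nonneg ((T + 1) * e), mul_nonneg hr hr]
  set M := 10 * (T + 1) * r * (r + r + r) + |(T + 1) * e| with hM
  have hM0 : 0 ≤ M := (abs_nonneg _).trans (hbp 0)
  have hbdd : ∀ α β : ℝ, |α| ≤ 1 + A → |β| ≤ 1 + A → ∀ X : ℝ × ℝ × ℝ,
      |α * clampedVolume T a σ e r X.1 X.2.1 X.2.2 + β * clampedPoisson a σ r X.1 X.2.1 X.2.2|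
        ≤ 2 * ((1 + A) * M) := fun α β hα hβ X => by
    refine (abs_add_le _ _).trans ?_
    rw [abs_mul, abs_mul, two_mul]
    exact add_le_add (mul_le_mul hα (hbv X) (abs_nonneg _) (by linarith [P.A_pos]))
      (mul_le_mul hβ (hbp X) (abs_nonneg _) (by linarith [P.A_pos]))
  obtain ⟨y, p, q, h0, hy, hp, hq, hpB, hqB⟩ := LyapunovPerron.exists_trajectory
    { f := fun X => a * clampedVolume T a σ e r X.1 X.2.1 X.2.2
        + a * clampedPoisson a σ r X.1 X.2.1 X.2.2
      g := fun X => σ * a * clampedVolume T a σ e r X.1 X.2.1 X.2.2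
        + 1 * clampedPoisson a σ r X.1 X.2.1 X.2.2
      k := fun X => -a * clampedVolume T a σ e r X.1 X.2.1 X.2.2
        + σ * clampedPoisson a σ r X.1 X.2.1 X.2.2
      σ := σ
      τ := σ + a
      σ₀ := 1 / (1 + A)
      ε := 3 * (40 * (T + 1) * (1 + A) ^ 2 * r)
      M := 2 * ((1 + A) * M)
      ε_nonneg := by linarith [P.lip_nonneg]
      σ₀_pos := P.inv_pos
      le_σ := P.inv_le_σ
      le_τ := P.inv_le_τ
      small := by linarith [smallness' P, P.lip_nonneg]
      lip_f := hlip _ _ P.abs_a_le P.abs_a_le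
      lip_g := hlip _ _ P.abs_σa_le P.abs_one_le
      lip_k := hlip _ _ P.abs_neg_a_le P.abs_σ_le
      bdd_f := hbdd _ _ P.abs_a_le P.abs_a_le
      bdd_g := hbdd _ _ P.abs_σa_le P.abs_one_le
      bdd_k := hbdd _ _ P.abs_neg_a_le P.abs_σ_le } y₀
  exact ⟨y, p, q, ⟨hy, hp, hq, hpB, hqB⟩, h0⟩

end ClampedTraj

theorem NormalisedSystem.const {T a c c' : ℝ} (hc' : 0 < c') (h : c' + 1 / c' = c + 1 / c) :
    NormalisedSystem T a c (fun _ => c') (fun _ => -Real.log c') (fun _ => 0) := by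
  have e : Real.exp (-Real.log c') = 1 / c' := by rw [Real.exp_neg, Real.exp_log hc', one_div]
  refine ⟨fun _ => hc', fun t => (hasDerivAt_const t c').congr_deriv ?_,
    fun t => hasDerivAt_const t _, fun t => (hasDerivAt_const t (0 : ℝ)).congr_deriv ?_⟩
  · rw [e, ← h]; ring
  · rw [e, sub_self]

/-- The box in which the nonlinear terms are a small perturbation. -/
def InBox (r : ℝ) (w Φ ψ : ℝ → ℝ) : Prop := ∀ t, |w t - 1| ≤ r ∧ |Φ t| ≤ r ∧ |ψ t| ≤ r

section Coordinates

variable {T a A σ r κ c : ℝ} {w Φ ψ w' Φ' ψ' : ℝ → ℝ}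

theorem fieldOf_coord (v Φ ψ : ℝ) : fieldOf σ (σ * (Φ + v) + ψ) (-(Φ + v) + σ * ψ) = ψ := by
  have : (1 + σ ^ 2 : ℝ) ≠ 0 := by positivity
  unfold fieldOf; field_simp; ring

theorem volumeOf_coord (v Φ ψ : ℝ) :
    volumeOf a σ (v + a * ψ) (σ * (Φ + v) + ψ) (-(Φ + v) + σ * ψ) = v := by
  rw [volumeOf, fieldOf_coord]; ring

theorem potentialOf_coord (v Φ ψ : ℝ) :
    potentialOf a σ (v + a * ψ) (σ * (Φ + v) + ψ) (-(Φ + v) + σ * ψ) = Φ := by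
  have : (1 + σ ^ 2 : ℝ) ≠ 0 := by positivity
  rw [potentialOf, volumeOf_coord]; field_simp; ring

theorem volume_identity {T c w Φ ψ : ℝ} (hw : 0 < w) : (T + 1) * w + T / w + Real.exp Φ
    - ψ ^ 2 / 2 - (T + 1) * (c + 1 / c)
    = (w - 1) + Φ - nlVolume T (c + 1 / c - 2) (w - 1) Φ ψ := by
  rw [nlVolume, show 1 + (w - 1) = w by ring]
  field_simp; ring

theorem poisson_identity {w Φ : ℝ} (hw : 0 < w) :
    Real.exp Φ - 1 / w = Φ + (w - 1) + nlPoisson (w - 1) Φ := by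
  rw [nlPoisson, show 1 + (w - 1) = w by ring]
  field_simp; ring

theorem NormalisedSystem.clampedTraj (P : Params T a A σ r κ)
    (h : NormalisedSystem T a c w Φ ψ) (hb : InBox r w Φ ψ) :
    ClampedTraj T a σ (c + 1 / c - 2) r (fun t => (w t - 1) + a * ψ t)
      (fun t => σ * (Φ t + (w t - 1)) + ψ t) (fun t => -(Φ t + (w t - 1)) + σ * ψ t) := by
  have hcv : ∀ t, clampedVolume T a σ (c + 1 / c - 2) r ((w t - 1) + a * ψ t)
      (σ * (Φ t + (w t - 1)) + ψ t) (-(Φ t + (w t - 1)) + σ * ψ t)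
      = nlVolume T (c + 1 / c - 2) (w t - 1) (Φ t) (ψ t) := fun t => by
    rw [clampedVolume, fieldOf_coord, volumeOf_coord, potentialOf_coord, clamp_eq_self (hb t).1,
      clamp_eq_self (hb t).2.1, clamp_eq_self (hb t).2.2]
  have hcp : ∀ t, clampedPoisson a σ r ((w t - 1) + a * ψ t)
      (σ * (Φ t + (w t - 1)) + ψ t) (-(Φ t + (w t - 1)) + σ * ψ t)
      = nlPoisson (w t - 1) (Φ t) := fun t => by
    rw [clampedPoisson, volumeOf_coord, potentialOf_coord, clamp_eq_self (hb t).1,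
      clamp_eq_self (hb t).2.1]
  have hw : ∀ t, HasDerivAt (fun t => w t - 1) (-a * ((w t - 1) + Φ t
      - nlVolume T (c + 1 / c - 2) (w t - 1) (Φ t) (ψ t))) t := fun t => by
    rw [← volume_identity (h.pos t)]; exact (h.hw t).sub_const 1
  have hψ : ∀ t, HasDerivAt ψ (Φ t + (w t - 1) + nlPoisson (w t - 1) (Φ t)) t := fun t => by
    rw [← poisson_identity (h.pos t)]; exact h.hψ t
  have hσ := P.σ_pos
  have hbound : ∀ t, |Φ t + (w t - 1)| ≤ r + r := fun t =>
    (abs_add_le _ _).trans (add_le_add (hb t).2.1 (hb t).1)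
  have hσ1 : |σ| ≤ 1 := by rw [abs_of_pos hσ]; exact P.σ_lt.le
  refine ⟨fun t => ?_, fun t => ?_, fun t => ?_, ⟨1 * (r + r) + r, fun t => ?_⟩,
    ⟨(r + r) + 1 * r, fun t => ?_⟩⟩
  · simp only [hcv, hcp]
    exact ((hw t).add ((hψ t).const_mul a)).congr_deriv (by ring)
  · simp only [hcv, hcp]
    refine ((((h.hΦ t).add (hw t)).const_mul σ).add (hψ t)).congr_deriv ?_
    linear_combination (-(Φ t + (w t - 1))) * P.σ_eq
  · simp only [hcv, hcp]
    refine ((((h.hΦ t).add (hw t)).neg).add ((hψ t).const_mul σ)).congr_deriv ?_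
    linear_combination ψ t * P.σ_eq
  · refine (abs_add_le _ _).trans (add_le_add ?_ (hb t).2.2)
    rw [abs_mul]
    exact mul_le_mul hσ1 (hbound t) (abs_nonneg _) zero_le_one
  · refine (abs_add_le _ _).trans (add_le_add ?_ ?_)
    · rw [abs_neg]; exact hbound t
    · rw [abs_mul]
      exact mul_le_mul hσ1 (hb t).2.2 (abs_nonneg _) zero_le_one

theorem ClampedTraj.normalisedSystem (P : Params T a A σ r κ) {y p q : ℝ → ℝ}
    (h : ClampedTraj T a σ (c + 1 / c - 2) r y p q)
    (hb : InBox r (fun t => 1 + volumeOf a σ (y t) (p t) (q t))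
      (fun t => potentialOf a σ (y t) (p t) (q t)) (fun t => fieldOf σ (p t) (q t))) :
    NormalisedSystem T a c (fun t => 1 + volumeOf a σ (y t) (p t) (q t))
      (fun t => potentialOf a σ (y t) (p t) (q t)) (fun t => fieldOf σ (p t) (q t)) := by
  have hv : ∀ t, |volumeOf a σ (y t) (p t) (q t)| ≤ r := fun t => by simpa using (hb t).1
  have hpos : ∀ t, 0 < 1 + volumeOf a σ (y t) (p t) (q t) := fun t => by
    have := (abs_le.1 (hv t)).1
    linarith [P.r_le_half]
  have hcv : ∀ t, clampedVolume T a σ (c + 1 / c - 2) r (y t) (p t) (q t)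
      = nlVolume T (c + 1 / c - 2) (volumeOf a σ (y t) (p t) (q t))
        (potentialOf a σ (y t) (p t) (q t)) (fieldOf σ (p t) (q t)) := fun t => by
    rw [clampedVolume, clamp_eq_self (hv t), clamp_eq_self (hb t).2.1, clamp_eq_self (hb t).2.2]
  have hcp : ∀ t, clampedPoisson a σ r (y t) (p t) (q t)
      = nlPoisson (volumeOf a σ (y t) (p t) (q t)) (potentialOf a σ (y t) (p t) (q t)) :=
    fun t => by rw [clampedPoisson, clamp_eq_self (hv t), clamp_eq_self (hb t).2.1]
  have hd0 : (1 + σ ^ 2 : ℝ) ≠ 0 := by positivity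
  have hy := h.hy
  have hp := h.hp
  have hq := h.hq
  simp only [hcv, hcp] at hy hp hq
  have hF : ∀ t, HasDerivAt (fun t => fieldOf σ (p t) (q t))
      ((σ * p t - q t) / (1 + σ ^ 2) + nlPoisson (volumeOf a σ (y t) (p t) (q t))
        (potentialOf a σ (y t) (p t) (q t))) t := fun t => by
    refine (((hp t).add ((hq t).const_mul σ)).div_const _).congr_deriv ?_
    field_simp
    linear_combination (-q t) * P.σ_eq
  have hV : ∀ t, HasDerivAt (fun t => volumeOf a σ (y t) (p t) (q t))
      (a * nlVolume T (c + 1 / c - 2) (volumeOf a σ (y t) (p t) (q t))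
        (potentialOf a σ (y t) (p t) (q t)) (fieldOf σ (p t) (q t))
        - a * ((σ * p t - q t) / (1 + σ ^ 2))) t := fun t =>
    ((hy t).sub ((hF t).const_mul a)).congr_deriv (by ring)
  have hD : ∀ t, HasDerivAt (fun t => (σ * p t - q t) / (1 + σ ^ 2))
      (fieldOf σ (p t) (q t) - a * ((σ * p t - q t) / (1 + σ ^ 2))
        + a * nlVolume T (c + 1 / c - 2) (volumeOf a σ (y t) (p t) (q t))
        (potentialOf a σ (y t) (p t) (q t)) (fieldOf σ (p t) (q t))) t := fun t => by
    refine ((((hp t).const_mul σ).sub (hq t)).div_const _).congr_deriv ?_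
    unfold fieldOf
    field_simp
    linear_combination p t * P.σ_eq
  have hpot : ∀ t, potentialOf a σ (y t) (p t) (q t) + volumeOf a σ (y t) (p t) (q t)
      = (σ * p t - q t) / (1 + σ ^ 2) := fun t => by unfold potentialOf; ring
  refine ⟨hpos, fun t => ?_, fun t => ?_, fun t => ?_⟩
  · rw [volume_identity (hpos t), add_sub_cancel_left]
    refine ((hV t).const_add 1).congr_deriv ?_
    rw [← hpot t]; ring
  · exact ((hD t).sub (hV t)).congr_deriv (by ring)
  · rw [poisson_identity (hpos t), add_sub_cancel_left]
    exact (hF t).congr_deriv (by rw [← hpot t])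

/-- Two trajectories in the box differ mainly in the slow variable. -/
theorem NormalisedSystem.abs_sub_le (P : Params T a A σ r κ)
    (h : NormalisedSystem T a c w Φ ψ) (hb : InBox r w Φ ψ)
    (h' : NormalisedSystem T a c w' Φ' ψ') (hb' : InBox r w' Φ' ψ') (t : ℝ) :
    |ψ t - ψ' t| ≤ 4 * κ * |(w t - 1 + a * ψ t) - (w' t - 1 + a * ψ' t)| ∧
    |(Φ t + w t) - (Φ' t + w' t)| ≤ 4 * κ * |(w t - 1 + a * ψ t) - (w' t - 1 + a * ψ' t)| := by
  obtain ⟨h1, h2⟩ := ClampedTraj.abs_sub_le P (h.clampedTraj P hb) (h'.clampedTraj P hb') t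
  have hd0 : (1 + σ ^ 2 : ℝ) ≠ 0 := by positivity
  constructor
  · have := P.abs_field_le (σ * (Φ t + (w t - 1)) + ψ t - (σ * (Φ' t + (w' t - 1)) + ψ' t))
      (-(Φ t + (w t - 1)) + σ * ψ t - (-(Φ' t + (w' t - 1)) + σ * ψ' t))
    rw [← Params.field_sub, fieldOf_coord, fieldOf_coord] at this
    linarith
  · have := P.abs_fast_le (σ * (Φ t + (w t - 1)) + ψ t - (σ * (Φ' t + (w' t - 1)) + ψ' t))
      (-(Φ t + (w t - 1)) + σ * ψ t - (-(Φ' t + (w' t - 1)) + σ * ψ' t))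
    have e : (σ * (σ * (Φ t + (w t - 1)) + ψ t - (σ * (Φ' t + (w' t - 1)) + ψ' t))
      - (-(Φ t + (w t - 1)) + σ * ψ t - (-(Φ' t + (w' t - 1)) + σ * ψ' t))) / (1 + σ ^ 2)
      = (Φ t + w t) - (Φ' t + w' t) := by field_simp; ring
    rw [e] at this
    linarith

theorem NormalisedSystem.abs_deriv_le (P : Params T a A σ r κ)
    (h : NormalisedSystem T a c w Φ ψ) (hb : InBox r w Φ ψ) (t : ℝ) :
    |deriv ψ t| ≤ 4 * κ * |deriv w t + a * deriv ψ t| ∧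
    |ψ t + deriv w t| ≤ 4 * κ * |deriv w t + a * deriv ψ t| := by
  obtain ⟨h1, h2⟩ := ClampedTraj.abs_deriv_le P (h.clampedTraj P hb) t
  have hw := (h.hw t).differentiableAt.hasDerivAt
  have hψ := (h.hψ t).differentiableAt.hasDerivAt
  have hΦ := h.hΦ t
  have ey : deriv (fun t => w t - 1 + a * ψ t) t = deriv w t + a * deriv ψ t :=
    ((hw.sub_const 1).add (hψ.const_mul a)).deriv
  have ep : deriv (fun t => σ * (Φ t + (w t - 1)) + ψ t) t
      = σ * (ψ t + deriv w t) + deriv ψ t :=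
    (((hΦ.add (hw.sub_const 1)).const_mul σ).add hψ).deriv
  have eq : deriv (fun t => -(Φ t + (w t - 1)) + σ * ψ t) t
      = -(ψ t + deriv w t) + σ * deriv ψ t :=
    (((hΦ.add (hw.sub_const 1)).neg).add (hψ.const_mul σ)).deriv
  rw [ey, ep] at h1
  rw [ey, eq] at h2
  have hd0 : (1 + σ ^ 2 : ℝ) ≠ 0 := by positivity
  constructor
  · have := P.abs_field_le (σ * (ψ t + deriv w t) + deriv ψ t)
      (-(ψ t + deriv w t) + σ * deriv ψ t)
    rw [fieldOf_coord] at this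
    linarith
  · have := P.abs_fast_le (σ * (ψ t + deriv w t) + deriv ψ t)
      (-(ψ t + deriv w t) + σ * deriv ψ t)
    have e : (σ * (σ * (ψ t + deriv w t) + deriv ψ t)
      - (-(ψ t + deriv w t) + σ * deriv ψ t)) / (1 + σ ^ 2) = ψ t + deriv w t := by
      field_simp; ring
    rw [e] at this
    linarith

/-- Trajectories in the box are determined by the slow variable at one time. -/
theorem NormalisedSystem.eq_of_eq (P : Params T a A σ r κ)
    (h : NormalisedSystem T a c w Φ ψ) (hb : InBox r w Φ ψ)
    (h' : NormalisedSystem T a c w' Φ' ψ') (hb' : InBox r w' Φ' ψ') {t₀ : ℝ}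
    (h0 : w t₀ + a * ψ t₀ = w' t₀ + a * ψ' t₀) (t : ℝ) : w t = w' t ∧ Φ t = Φ' t := by
  obtain ⟨h1, h2, h3⟩ := ClampedTraj.eq_of_eq P (h.clampedTraj P hb) (h'.clampedTraj P hb')
    (t₀ := t₀) (by linarith) t
  have h4 := volumeOf_coord (a := a) (σ := σ) (w t - 1) (Φ t) (ψ t)
  have h5 := potentialOf_coord (a := a) (σ := σ) (w t - 1) (Φ t) (ψ t)
  rw [h1, h2, h3, volumeOf_coord] at h4
  rw [h1, h2, h3, potentialOf_coord] at h5
  exact ⟨by linarith, h5.symm⟩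

theorem NormalisedSystem.comp_add (h : NormalisedSystem T a c w Φ ψ) (s : ℝ) :
    NormalisedSystem T a c (fun t => w (t + s)) (fun t => Φ (t + s)) (fun t => ψ (t + s)) :=
  ⟨fun _ => h.pos _, fun t => (h.hw (t + s)).comp_add_const t s,
    fun t => (h.hΦ (t + s)).comp_add_const t s, fun t => (h.hψ (t + s)).comp_add_const t s⟩

end Coordinates

/-- The assumptions on the strength of the shock. -/
structure SmallShock (T a A σ r κ c : ℝ) : Prop extends Params T a A σ r κ where
  c_pos : 0 < c
  c_lt : c < 1
  κ_small : 16 * (1 + A) * κ ≤ 1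
  strength : 10 * (1 + A) * (1 / c - 1) ≤ r

namespace SmallShock

variable {T a A σ r κ c : ℝ}

theorem one_lt (S : SmallShock T a A σ r κ c) : 1 < 1 / c := by
  rw [lt_div_iff₀ S.c_pos]; linarith [S.c_lt]

theorem one_sub_le (S : SmallShock T a A σ r κ c) : 1 - c ≤ 1 / c - 1 := by
  have := S.one_lt
  have h : c * (1 / c) = 1 := mul_one_div_cancel S.c_pos.ne'
  nlinarith [S.c_pos]

theorem strength_le (S : SmallShock T a A σ r κ c) : 10 * (1 / c - 1) ≤ r := by
  have := S.one_lt
  nlinarith [S.strength, mul_pos S.A_pos (sub_pos.2 this)]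

theorem log_le (S : SmallShock T a A σ r κ c) : -Real.log c ≤ 1 / c - 1 ∧ 0 ≤ -Real.log c := by
  refine ⟨?_, by linarith [Real.log_nonpos S.c_pos.le S.c_lt.le]⟩
  rw [← Real.log_inv, ← one_div]
  exact Real.log_le_sub_one_of_pos (by have := S.c_pos; positivity)

theorem left (S : SmallShock T a A σ r κ c) :
    NormalisedSystem T a c (fun _ => c) (fun _ => -Real.log c) (fun _ => 0) :=
  NormalisedSystem.const S.c_pos rfl

theorem left_inBox (S : SmallShock T a A σ r κ c) :
    InBox r (fun _ => c) (fun _ => -Real.log c) (fun _ => 0) := fun _ => by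
  have h1 := S.one_sub_le
  have h2 := S.log_le
  have h3 := S.strength_le
  have h4 := S.one_lt
  refine ⟨abs_le.2 ⟨?_, ?_⟩, abs_le.2 ⟨?_, ?_⟩, by simpa using S.r_pos.le⟩ <;>
    linarith [S.c_lt, S.r_pos, h2.1, h2.2]

theorem right (S : SmallShock T a A σ r κ c) :
    NormalisedSystem T a c (fun _ => 1 / c) (fun _ => Real.log c) (fun _ => 0) := by
  have := NormalisedSystem.const (T := T) (a := a) (c := c) (c' := 1 / c)
    (one_div_pos.2 S.c_pos) (by rw [one_div_one_div, add_comm])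
  simpa [Real.log_inv] using this

theorem right_inBox (S : SmallShock T a A σ r κ c) :
    InBox r (fun _ => 1 / c) (fun _ => Real.log c) (fun _ => 0) := fun _ => by
  have h2 := S.log_le
  have h3 := S.strength_le
  have h4 := S.one_lt
  refine ⟨abs_le.2 ⟨?_, ?_⟩, abs_le.2 ⟨?_, ?_⟩, by simpa using S.r_pos.le⟩ <;>
    linarith [S.r_pos, h2.1, h2.2]

/-- The profile in the box. -/
theorem exists_solution (S : SmallShock T a A σ r κ c) : ∃ w Φ ψ : ℝ → ℝ,
    NormalisedSystem T a c w Φ ψ ∧ InBox r w Φ ψ ∧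
    (w 0 + a * ψ 0 = (c + 1 / c) / 2) ∧ ∀ t, c < w t + a * ψ t ∧ w t + a * ψ t < 1 / c := by
  have P := S.toParams
  obtain ⟨y, p, q, htr, h0⟩ := ClampedTraj.exists_through P (c + 1 / c - 2) ((c + 1 / c) / 2 - 1)
  have hL := S.left.clampedTraj P S.left_inBox
  have hR := S.right.clampedTraj P S.right_inBox
  have h1 := S.one_lt
  have h2 := S.c_lt
  have h3 := S.one_sub_le
  have h4 := S.log_le
  have hA := S.A_pos
  have yl : ∀ t, (c - 1) + a * 0 < y t :=
    ClampedTraj.pos_sub P htr hL (t₀ := 0) (by rw [h0]; linarith)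
  have yr : ∀ t, y t < (1 / c - 1) + a * 0 :=
    ClampedTraj.pos_sub P hR htr (t₀ := 0) (by rw [h0]; linarith)
  set b := 1 / c - 1 with hb
  have hpq : ∀ t, |p t| ≤ 4 * b ∧ |q t| ≤ 4 * b := fun t => by
    obtain ⟨g1, g2⟩ := ClampedTraj.abs_sub_le P htr hL t
    have hyb : |y t - ((c - 1) + a * 0)| ≤ 2 * b := by
      rw [abs_of_pos (sub_pos.2 (yl t))]; linarith [yr t]
    have hκ : 2 * κ * |y t - ((c - 1) + a * 0)| ≤ 1 * (2 * b) :=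
      mul_le_mul (by linarith [S.κ_le]) hyb (abs_nonneg _) zero_le_one
    have hD : |-Real.log c + (c - 1)| ≤ b := abs_le.2 ⟨by linarith, by linarith⟩
    have hσ : |σ * (-Real.log c + (c - 1)) + 0| ≤ b := by
      rw [add_zero, abs_mul, abs_of_pos S.σ_pos]
      have := mul_le_mul S.σ_lt.le hD (abs_nonneg _) zero_le_one
      linarith
    have hσ' : |-(-Real.log c + (c - 1)) + σ * 0| ≤ b := by
      rw [mul_zero, add_zero, abs_neg]; exact hD
    constructor
    · have := abs_sub_abs_le_abs_sub (p t) (σ * (-Real.log c + (c - 1)) + 0)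
      linarith
    · have := abs_sub_abs_le_abs_sub (q t) (-(-Real.log c + (c - 1)) + σ * 0)
      linarith
  have hyb : ∀ t, |y t| ≤ b := fun t => abs_le.2 ⟨by linarith [yl t], by linarith [yr t]⟩
  have hstr := S.strength
  have hbox : InBox r (fun t => 1 + volumeOf a σ (y t) (p t) (q t))
      (fun t => potentialOf a σ (y t) (p t) (q t)) (fun t => fieldOf σ (p t) (q t)) := fun t => by
    have g1 := P.abs_volume_le (y t) (p t) (q t)
    have g2 := P.abs_potential_le (y t) (p t) (q t)
    have g3 := P.abs_field_le (p t) (q t)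
    have g4 := hyb t
    obtain ⟨g5, g6⟩ := hpq t
    have g7 : A * (|p t| + |q t|) ≤ A * (8 * b) :=
      mul_le_mul_of_nonneg_left (by linarith) hA.le
    have hAb : 0 ≤ A * b := mul_nonneg hA.le (by linarith)
    refine ⟨?_, ?_, ?_⟩
    · rw [add_sub_cancel_left]; nlinarith
    · nlinarith
    · nlinarith
  refine ⟨_, _, _, htr.normalisedSystem P hbox, hbox, ?_, fun t => ?_⟩
  · simp only [volumeOf, h0]; ring
  · simp only [volumeOf]
    constructor <;> linarith [yl t, yr t]

end SmallShock

/-- A profile in the box, whose slow variable `w + a ψ` lies between the end states and in the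
middle at time zero. -/
structure CenteredProfile (T a r c : ℝ) (w Φ ψ : ℝ → ℝ) : Prop where
  sys : NormalisedSystem T a c w Φ ψ
  box : InBox r w Φ ψ
  mid : w 0 + a * ψ 0 = (c + 1 / c) / 2
  left_lt : ∀ t, c < w t + a * ψ t
  lt_right : ∀ t, w t + a * ψ t < 1 / c

namespace CenteredProfile

variable {T a A σ r κ c : ℝ} {w Φ ψ : ℝ → ℝ}

theorem left_estimates (S : SmallShock T a A σ r κ c) (h : CenteredProfile T a r c w Φ ψ) (t : ℝ) :
    |ψ t| ≤ 4 * κ * (w t + a * ψ t - c) ∧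
    |(Φ t + w t) - (-Real.log c + c)| ≤ 4 * κ * (w t + a * ψ t - c) := by
  have := h.sys.abs_sub_le S.toParams h.box S.left S.left_inBox t
  rw [sub_zero, show w t - 1 + a * ψ t - (c - 1 + a * 0) = w t + a * ψ t - c by ring,
    abs_of_pos (sub_pos.2 (h.left_lt t))] at this
  exact this

theorem right_estimates (S : SmallShock T a A σ r κ c) (h : CenteredProfile T a r c w Φ ψ)
    (t : ℝ) : |ψ t| ≤ 4 * κ * (1 / c - (w t + a * ψ t)) ∧
    |(Φ t + w t) - (Real.log c + 1 / c)| ≤ 4 * κ * (1 / c - (w t + a * ψ t)) := by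
  have := h.sys.abs_sub_le S.toParams h.box S.right S.right_inBox t
  rw [sub_zero, show w t - 1 + a * ψ t - (1 / c - 1 + a * 0)
    = -(1 / c - (w t + a * ψ t)) by ring, abs_neg, abs_of_pos (sub_pos.2 (h.lt_right t))] at this
  exact this

theorem abs_a_mul_le (S : SmallShock T a A σ r κ c) {x z : ℝ} (hz : 0 ≤ z)
    (hx : |x| ≤ 4 * κ * z) : |a * x| ≤ z / 4 := by
  rw [abs_mul, abs_of_pos S.a_pos]
  have h1 := mul_le_mul S.a_le hx (abs_nonneg _) S.A_pos.le
  nlinarith [S.κ_small, S.κ_pos, mul_nonneg S.κ_pos.le hz]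

theorem κ_mul_le (S : SmallShock T a A σ r κ c) {z : ℝ} (hz : 0 ≤ z) : 4 * κ * z ≤ z / 4 := by
  nlinarith [S.κ_small, S.κ_pos, S.A_pos, mul_nonneg S.κ_pos.le hz, mul_pos S.A_pos S.κ_pos]

/-- Bounds of the deviation from the left state by the slow variable. -/
theorem left_bounds (S : SmallShock T a A σ r κ c) (h : CenteredProfile T a r c w Φ ψ) (t : ℝ) :
    3 / 4 * (w t + a * ψ t - c) ≤ w t - c ∧ w t - c ≤ 5 / 4 * (w t + a * ψ t - c) ∧
    |Φ t + Real.log c| ≤ 2 * (w t + a * ψ t - c) ∧ |ψ t| ≤ 1 / 4 * (w t + a * ψ t - c) := by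
  obtain ⟨h1, h2⟩ := h.left_estimates S t
  have h0 := (sub_pos.2 (h.left_lt t)).le
  have h3 := abs_le.1 (abs_a_mul_le S h0 h1)
  have h4 := κ_mul_le S h0
  have h5 := abs_le.1 (h2.trans h4)
  refine ⟨by linarith [h3.2], by linarith [h3.1], abs_le.2 ⟨?_, ?_⟩, by linarith⟩ <;>
    linarith [h3.1, h3.2, h5.1, h5.2]

theorem right_bounds (S : SmallShock T a A σ r κ c) (h : CenteredProfile T a r c w Φ ψ) (t : ℝ) :
    3 / 4 * (1 / c - (w t + a * ψ t)) ≤ 1 / c - w t ∧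
    1 / c - w t ≤ 5 / 4 * (1 / c - (w t + a * ψ t)) ∧
    |Φ t - Real.log c| ≤ 2 * (1 / c - (w t + a * ψ t)) ∧
    |ψ t| ≤ 1 / 4 * (1 / c - (w t + a * ψ t)) := by
  obtain ⟨h1, h2⟩ := h.right_estimates S t
  have h0 := (sub_pos.2 (h.lt_right t)).le
  have h3 := abs_le.1 (abs_a_mul_le S h0 h1)
  have h4 := κ_mul_le S h0
  have h5 := abs_le.1 (h2.trans h4)
  refine ⟨by linarith [h3.1], by linarith [h3.2], abs_le.2 ⟨?_, ?_⟩, by linarith⟩ <;>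
    linarith [h3.1, h3.2, h5.1, h5.2]

theorem volume_mem (S : SmallShock T a A σ r κ c) (h : CenteredProfile T a r c w Φ ψ) (t : ℝ) :
    1 / 2 ≤ w t ∧ w t ≤ 2 := by
  have := abs_le.1 (h.box t).1
  have hr := S.r_le_half
  exact ⟨by linarith [this.1], by linarith [this.2]⟩

theorem hasDerivAt_slow (S : SmallShock T a A σ r κ c) (h : CenteredProfile T a r c w Φ ψ)
    (t : ℝ) : HasDerivAt (fun t => w t + a * ψ t)
      (a * ((T + 1) * ((w t - c) * (1 / c - w t)) / w t + ψ t ^ 2 / 2)) t := by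
  refine ((h.sys.hw t).add ((h.sys.hψ t).const_mul a)).congr_deriv ?_
  have := (h.sys.pos t).ne'
  have := S.c_pos.ne'
  field_simp
  ring

theorem deriv_slow (h : CenteredProfile T a r c w Φ ψ) (t : ℝ) :
    deriv (fun t => w t + a * ψ t) t = deriv w t + a * deriv ψ t :=
  ((h.sys.hw t).differentiableAt.hasDerivAt.add
    ((h.sys.hψ t).differentiableAt.hasDerivAt.const_mul a)).deriv

theorem slow_rate_ge (S : SmallShock T a A σ r κ c) (h : CenteredProfile T a r c w Φ ψ) (t : ℝ) :
    a * (T + 1) / 4 * ((w t + a * ψ t - c) * (1 / c - (w t + a * ψ t)))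
      ≤ deriv (fun t => w t + a * ψ t) t := by
  rw [(h.hasDerivAt_slow S t).deriv]
  obtain ⟨l1, -, -, -⟩ := h.left_bounds S t
  obtain ⟨r1, -, -, -⟩ := h.right_bounds S t
  obtain ⟨w1, w2⟩ := h.volume_mem S t
  have hl := sub_pos.2 (h.left_lt t)
  have hr := sub_pos.2 (h.lt_right t)
  set l := w t + a * ψ t - c
  set ρ := 1 / c - (w t + a * ψ t)
  have h1 : 1 / 2 * (l * ρ) ≤ (w t - c) * (1 / c - w t) := by
    nlinarith [mul_le_mul l1 r1 (by positivity) (by linarith), mul_pos hl hr]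
  have h2 : 1 / 4 * (l * ρ) ≤ (w t - c) * (1 / c - w t) / w t := by
    rw [le_div_iff₀ (by linarith)]
    nlinarith [mul_pos hl hr]
  have ha := S.a_pos
  have hT := S.T_nonneg
  have h3 : (T + 1) * (1 / 4 * (l * ρ)) ≤ (T + 1) * ((w t - c) * (1 / c - w t) / w t) :=
    mul_le_mul_of_nonneg_left h2 (by linarith)
  have h4 : a * ((T + 1) * (1 / 4 * (l * ρ)))
      ≤ a * ((T + 1) * ((w t - c) * (1 / c - w t)) / w t + ψ t ^ 2 / 2) := by
    refine mul_le_mul_of_nonneg_left ?_ ha.le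
    rw [mul_div_assoc]; nlinarith [sq_nonneg (ψ t)]
  linarith

theorem slow_rate_le (S : SmallShock T a A σ r κ c) (h : CenteredProfile T a r c w Φ ψ) (t : ℝ) :
    deriv (fun t => w t + a * ψ t) t
      ≤ 5 * A * (T + 1) * ((w t + a * ψ t - c) * (1 / c - (w t + a * ψ t))) := by
  rw [(h.hasDerivAt_slow S t).deriv]
  obtain ⟨l1, l2, -, l3⟩ := h.left_bounds S t
  obtain ⟨r1, r2, -, r3⟩ := h.right_bounds S t
  obtain ⟨w1, w2⟩ := h.volume_mem S t
  have hl := sub_pos.2 (h.left_lt t)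
  have hr := sub_pos.2 (h.lt_right t)
  set l := w t + a * ψ t - c
  set ρ := 1 / c - (w t + a * ψ t)
  have hlr := mul_pos hl hr
  have h1 : (w t - c) * (1 / c - w t) ≤ 2 * (l * ρ) := by
    nlinarith [mul_le_mul l2 r2 (by linarith) (by positivity)]
  have h2 : (w t - c) * (1 / c - w t) / w t ≤ 4 * (l * ρ) := by
    rw [div_le_iff₀ (by linarith)]
    nlinarith
  have h3 : ψ t ^ 2 ≤ l * ρ := by
    rw [← sq_abs]; nlinarith [mul_le_mul l3 r3 (abs_nonneg _) (by positivity)]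
  have ha := S.a_pos
  have hT := S.T_nonneg
  have h5 : (T + 1) * ((w t - c) * (1 / c - w t)) / w t + ψ t ^ 2 / 2
      ≤ 5 * (T + 1) * (l * ρ) := by
    have := mul_le_mul_of_nonneg_left h2 (by linarith : 0 ≤ T + 1)
    rw [mul_div_assoc]
    nlinarith [mul_nonneg hT hlr.le]
  calc _ ≤ a * (5 * (T + 1) * (l * ρ)) := mul_le_mul_of_nonneg_left h5 ha.le
    _ ≤ A * (5 * (T + 1) * (l * ρ)) := mul_le_mul_of_nonneg_right S.a_le (by positivity)
    _ = _ := by ring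

theorem slow_rate_pos (S : SmallShock T a A σ r κ c) (h : CenteredProfile T a r c w Φ ψ) (t : ℝ) :
    0 < deriv (fun t => w t + a * ψ t) t := by
  refine lt_of_lt_of_le ?_ (h.slow_rate_ge S t)
  have := sub_pos.2 (h.left_lt t)
  have := sub_pos.2 (h.lt_right t)
  have := S.a_pos
  have := S.T_nonneg
  positivity

theorem strictMono_slow (S : SmallShock T a A σ r κ c) (h : CenteredProfile T a r c w Φ ψ) :
    StrictMono (fun t => w t + a * ψ t) :=
  strictMono_of_deriv_pos (h.slow_rate_pos S)

/-- The derivative of the profile is dominated by its volume component. -/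
theorem deriv_bounds (S : SmallShock T a A σ r κ c) (h : CenteredProfile T a r c w Φ ψ) (t : ℝ) :
    0 < deriv w t ∧ deriv w t ≤ 2 * deriv (fun t => w t + a * ψ t) t ∧
    |deriv ψ t| ≤ deriv (fun t => w t + a * ψ t) t ∧
    deriv w t / 2 ≤ -ψ t ∧ -ψ t ≤ 2 * deriv w t := by
  have h0 := h.slow_rate_pos S t
  obtain ⟨h1, h2⟩ := h.sys.abs_deriv_le S.toParams h.box t
  have e := h.deriv_slow t
  rw [← e, abs_of_pos h0] at h1 h2
  have h3 := abs_le.1 (abs_a_mul_le S h0.le h1)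
  have h4 := κ_mul_le S h0.le
  have h5 := abs_le.1 (h2.trans h4)
  refine ⟨?_, ?_, ?_, ?_, ?_⟩ <;> linarith [h3.1, h3.2, h5.1, h5.2]

theorem right_decay (S : SmallShock T a A σ r κ c) (h : CenteredProfile T a r c w Φ ψ) {t : ℝ}
    (ht : 0 ≤ t) : 1 / c - (w t + a * ψ t)
      ≤ (1 / c - c) * Real.exp (-(a * (T + 1) / 8 * (1 / c - c)) * t) := by
  set y := fun t => w t + a * ψ t with hy
  set ν := a * (T + 1) / 8 * (1 / c - c) with hν
  have hd : ∀ s, HasDerivAt (fun s => (1 / c - y s) * Real.exp (ν * s))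
      ((-deriv y s) * Real.exp (ν * s) + (1 / c - y s) * (Real.exp (ν * s) * ν)) s := fun s => by
    have h1 : HasDerivAt (fun s => ν * s) ν s := by simpa using (hasDerivAt_id s).const_mul ν
    exact ((h.hasDerivAt_slow S s).differentiableAt.hasDerivAt.const_sub _).mul h1.exp
  have hanti : AntitoneOn (fun s => (1 / c - y s) * Real.exp (ν * s)) (Set.Ici 0) := by
    refine antitoneOn_of_deriv_nonpos (convex_Ici 0)
      (fun s _ => (hd s).continuousAt.continuousWithinAt)
      (fun s _ => (hd s).differentiableAt.differentiableWithinAt) (fun s hs => ?_)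
    rw [interior_Ici] at hs
    rw [(hd s).deriv]
    have h1 := h.slow_rate_ge S s
    have h2 : (1 / c - c) / 2 ≤ y s - c := by
      have := (h.strictMono_slow S).monotone (Set.mem_Ioi.1 hs).le
      have hm : y 0 = (c + 1 / c) / 2 := h.mid
      change y 0 ≤ y s at this
      linarith
    have h3 : 0 < 1 / c - y s := sub_pos.2 (h.lt_right s)
    have h4 : 0 ≤ a * (T + 1) / 4 := by
      have := S.a_pos
      have := S.T_nonneg
      positivity
    have h5 : (1 / c - y s) * ν ≤ deriv y s := by
      refine le_trans ?_ h1
      have := mul_le_mul_of_nonneg_left (mul_le_mul_of_nonneg_right h2 h3.le) h4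
      calc _ = a * (T + 1) / 4 * ((1 / c - c) / 2 * (1 / c - y s)) := by rw [hν]; ring
        _ ≤ _ := this
    nlinarith [Real.exp_pos (ν * s)]
  have h6 := hanti Set.self_mem_Ici ht ht
  simp only [mul_zero, Real.exp_zero, mul_one] at h6
  have hm : y 0 = (c + 1 / c) / 2 := h.mid
  have h1 := S.one_lt
  have h2 := S.c_lt
  rw [neg_mul, Real.exp_neg, ← div_eq_mul_inv, le_div_iff₀ (Real.exp_pos _)]
  change (1 / c - y t) * _ ≤ _
  linarith

theorem left_decay (S : SmallShock T a A σ r κ c) (h : CenteredProfile T a r c w Φ ψ) {t : ℝ}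
    (ht : t ≤ 0) : w t + a * ψ t - c
      ≤ (1 / c - c) * Real.exp (a * (T + 1) / 8 * (1 / c - c) * t) := by
  set y := fun t => w t + a * ψ t with hy
  set ν := a * (T + 1) / 8 * (1 / c - c) with hν
  have hd : ∀ s, HasDerivAt (fun s => (y s - c) * Real.exp (-ν * s))
      ((deriv y s) * Real.exp (-ν * s) + (y s - c) * (Real.exp (-ν * s) * -ν)) s := fun s => by
    have h1 : HasDerivAt (fun s => -ν * s) (-ν) s := by simpa using (hasDerivAt_id s).const_mul (-ν)
    exact ((h.hasDerivAt_slow S s).differentiableAt.hasDerivAt.sub_const _).mul h1.exp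
  have hmono : MonotoneOn (fun s => (y s - c) * Real.exp (-ν * s)) (Set.Iic 0) := by
    refine monotoneOn_of_deriv_nonneg (convex_Iic 0)
      (fun s _ => (hd s).continuousAt.continuousWithinAt)
      (fun s _ => (hd s).differentiableAt.differentiableWithinAt) (fun s hs => ?_)
    rw [interior_Iic] at hs
    rw [(hd s).deriv]
    have h1 := h.slow_rate_ge S s
    have h2 : (1 / c - c) / 2 ≤ 1 / c - y s := by
      have := (h.strictMono_slow S).monotone (Set.mem_Iio.1 hs).le
      have hm : y 0 = (c + 1 / c) / 2 := h.mid
      change y s ≤ y 0 at this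
      linarith
    have h3 : 0 < y s - c := sub_pos.2 (h.left_lt s)
    have h4 : 0 ≤ a * (T + 1) / 4 := by
      have := S.a_pos
      have := S.T_nonneg
      positivity
    have h5 : (y s - c) * ν ≤ deriv y s := by
      refine le_trans ?_ h1
      have := mul_le_mul_of_nonneg_left (mul_le_mul_of_nonneg_left h2 h3.le) h4
      calc _ = a * (T + 1) / 4 * ((y s - c) * ((1 / c - c) / 2)) := by rw [hν]; ring
        _ ≤ _ := this
    nlinarith [Real.exp_pos (-ν * s)]
  have h6 := hmono ht Set.self_mem_Iic ht
  simp only [mul_zero, Real.exp_zero, mul_one] at h6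
  have hm : y 0 = (c + 1 / c) / 2 := h.mid
  have h1 := S.one_lt
  have h2 := S.c_lt
  have e : Real.exp (ν * t) = (Real.exp (-ν * t))⁻¹ := by rw [← Real.exp_neg]; ring_nf
  rw [e, ← div_eq_mul_inv, le_div_iff₀ (Real.exp_pos _)]
  change (y t - c) * _ ≤ _
  linarith

/-- The exponential weight of the decay estimates. -/
theorem slow_rate_decay (S : SmallShock T a A σ r κ c) (h : CenteredProfile T a r c w Φ ψ)
    (t : ℝ) : deriv (fun t => w t + a * ψ t) t ≤ 5 * A * (T + 1) * ((1 / c - c) ^ 2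
      * Real.exp (-(a * (T + 1) / 8 * (1 / c - c)) * |t|)) := by
  refine (h.slow_rate_le S t).trans ?_
  have hA := S.A_pos
  have hT := S.T_nonneg
  refine mul_le_mul_of_nonneg_left ?_ (by positivity)
  have hl := sub_pos.2 (h.left_lt t)
  have hr := sub_pos.2 (h.lt_right t)
  have hΔ : 0 < 1 / c - c := by linarith
  rcases le_total 0 t with ht | ht
  · have := h.right_decay S ht
    rw [abs_of_nonneg ht]
    have h2 := mul_le_mul (by linarith : w t + a * ψ t - c ≤ 1 / c - c) this hr.le hΔ.le
    refine h2.trans_eq (by ring)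
  · have := h.left_decay S ht
    rw [abs_of_nonpos ht]
    have h2 := mul_le_mul this (by linarith : 1 / c - (w t + a * ψ t) ≤ 1 / c - c) hr.le
      (by positivity)
    refine h2.trans_eq ?_
    rw [neg_mul_neg]; ring

theorem tendsto_slow_right (S : SmallShock T a A σ r κ c) (h : CenteredProfile T a r c w Φ ψ) :
    Tendsto (fun t => 1 / c - (w t + a * ψ t)) atTop (𝓝 0) := by
  have hν : 0 < a * (T + 1) / 8 * (1 / c - c) := by
    have := S.a_pos
    have := S.T_nonneg
    have : 0 < 1 / c - c := by linarith [S.one_lt, S.c_lt]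
    positivity
  have h1 : Tendsto (fun t => (1 / c - c) * Real.exp (-(a * (T + 1) / 8 * (1 / c - c)) * t)) atTop
      (𝓝 ((1 / c - c) * 0)) := by
    refine Tendsto.const_mul _ (Real.tendsto_exp_atBot.comp ?_)
    exact tendsto_id.const_mul_atTop_of_neg (by linarith)
  rw [mul_zero] at h1
  refine tendsto_of_tendsto_of_tendsto_of_le_of_le' tendsto_const_nhds h1
    (Eventually.of_forall fun t => (sub_pos.2 (h.lt_right t)).le) ?_
  filter_upwards [eventually_ge_atTop 0] with t ht using h.right_decay S ht

theorem tendsto_slow_left (S : SmallShock T a A σ r κ c) (h : CenteredProfile T a r c w Φ ψ) :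
    Tendsto (fun t => w t + a * ψ t - c) atBot (𝓝 0) := by
  have hν : 0 < a * (T + 1) / 8 * (1 / c - c) := by
    have := S.a_pos
    have := S.T_nonneg
    have : 0 < 1 / c - c := by linarith [S.one_lt, S.c_lt]
    positivity
  have h1 : Tendsto (fun t => (1 / c - c) * Real.exp (a * (T + 1) / 8 * (1 / c - c) * t)) atBot
      (𝓝 ((1 / c - c) * 0)) :=
    Tendsto.const_mul _ (Real.tendsto_exp_atBot.comp (tendsto_id.const_mul_atBot hν))
  rw [mul_zero] at h1
  refine tendsto_of_tendsto_of_tendsto_of_le_of_le' tendsto_const_nhds h1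
    (Eventually.of_forall fun t => (sub_pos.2 (h.left_lt t)).le) ?_
  filter_upwards [eventually_le_atBot 0] with t ht using h.left_decay S ht

theorem tendsto_of_abs_sub_le {F g : ℝ → ℝ} {l : Filter ℝ} {x K : ℝ}
    (hg : Tendsto g l (𝓝 0)) (h : ∀ t, |F t - x| ≤ K * g t) : Tendsto F l (𝓝 x) := by
  rw [tendsto_iff_dist_tendsto_zero]
  refine squeeze_zero (fun _ => dist_nonneg) h ?_
  simpa using hg.const_mul K

theorem tendsto_left (S : SmallShock T a A σ r κ c) (h : CenteredProfile T a r c w Φ ψ) :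
    Tendsto w atBot (𝓝 c) ∧ Tendsto Φ atBot (𝓝 (-Real.log c)) := by
  have ht := h.tendsto_slow_left S
  refine ⟨tendsto_of_abs_sub_le (K := 5 / 4) ht fun t => ?_,
    tendsto_of_abs_sub_le (K := 2) ht fun t => ?_⟩
  · obtain ⟨h1, h2, -, -⟩ := h.left_bounds S t
    have := sub_pos.2 (h.left_lt t)
    rw [abs_of_nonneg (by linarith)]; exact h2
  · rw [sub_neg_eq_add]; exact (h.left_bounds S t).2.2.1

theorem tendsto_right (S : SmallShock T a A σ r κ c) (h : CenteredProfile T a r c w Φ ψ) :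
    Tendsto w atTop (𝓝 (1 / c)) ∧ Tendsto Φ atTop (𝓝 (Real.log c)) := by
  have ht := h.tendsto_slow_right S
  refine ⟨tendsto_of_abs_sub_le (K := 5 / 4) ht fun t => ?_,
    tendsto_of_abs_sub_le (K := 2) ht fun t => (h.right_bounds S t).2.2.1⟩
  obtain ⟨h1, h2, -, -⟩ := h.right_bounds S t
  have := sub_pos.2 (h.lt_right t)
  rw [abs_sub_comm, abs_of_nonneg (by linarith)]; exact h2

end CenteredProfile

/-- A Leibniz estimate: the `n`-th derivative of `F G'`, when the derivatives of `F` and `G` of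
order `l ≥ 1` are of size `Δ ^ (l + 1)`. -/
theorem abs_iteratedDeriv_mul_deriv_le {F G : ℝ → ℝ} (sF : ContDiff ℝ ∞ F) (sG : ContDiff ℝ ∞ G)
    {n : ℕ} {t M C θ Δ W : ℝ} (hM : 0 ≤ M) (hC : 0 ≤ C) (hΔ : 0 ≤ Δ) (hθ : Δ ≤ θ) (hW : 0 ≤ W)
    (hW1 : W ≤ 1) (h0 : |F t| ≤ M * θ)
    (hF : ∀ l, 1 ≤ l → l ≤ n → |iteratedDeriv l F t| ≤ C * Δ ^ (l + 1) * W)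
    (hG : ∀ l, 1 ≤ l → l ≤ n + 1 → |iteratedDeriv l G t| ≤ C * Δ ^ (l + 1) * W) :
    |iteratedDeriv n (fun t => F t * deriv G t) t|
      ≤ 2 ^ n * ((M + C) * C) * (θ * Δ ^ (n + 2) * W) := by
  have sG' : ContDiff ℝ ∞ (deriv G) := (contDiff_infty_iff_deriv.1 sG).2
  rw [iteratedDeriv_fun_mul (sF.contDiffAt.of_le (by exact_mod_cast le_top))
    (sG'.contDiffAt.of_le (by exact_mod_cast le_top))]
  refine (Finset.abs_sum_le_sum_abs _ _).trans ?_
  have hterm : ∀ i ∈ Finset.range (n + 1),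
      |(n.choose i : ℝ) * iteratedDeriv i F t * iteratedDeriv (n - i) (deriv G) t|
        ≤ (n.choose i : ℝ) * ((M + C) * C * (θ * Δ ^ (n + 2) * W)) := by
    intro i hi
    have hin : i ≤ n := Nat.lt_succ_iff.1 (Finset.mem_range.1 hi)
    have hg := hG (n - i + 1) (by omega) (by omega)
    rw [iteratedDeriv_succ'] at hg
    rw [mul_assoc, abs_mul, abs_mul, Nat.abs_cast]
    refine mul_le_mul_of_nonneg_left ?_ (Nat.cast_nonneg _)
    have hθ0 : 0 ≤ θ := hΔ.trans hθ
    rcases Nat.eq_zero_or_pos i with rfl | hi0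
    · rw [Nat.sub_zero] at hg ⊢
      rw [iteratedDeriv_zero]
      refine (mul_le_mul h0 hg (abs_nonneg _) (by positivity)).trans ?_
      have : 0 ≤ C * C * (θ * Δ ^ (n + 2) * W) := by positivity
      have e : M * θ * (C * Δ ^ (n + 1 + 1) * W) = M * C * (θ * Δ ^ (n + 2) * W) := by ring
      rw [e]; nlinarith
    · refine (mul_le_mul (hF i hi0 hin) hg (abs_nonneg _) (by positivity)).trans ?_
      have e : C * Δ ^ (i + 1) * W * (C * Δ ^ (n - i + 1 + 1) * W)
          = C * C * (Δ ^ (n + 2) * W) * (Δ * W) := by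
        have : Δ ^ (i + 1) * Δ ^ (n - i + 1 + 1) = Δ ^ (n + 2) * Δ := by
          rw [← pow_add, ← pow_succ]; congr 1; omega
        linear_combination C * C * W * W * this
      rw [e]
      have h1 : Δ * W ≤ θ := by nlinarith
      have h2 : 0 ≤ C * C * (Δ ^ (n + 2) * W) := by positivity
      have h3 : 0 ≤ M * C * (θ * Δ ^ (n + 2) * W) := by positivity
      nlinarith [mul_le_mul_of_nonneg_left h1 h2]
  refine (Finset.sum_le_sum hterm).trans_eq ?_
  rw [← Finset.sum_mul]
  have : ∑ i ∈ Finset.range (n + 1), (n.choose i : ℝ) = 2 ^ n := by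
    exact_mod_cast Nat.sum_range_choose n
  rw [this]; ring

theorem abs_iteratedDeriv_mul_le {F G : ℝ → ℝ} (sF : ContDiff ℝ ∞ F) (sG : ContDiff ℝ ∞ G)
    {n : ℕ} {t M C θ Δ W : ℝ} (hM : 0 ≤ M) (hC : 0 ≤ C) (hΔ : 0 ≤ Δ) (hθ : Δ ≤ θ) (hW : 0 ≤ W)
    (hW1 : W ≤ 1) (hF0 : |F t| ≤ M * θ) (hG0 : |G t| ≤ M * θ)
    (hF : ∀ l, 1 ≤ l → l ≤ n + 1 → |iteratedDeriv l F t| ≤ C * Δ ^ (l + 1) * W)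
    (hG : ∀ l, 1 ≤ l → l ≤ n + 1 → |iteratedDeriv l G t| ≤ C * Δ ^ (l + 1) * W) :
    |iteratedDeriv (n + 1) (fun t => F t * G t) t|
      ≤ 2 ^ (n + 1) * ((M + C) * C) * (θ * Δ ^ (n + 2) * W) := by
  have sF' : ContDiff ℝ ∞ (deriv F) := (contDiff_infty_iff_deriv.1 sF).2
  have sG' : ContDiff ℝ ∞ (deriv G) := (contDiff_infty_iff_deriv.1 sG).2
  have hd : deriv (fun t => F t * G t) = fun t => F t * deriv G t + G t * deriv F t := by
    funext s
    have h1 := ((contDiff_infty_iff_deriv.1 sF).1 s).hasDerivAt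
    have h2 := ((contDiff_infty_iff_deriv.1 sG).1 s).hasDerivAt
    rw [(h1.fun_mul h2).deriv]; ring
  rw [iteratedDeriv_succ', hd, iteratedDeriv_fun_add
    ((sF.mul sG').contDiffAt.of_le (by exact_mod_cast le_top))
    ((sG.mul sF').contDiffAt.of_le (by exact_mod_cast le_top))]
  refine (abs_add_le _ _).trans ?_
  have h1 := abs_iteratedDeriv_mul_deriv_le sF sG hM hC hΔ hθ hW hW1 hF0
    (fun l h h' => hF l h (by omega)) hG
  have h2 := abs_iteratedDeriv_mul_deriv_le sG sF hM hC hΔ hθ hW hW1 hG0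
    (fun l h h' => hG l h (by omega)) hF
  rw [pow_succ]
  linarith

/-- The derivatives of `F` of orders between `1` and `k` are of size `Δ ^ (i + 1)`, with an
exponential weight. -/
def DerivBound (Δ ν C : ℝ) (k : ℕ) (F : ℝ → ℝ) : Prop :=
  ∀ i, 1 ≤ i → i ≤ k → ∀ t, |iteratedDeriv i F t| ≤ C * Δ ^ (i + 1) * Real.exp (-ν * |t|)

namespace DerivBound

variable {Δ ν C C' : ℝ} {k : ℕ} {F : ℝ → ℝ}

theorem mono (h : DerivBound Δ ν C k F) (hΔ : 0 ≤ Δ) (hC : C ≤ C') : DerivBound Δ ν C' k F :=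
  fun i h1 h2 t => (h i h1 h2 t).trans (by gcongr)

theorem succ (h : DerivBound Δ ν C k F)
    (h' : ∀ t, |iteratedDeriv (k + 1) F t| ≤ C * Δ ^ (k + 2) * Real.exp (-ν * |t|)) :
    DerivBound Δ ν C (k + 1) F := fun i h1 h2 t => by
  rcases Nat.lt_or_ge i (k + 1) with hi | hi
  · exact h i h1 (by omega) t
  · obtain rfl : i = k + 1 := by omega
    exact h' t

theorem sub_const (h : DerivBound Δ ν C k F) (b : ℝ) : DerivBound Δ ν C k (fun t => F t - b) :=
  fun i h1 h2 t => by
    have : iteratedDeriv i (fun t => F t - b) t = iteratedDeriv i F t := by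
      simp only [sub_eq_neg_add]
      exact iteratedDeriv_const_add (by omega) _
    rw [this]; exact h i h1 h2 t

theorem const_sub (h : DerivBound Δ ν C k F) (b : ℝ) : DerivBound Δ ν C k (fun t => b - F t) :=
  fun i h1 h2 t => by
    rw [iteratedDeriv_const_sub (by omega), iteratedDeriv_neg, abs_neg]; exact h i h1 h2 t

end DerivBound

section Smooth

variable {T a c : ℝ} {w Φ ψ : ℝ → ℝ}

theorem NormalisedSystem.contDiff (h : NormalisedSystem T a c w Φ ψ) :
    ContDiff ℝ ∞ w ∧ ContDiff ℝ ∞ Φ ∧ ContDiff ℝ ∞ ψ := by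
  have key : ∀ n : ℕ, ContDiff ℝ n w ∧ ContDiff ℝ n Φ ∧ ContDiff ℝ n ψ := by
    intro n
    induction n with
    | zero =>
      simp only [Nat.cast_zero, contDiff_zero]
      exact ⟨continuous_iff_continuousAt.2 fun t => (h.hw t).continuousAt,
        continuous_iff_continuousAt.2 fun t => (h.hΦ t).continuousAt,
        continuous_iff_continuousAt.2 fun t => (h.hψ t).continuousAt⟩
    | succ n ih =>
      obtain ⟨i1, i2, i3⟩ := ih
      have hne : ∀ t, w t ≠ 0 := fun t => (h.pos t).ne'
      have hsucc : ∀ {f f' : ℝ → ℝ}, (∀ t, HasDerivAt f (f' t) t) → ContDiff ℝ n f' →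
          ContDiff ℝ (n + 1 : ℕ) f := fun {f f'} hf hf' => by
        push_cast
        refine contDiff_succ_iff_deriv.2 ⟨fun t => (hf t).differentiableAt, by simp, ?_⟩
        rwa [show deriv f = f' from funext fun t => (hf t).deriv]
      have i4 := i1.inv hne
      have i5 := i2.exp
      refine ⟨hsucc h.hw ?_, hsucc h.hΦ i3, hsucc h.hψ ?_⟩
      · simp only [div_eq_mul_inv]
        fun_prop
      · simp only [div_eq_mul_inv]
        fun_prop
  exact ⟨contDiff_infty.2 fun n => (key n).1, contDiff_infty.2 fun n => (key n).2.1,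
    contDiff_infty.2 fun n => (key n).2.2⟩

end Smooth

theorem exp_neg_weight_le {ν : ℝ} (hν : 0 ≤ ν) (s t : ℝ) :
    Real.exp (-ν * |t|) ≤ Real.exp (-ν * |s|) * Real.exp (ν * |t - s|) := by
  rw [← Real.exp_add, Real.exp_le_exp]
  have : |s| ≤ |t| + |t - s| := by
    calc |s| = |t - (t - s)| := by ring_nf
      _ ≤ _ := abs_sub _ _
  nlinarith

namespace CenteredProfile

variable {T a A σ r κ c : ℝ} {w Φ ψ : ℝ → ℝ}

theorem strength_facts (S : SmallShock T a A σ r κ c) : 0 < 1 / c - c ∧ 1 / c - c ≤ 1 ∧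
    0 ≤ a * (T + 1) / 8 * (1 / c - c) ∧ a * (T + 1) / 8 * (1 / c - c) ≤ 1 / (2 * (1 + A)) := by
  have h1 := S.one_lt
  have h2 := S.c_lt
  have h3 := S.one_sub_le
  have h4 := S.strength_le
  have h5 := S.r_le_half
  have hT := S.T_nonneg
  have ha := S.a_pos
  have hA := S.A_pos
  have hr := S.r_pos
  have hΔ : 0 < 1 / c - c := by linarith
  refine ⟨hΔ, by linarith, by positivity, ?_⟩
  rw [le_div_iff₀ (by linarith)]
  have h6 : 1 / c - c ≤ r := by linarith
  have h7 : a * (T + 1) / 8 * (1 / c - c) ≤ (1 + A) * (T + 1) / 8 * r := by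
    have := S.a_le
    gcongr
    linarith
  have h8 : (1 + A) ^ 2 * ((T + 1) * r) ≤ (1 + A) ^ 3 * ((T + 1) * r) := by
    refine mul_le_mul_of_nonneg_right ?_ (by positivity)
    exact pow_le_pow_right₀ (by linarith) (by norm_num)
  have h9 := mul_le_mul_of_nonneg_right h7 (by linarith : 0 ≤ 2 * (1 + A))
  nlinarith [S.r_le, S.κ_le]

/-- The sizes of the quantities that enter the quadratic terms. -/
theorem size_bounds (S : SmallShock T a A σ r κ c) (h : CenteredProfile T a r c w Φ ψ) (t : ℝ) :
    |w t - 1| ≤ 6 * (1 / c - c) ∧ |1 - (w t)⁻¹| ≤ 6 * (1 / c - c) ∧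
    |Real.exp (Φ t) - 1| ≤ 6 * (1 / c - c) ∧ |ψ t| ≤ 6 * (1 / c - c) ∧
    |(w t)⁻¹| ≤ 6 ∧ |Real.exp (Φ t)| ≤ 6 := by
  obtain ⟨l1, l2, l3, l4⟩ := h.left_bounds S t
  obtain ⟨r1, r2, -, -⟩ := h.right_bounds S t
  have hl := sub_pos.2 (h.left_lt t)
  have hr := sub_pos.2 (h.lt_right t)
  obtain ⟨w1, w2⟩ := h.volume_mem S t
  have h1 := S.one_lt
  have h2 := S.c_lt
  obtain ⟨g1, g2⟩ := S.log_le
  have hr2 := S.r_le_half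
  have hv : |w t - 1| ≤ 1 / c - c := abs_le.2 ⟨by linarith, by linarith⟩
  have hinv : |(w t)⁻¹| ≤ 2 := by
    rw [abs_of_pos (by positivity)]
    exact inv_le_of_inv_le₀ (by norm_num) (by linarith)
  have hΦ : |Φ t| ≤ 3 * (1 / c - c) := by
    have := abs_sub_abs_le_abs_sub (Φ t) (-Real.log c)
    rw [sub_neg_eq_add, abs_of_nonneg g2] at this
    linarith
  have hΦ1 := (h.box t).2.1
  have he := Real.abs_exp_sub_one_le (hΦ1.trans (by linarith))
  refine ⟨by linarith, ?_, by linarith, by linarith, by linarith, ?_⟩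
  · have e : 1 - (w t)⁻¹ = (w t - 1) * (w t)⁻¹ := by field_simp
    rw [e, abs_mul]
    nlinarith [mul_le_mul hv hinv (abs_nonneg _) (by linarith)]
  · have := abs_sub_abs_le_abs_sub (Real.exp (Φ t)) 1
    rw [abs_one] at this
    linarith

/-- The bounds of the derivatives of orders between `1` and `k` of the profile. -/
structure ProfileBound (Δ ν C : ℝ) (k : ℕ) (w Φ ψ : ℝ → ℝ) : Prop where
  volume : DerivBound Δ ν C k w
  density : DerivBound Δ ν C k (fun t => (w t)⁻¹)
  potential : DerivBound Δ ν C k Φ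
  density' : DerivBound Δ ν C k (fun t => Real.exp (Φ t))
  field : DerivBound Δ ν C k ψ

theorem profileBound_one (S : SmallShock T a A σ r κ c) (h : CenteredProfile T a r c w Φ ψ) :
    ProfileBound (1 / c - c) (a * (T + 1) / 8 * (1 / c - c)) (120 * A * (T + 1)) 1 w Φ ψ := by
  obtain ⟨hΔ, -, -, -⟩ := strength_facts S
  have hA := S.A_pos
  have hT := S.T_nonneg
  have red : ∀ F : ℝ → ℝ,
      (∀ t, |deriv F t| ≤ 24 * deriv (fun t => w t + a * ψ t) t) →
      DerivBound (1 / c - c) (a * (T + 1) / 8 * (1 / c - c)) (120 * A * (T + 1)) 1 F := by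
    intro F hF i h1 h2 t
    obtain rfl : i = 1 := by omega
    rw [iteratedDeriv_one]
    have := h.slow_rate_decay S t
    refine (hF t).trans ((mul_le_mul_of_nonneg_left this (by norm_num)).trans_eq ?_)
    ring
  have hw := fun t => (h.sys.hw t).differentiableAt.hasDerivAt
  have hbase := fun t => h.deriv_bounds S t
  have hw' : ∀ t, |deriv w t| ≤ 2 * deriv (fun t => w t + a * ψ t) t := fun t => by
    obtain ⟨b1, b2, -, -, -⟩ := hbase t
    rwa [abs_of_pos b1]
  have hψ : ∀ t, |ψ t| ≤ 4 * deriv (fun t => w t + a * ψ t) t := fun t => by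
    obtain ⟨b1, b2, -, b4, b5⟩ := hbase t
    exact abs_le.2 ⟨by linarith, by linarith⟩
  have hpos := fun t => h.slow_rate_pos S t
  refine ⟨red _ fun t => ?_, red _ fun t => ?_, red _ fun t => ?_, red _ fun t => ?_,
    red _ fun t => ?_⟩
  · linarith [hw' t, hpos t]
  · have hw1 := (h.volume_mem S t).1
    rw [((hw t).fun_inv (h.sys.pos t).ne').deriv, abs_div, abs_neg,
      abs_of_pos (by positivity : 0 < w t ^ 2), div_le_iff₀ (by positivity)]
    have : 1 / 4 ≤ w t ^ 2 := by nlinarith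
    nlinarith [hw' t, hpos t]
  · rw [(h.sys.hΦ t).deriv]; linarith [hψ t, hpos t]
  · rw [(h.sys.hΦ t).exp.deriv, abs_mul]
    have := (h.size_bounds S t).2.2.2.2.2
    nlinarith [mul_le_mul this (hψ t) (abs_nonneg _) (by norm_num)]
  · linarith [(hbase t).2.2.1, hpos t]

end CenteredProfile

namespace CenteredProfile

variable {T a A σ r κ c : ℝ} {w Φ ψ : ℝ → ℝ}

/-- The derivatives of the quadratic terms gain a power of the shock strength. -/
theorem quadratic_bounds (S : SmallShock T a A σ r κ c) (h : CenteredProfile T a r c w Φ ψ)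
    {k : ℕ} {C ν : ℝ} (hC : 0 ≤ C) (hν : 0 ≤ ν)
    (hB : ProfileBound (1 / c - c) ν C (k + 1) w Φ ψ) (t : ℝ) :
    |iteratedDeriv (k + 1) (fun t => (w t - 1) * (1 - (w t)⁻¹)) t|
      ≤ 2 ^ (k + 1) * ((6 + C) * C) * ((1 / c - c) ^ (k + 3) * Real.exp (-ν * |t|)) ∧
    |iteratedDeriv (k + 1) (fun t => Real.exp (Φ t) - 1 - Φ t) t|
      ≤ 2 ^ (k + 1) * ((6 + C) * C) * ((1 / c - c) ^ (k + 3) * Real.exp (-ν * |t|)) ∧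
    |iteratedDeriv (k + 1) (fun t => ψ t * ψ t) t|
      ≤ 2 ^ (k + 1) * ((6 + C) * C) * ((1 / c - c) ^ (k + 3) * Real.exp (-ν * |t|)) := by
  obtain ⟨hΔ, hΔ1, -, -⟩ := strength_facts S
  obtain ⟨sw, sΦ, sψ⟩ := h.sys.contDiff
  obtain ⟨z1, z2, z3, z4, z5, z6⟩ := h.size_bounds S t
  have sA : ContDiff ℝ ∞ (fun t => (w t)⁻¹) := sw.inv fun t => (h.sys.pos t).ne'
  have hW1 : Real.exp (-ν * |t|) ≤ 1 := by
    rw [Real.exp_le_one_iff]; nlinarith [abs_nonneg t]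
  have hW0 := (Real.exp_pos (-ν * |t|)).le
  set Δ := 1 / c - c
  have e : Δ * Δ ^ (k + 2) * Real.exp (-ν * |t|) = Δ ^ (k + 3) * Real.exp (-ν * |t|) := by ring
  refine ⟨?_, ?_, ?_⟩
  · have := abs_iteratedDeriv_mul_le (n := k) (M := 6) (θ := Δ) (sw.sub contDiff_const)
      (contDiff_const.sub sA) (by norm_num) hC hΔ.le le_rfl hW0 hW1 z1 z2
      (fun l h1 h2 => hB.volume.sub_const 1 l h1 h2 t)
      (fun l h1 h2 => hB.density.const_sub 1 l h1 h2 t)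
    rwa [e] at this
  · have hd : deriv (fun t => Real.exp (Φ t) - 1 - Φ t)
        = fun t => (Real.exp (Φ t) - 1) * deriv Φ t := by
      funext s
      have h1 := (h.sys.hΦ s).differentiableAt.hasDerivAt
      rw [((h1.exp.sub_const 1).fun_sub h1).deriv]; ring
    rw [iteratedDeriv_succ', hd]
    have := abs_iteratedDeriv_mul_deriv_le (n := k) (M := 6) (θ := Δ)
      (sΦ.exp.sub contDiff_const) sΦ (by norm_num) hC hΔ.le le_rfl hW0 hW1 z3
      (fun l h1 h2 => hB.density'.sub_const 1 l h1 (by omega) t)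
      (fun l h1 h2 => hB.potential l h1 h2 t)
    rw [e] at this
    refine this.trans (mul_le_mul_of_nonneg_right (mul_le_mul_of_nonneg_right ?_ ?_) ?_)
    · exact pow_le_pow_right₀ (by norm_num) (by omega)
    · positivity
    · positivity
  · have := abs_iteratedDeriv_mul_le (n := k) (M := 6) (θ := Δ) sψ sψ (by norm_num) hC hΔ.le le_rfl
      hW0 hW1 z4 z4 (fun l h1 h2 => hB.field l h1 h2 t) (fun l h1 h2 => hB.field l h1 h2 t)
    rwa [e] at this

/-- The recursion satisfied by the derivatives of the profile. -/
theorem iteratedDeriv_recursion (h : CenteredProfile T a r c w Φ ψ) (k : ℕ) (t : ℝ) :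
    iteratedDeriv (k + 2) w t = -a * (iteratedDeriv (k + 1) w t + iteratedDeriv (k + 1) Φ t
      + T * iteratedDeriv (k + 1) (fun t => (w t - 1) * (1 - (w t)⁻¹)) t
      + iteratedDeriv (k + 1) (fun t => Real.exp (Φ t) - 1 - Φ t) t
      - 1 / 2 * iteratedDeriv (k + 1) (fun t => ψ t * ψ t) t) ∧
    iteratedDeriv (k + 2) Φ t = iteratedDeriv (k + 1) ψ t ∧
    iteratedDeriv (k + 2) ψ t = iteratedDeriv (k + 1) w t + iteratedDeriv (k + 1) Φ t
      + iteratedDeriv (k + 1) (fun t => Real.exp (Φ t) - 1 - Φ t) t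
      - iteratedDeriv (k + 1) (fun t => (w t - 1) * (1 - (w t)⁻¹)) t := by
  obtain ⟨sw, sΦ, sψ⟩ := h.sys.contDiff
  have sA : ContDiff ℝ ∞ (fun t => (w t)⁻¹) := sw.inv fun t => (h.sys.pos t).ne'
  have at' : ∀ {F : ℝ → ℝ}, ContDiff ℝ ∞ F → ContDiffAt ℝ ((k + 1 : ℕ) : WithTop ℕ∞) F t :=
    fun hF => hF.contDiffAt.of_le (by exact_mod_cast le_top)
  have s1 : ContDiff ℝ ∞ (fun t => (w t - 1) * (1 - (w t)⁻¹)) :=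
    (sw.sub contDiff_const).mul (contDiff_const.sub sA)
  have s2 : ContDiff ℝ ∞ (fun t => Real.exp (Φ t) - 1 - Φ t) := (sΦ.exp.sub contDiff_const).sub sΦ
  have s3 : ContDiff ℝ ∞ (fun t => ψ t * ψ t) := sψ.mul sψ
  refine ⟨?_, ?_, ?_⟩
  · have hd : deriv w = fun t => (-a * (2 * T + 1 - (T + 1) * (c + 1 / c))) + (-a * (w t + Φ t
      + T * ((w t - 1) * (1 - (w t)⁻¹)) + (Real.exp (Φ t) - 1 - Φ t)
      - 1 / 2 * (ψ t * ψ t))) := by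
      funext s
      have := (h.sys.pos s).ne'
      rw [(h.sys.hw s).deriv]
      field_simp; ring
    rw [iteratedDeriv_succ', hd, iteratedDeriv_const_add (by omega), iteratedDeriv_const_mul_field,
      iteratedDeriv_fun_sub (at' (((sw.add sΦ).add (contDiff_const.mul s1)).add s2))
        (at' (contDiff_const.mul s3)),
      iteratedDeriv_fun_add (at' ((sw.add sΦ).add (contDiff_const.mul s1))) (at' s2),
      iteratedDeriv_fun_add (at' (sw.add sΦ)) (at' (contDiff_const.mul s1)),
      iteratedDeriv_fun_add (at' sw) (at' sΦ), iteratedDeriv_const_mul_field,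
      iteratedDeriv_const_mul_field]
  · rw [iteratedDeriv_succ', show deriv Φ = ψ from funext fun s => (h.sys.hΦ s).deriv]
  · have hd : deriv ψ = fun t => -1 + (w t + Φ t + (Real.exp (Φ t) - 1 - Φ t)
      - (w t - 1) * (1 - (w t)⁻¹)) := by
      funext s
      have := (h.sys.pos s).ne'
      rw [(h.sys.hψ s).deriv]
      field_simp; ring
    rw [iteratedDeriv_succ', hd, iteratedDeriv_const_add (by omega),
      iteratedDeriv_fun_sub (at' ((sw.add sΦ).add s2)) (at' s1),
      iteratedDeriv_fun_add (at' (sw.add sΦ)) (at' s2), iteratedDeriv_fun_add (at' sw) (at' sΦ)]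

theorem hasDerivAt_iteratedDeriv {F : ℝ → ℝ} (hF : ContDiff ℝ ∞ F) (k : ℕ) (t : ℝ) :
    HasDerivAt (iteratedDeriv k F) (iteratedDeriv (k + 1) F t) t := by
  rw [iteratedDeriv_succ]
  exact ((hF.differentiable_iteratedDeriv k (by exact_mod_cast ENat.natCast_lt_top k)) t).hasDerivAt

/-- The fast components of the derivatives of order `k + 1` are smaller by one power of the shock
strength. -/
theorem fast_bounds (S : SmallShock T a A σ r κ c) (h : CenteredProfile T a r c w Φ ψ)
    {k : ℕ} {C K : ℝ} (hC : 0 ≤ C) (hK : 0 ≤ K)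
    (hB : ProfileBound (1 / c - c) (a * (T + 1) / 8 * (1 / c - c)) C (k + 1) w Φ ψ)
    (h1 : ∀ t, |iteratedDeriv (k + 1) (fun t => (w t - 1) * (1 - (w t)⁻¹)) t|
      ≤ K * ((1 / c - c) ^ (k + 3) * Real.exp (-(a * (T + 1) / 8 * (1 / c - c)) * |t|)))
    (h2 : ∀ t, |iteratedDeriv (k + 1) (fun t => Real.exp (Φ t) - 1 - Φ t) t|
      ≤ K * ((1 / c - c) ^ (k + 3) * Real.exp (-(a * (T + 1) / 8 * (1 / c - c)) * |t|)))
    (h3 : ∀ t, |iteratedDeriv (k + 1) (fun t => ψ t * ψ t) t|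
      ≤ K * ((1 / c - c) ^ (k + 3) * Real.exp (-(a * (T + 1) / 8 * (1 / c - c)) * |t|)))
    (t : ℝ) :
    |iteratedDeriv (k + 1) ψ t| ≤ 4 * (1 + A) ^ 2 * (T + 4) * K * ((1 / c - c) ^ (k + 3)
      * Real.exp (-(a * (T + 1) / 8 * (1 / c - c)) * |t|)) ∧
    |iteratedDeriv (k + 1) Φ t + iteratedDeriv (k + 1) w t|
      ≤ 4 * (1 + A) ^ 2 * (T + 4) * K * ((1 / c - c) ^ (k + 3)
      * Real.exp (-(a * (T + 1) / 8 * (1 / c - c)) * |t|)) := by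
  obtain ⟨hΔ, hΔ1, hν0, hνA⟩ := strength_facts S
  obtain ⟨sw, sΦ, sψ⟩ := h.sys.contDiff
  have hA := S.A_pos
  have hT := S.T_nonneg
  set Δ := 1 / c - c
  set ν := a * (T + 1) / 8 * Δ
  set wk := iteratedDeriv (k + 1) w with hwk
  set Φk := iteratedDeriv (k + 1) Φ
  set ψk := iteratedDeriv (k + 1) ψ
  set q1 := iteratedDeriv (k + 1) (fun t => (w t - 1) * (1 - (w t)⁻¹))
  set q2 := iteratedDeriv (k + 1) (fun t => Real.exp (Φ t) - 1 - Φ t)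
  set q3 := iteratedDeriv (k + 1) (fun t => ψ t * ψ t)
  have hrec := h.iteratedDeriv_recursion k
  have dw : ∀ t, HasDerivAt wk (-a * (wk t + Φk t + T * q1 t + q2 t - 1 / 2 * q3 t)) t := fun t =>
    (hasDerivAt_iteratedDeriv sw (k + 1) t).congr_deriv (hrec t).1
  have dΦ : ∀ t, HasDerivAt Φk (ψk t) t := fun t =>
    (hasDerivAt_iteratedDeriv sΦ (k + 1) t).congr_deriv (hrec t).2.1
  have dψ : ∀ t, HasDerivAt ψk (wk t + Φk t + q2 t - q1 t) t := fun t =>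
    (hasDerivAt_iteratedDeriv sψ (k + 1) t).congr_deriv (hrec t).2.2
  have hbd : ∀ {F : ℝ → ℝ}, DerivBound Δ ν C (k + 1) F → ∀ t,
      |iteratedDeriv (k + 1) F t| ≤ C * Δ ^ (k + 2) := fun hF t => by
    refine (hF (k + 1) (by omega) le_rfl t).trans (mul_le_of_le_one_right (by positivity) ?_)
    rw [Real.exp_le_one_iff]; nlinarith [abs_nonneg t]
  have bw := hbd hB.volume
  have bΦ := hbd hB.potential
  have bψ := hbd hB.field
  set B := C * Δ ^ (k + 2)
  have hσ := S.σ_pos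
  have hσ1 := S.σ_lt
  have hσA := S.inv_le_σ
  have hI : 1 / (2 * (1 + A)) = 1 / (1 + A) / 2 := by field_simp
  have hgap : ∀ τ, 1 / (1 + A) ≤ τ → ν < τ ∧
      ∀ {Z : ℝ}, 0 ≤ Z → Z / (τ - ν) ≤ 2 * (1 + A) * Z := fun τ hτ => by
    have hp := S.inv_pos
    have hm : 1 / (2 * (1 + A)) ≤ τ - ν := by linarith
    refine ⟨by linarith, fun {Z} hZ => ?_⟩
    rw [div_le_iff₀ (by linarith)]
    have : 1 ≤ 2 * (1 + A) * (τ - ν) := by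
      rw [div_le_iff₀ (by linarith)] at hm; linarith
    nlinarith
  have hforce : ∀ α β : ℝ, |α| ≤ 1 + A → |β| ≤ 1 → ∀ t,
      |α * (-(T * q1 t) - q2 t + 1 / 2 * q3 t) + β * (q2 t - q1 t)|
        ≤ (1 + A) * (T + 4) * K * Δ ^ (k + 3) * Real.exp (-ν * |t|) := fun α β hα hβ t => by
    have e1 := h1 t
    have e2 := h2 t
    have e3 := h3 t
    set Z := Δ ^ (k + 3) * Real.exp (-ν * |t|)
    have hZ : 0 ≤ K * Z := by positivity
    have f1 : |-(T * q1 t) - q2 t + 1 / 2 * q3 t| ≤ (T + 2) * (K * Z) := by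
      have g := mul_le_mul_of_nonneg_left e1 hT
      have a1 := abs_add_le (-(T * q1 t) - q2 t) (1 / 2 * q3 t)
      have a2 := abs_sub (-(T * q1 t)) (q2 t)
      rw [abs_neg, abs_mul, abs_of_nonneg hT] at a2
      rw [abs_mul, abs_of_nonneg (by norm_num : (0 : ℝ) ≤ 1 / 2)] at a1
      nlinarith
    have f2 : |q2 t - q1 t| ≤ 2 * (K * Z) := (abs_sub _ _).trans (by linarith)
    refine (abs_add_le _ _).trans ?_
    rw [abs_mul, abs_mul]
    have g1 := mul_le_mul hα f1 (abs_nonneg _) (by linarith)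
    have g2 := mul_le_mul hβ f2 (abs_nonneg _) zero_le_one
    have : (1 + A) * (T + 4) * K * Δ ^ (k + 3) * Real.exp (-ν * |t|)
        = (1 + A) * (T + 4) * (K * Z) := by simp only [Z]; ring
    rw [this]
    nlinarith [mul_nonneg hA.le hZ]
  have hK2 : 0 ≤ (1 + A) * (T + 4) * K * Δ ^ (k + 3) := by positivity
  have hρ0 : ∀ t : ℝ, 0 ≤ Real.exp (-ν * |t|) := fun _ => (Real.exp_pos _).le
  have hp : |σ * (Φk t + wk t) + ψk t|
      ≤ 2 * (1 + A) * ((1 + A) * (T + 4) * K * Δ ^ (k + 3) * Real.exp (-ν * |t|)) := by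
    refine (abs_le_of_unstable (f := fun t => σ * (Φk t + wk t) + ψk t)
      (g := fun t => σ * a * (-(T * q1 t) - q2 t + 1 / 2 * q3 t) + 1 * (q2 t - q1 t))
      (ρ := fun t => Real.exp (-ν * |t|)) (B := 1 * (B + B) + B) hν0 (hgap σ hσA).1 (fun t => ?_)
      (fun t => ?_) hK2 hρ0 (fun s t hst => ?_) (hforce _ _ S.abs_σa_le (by simp)) t).trans
      ((hgap σ hσA).2 (by positivity))
    · refine ((((dΦ t).add (dw t)).const_mul σ).add (dψ t)).congr_deriv ?_
      linear_combination (-(Φk t + wk t)) * S.σ_eq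
    · refine (abs_add_le _ _).trans (add_le_add ?_ (bψ t))
      rw [abs_mul, abs_of_pos hσ]
      exact mul_le_mul hσ1.le ((abs_add_le _ _).trans (add_le_add (bΦ t) (bw t))) (abs_nonneg _)
        zero_le_one
    · have := exp_neg_weight_le hν0 s t
      rwa [abs_of_nonneg (sub_nonneg.2 hst)] at this
  have hq : |-(Φk t + wk t) + σ * ψk t|
      ≤ 2 * (1 + A) * ((1 + A) * (T + 4) * K * Δ ^ (k + 3) * Real.exp (-ν * |t|)) := by
    refine (abs_le_of_stable (f := fun t => -(Φk t + wk t) + σ * ψk t)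
      (g := fun t => -a * (-(T * q1 t) - q2 t + 1 / 2 * q3 t) + σ * (q2 t - q1 t))
      (ρ := fun t => Real.exp (-ν * |t|)) (B := (B + B) + 1 * B) hν0 (hgap _ S.inv_le_τ).1
      (fun t => ?_) (fun t => ?_) hK2 hρ0 (fun s t hst => ?_)
      (hforce _ _ S.abs_neg_a_le (by rw [abs_of_pos hσ]; exact hσ1.le)) t).trans
      ((hgap _ S.inv_le_τ).2 (by positivity))
    · refine ((((dΦ t).add (dw t)).neg).add ((dψ t).const_mul σ)).congr_deriv ?_
      linear_combination (ψk t) * S.σ_eq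
    · refine (abs_add_le _ _).trans (add_le_add ?_ ?_)
      · rw [abs_neg]; exact (abs_add_le _ _).trans (add_le_add (bΦ t) (bw t))
      · rw [abs_mul, abs_of_pos hσ]
        exact mul_le_mul hσ1.le (bψ t) (abs_nonneg _) zero_le_one
    · have := exp_neg_weight_le hν0 s t
      rwa [abs_sub_comm, abs_of_nonneg (sub_nonneg.2 hst)] at this
  have hF := S.abs_field_le (σ * (Φk t + wk t) + ψk t) (-(Φk t + wk t) + σ * ψk t)
  have hG := S.abs_fast_le (σ * (Φk t + wk t) + ψk t) (-(Φk t + wk t) + σ * ψk t)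
  rw [fieldOf_coord] at hF
  have e : (σ * (σ * (Φk t + wk t) + ψk t) - (-(Φk t + wk t) + σ * ψk t)) / (1 + σ ^ 2)
      = Φk t + wk t := by
    have hd0 : (1 + σ ^ 2 : ℝ) ≠ 0 := by positivity
    field_simp; ring
  rw [e] at hG
  have e2 : 4 * (1 + A) ^ 2 * (T + 4) * K * (Δ ^ (k + 3) * Real.exp (-ν * |t|))
      = 2 * (1 + A) * ((1 + A) * (T + 4) * K * Δ ^ (k + 3) * Real.exp (-ν * |t|))
        + 2 * (1 + A) * ((1 + A) * (T + 4) * K * Δ ^ (k + 3) * Real.exp (-ν * |t|)) := by ring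
  rw [e2]
  exact ⟨hF.trans (add_le_add hp hq), hG.trans (add_le_add hp hq)⟩

/-- The bounds of one more derivative of the volume, the potential and the field. -/
theorem system_bounds_succ (S : SmallShock T a A σ r κ c) (h : CenteredProfile T a r c w Φ ψ)
    {k : ℕ} {C K L C₁ : ℝ} (hC : 0 ≤ C) (hK : K = 2 ^ (k + 1) * ((6 + C) * C))
    (hL : L = 4 * (1 + A) ^ 2 * (T + 4) * K) (hC₁ : C₁ = C + K + (1 + A) * (L + (T + 2) * K))
    (hB : ProfileBound (1 / c - c) (a * (T + 1) / 8 * (1 / c - c)) C (k + 1) w Φ ψ) :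
    DerivBound (1 / c - c) (a * (T + 1) / 8 * (1 / c - c)) C₁ (k + 2) w ∧
    DerivBound (1 / c - c) (a * (T + 1) / 8 * (1 / c - c)) C₁ (k + 2) Φ ∧
    DerivBound (1 / c - c) (a * (T + 1) / 8 * (1 / c - c)) C₁ (k + 2) ψ := by
  have hA := S.A_pos
  have hT := S.T_nonneg
  have hK0 : 0 ≤ K := by rw [hK]; positivity
  have hL0 : 0 ≤ L := by rw [hL]; positivity
  obtain ⟨hΔ, hΔ1, hν0, -⟩ := strength_facts S
  have hQ := h.quadratic_bounds S hC hν0 hB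
  rw [← hK] at hQ
  have hF := h.fast_bounds S hC hK0 hB (fun t => (hQ t).1) (fun t => (hQ t).2.1)
    (fun t => (hQ t).2.2)
  rw [← hL] at hF
  have hrec := h.iteratedDeriv_recursion k
  have hTK : 0 ≤ (T + 2) * K := by positivity
  have hALK : 0 ≤ A * (L + (T + 2) * K) := by positivity
  have hLC : L ≤ C₁ := by rw [hC₁]; linarith
  have hCC₁ : C ≤ C₁ := by rw [hC₁]; linarith
  set Δ := 1 / c - c
  set ν := a * (T + 1) / 8 * Δ
  have bw : DerivBound Δ ν C₁ (k + 2) w := (hB.volume.mono hΔ.le hCC₁).succ fun t => by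
    obtain ⟨f1, f2⟩ := hF t
    obtain ⟨g1, g2, g3⟩ := hQ t
    rw [(hrec t).1, mul_assoc]
    set Z := Δ ^ (k + 3) * Real.exp (-ν * |t|)
    have hZ : 0 ≤ Z := by positivity
    rw [abs_mul, abs_neg, abs_of_pos S.a_pos]
    have hin : |iteratedDeriv (k + 1) w t + iteratedDeriv (k + 1) Φ t
      + T * iteratedDeriv (k + 1) (fun t => (w t - 1) * (1 - (w t)⁻¹)) t
      + iteratedDeriv (k + 1) (fun t => Real.exp (Φ t) - 1 - Φ t) t
      - 1 / 2 * iteratedDeriv (k + 1) (fun t => ψ t * ψ t) t| ≤ (L + (T + 2) * K) * Z := by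
      refine (abs_sub _ _).trans ?_
      refine (add_le_add (abs_add_le _ _) le_rfl).trans ?_
      refine (add_le_add (add_le_add (abs_add_le _ _) le_rfl) le_rfl).trans ?_
      rw [abs_mul, abs_mul, abs_of_nonneg hT, abs_of_nonneg (by norm_num : (0 : ℝ) ≤ 1 / 2),
        add_comm (iteratedDeriv (k + 1) w t)]
      have := mul_le_mul_of_nonneg_left g1 hT
      nlinarith [mul_nonneg hK0 hZ]
    refine (mul_le_mul S.a_le hin (abs_nonneg _) hA.le).trans ?_
    rw [← mul_assoc]
    refine mul_le_mul_of_nonneg_right ?_ hZ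
    have : 0 ≤ (T + 2) * K := by positivity
    rw [hC₁]; nlinarith
  have bΦ : DerivBound Δ ν C₁ (k + 2) Φ := (hB.potential.mono hΔ.le hCC₁).succ fun t => by
    rw [(hrec t).2.1, mul_assoc]
    exact (hF t).1.trans (mul_le_mul_of_nonneg_right hLC (by positivity))
  have bψ : DerivBound Δ ν C₁ (k + 2) ψ := (hB.field.mono hΔ.le hCC₁).succ fun t => by
    obtain ⟨f1, f2⟩ := hF t
    obtain ⟨g1, g2, g3⟩ := hQ t
    rw [(hrec t).2.2, mul_assoc]
    set Z := Δ ^ (k + 3) * Real.exp (-ν * |t|)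
    have hZ : 0 ≤ Z := by positivity
    refine (abs_sub _ _).trans ?_
    refine (add_le_add (abs_add_le _ _) le_rfl).trans ?_
    rw [add_comm (iteratedDeriv (k + 1) w t)]
    have : L + 2 * K ≤ C₁ := by
      have : 0 ≤ A * (L + (T + 2) * K) := by positivity
      have : 0 ≤ T * K := by positivity
      rw [hC₁]; linarith
    nlinarith [mul_le_mul_of_nonneg_right this hZ]
  exact ⟨bw, bΦ, bψ⟩

theorem density_bound_succ (S : SmallShock T a A σ r κ c) (h : CenteredProfile T a r c w Φ ψ)
    {k : ℕ} {C K C₁ C₂ ν : ℝ} (hν0 : 0 ≤ ν) (hC : 0 ≤ C) (hCC₁ : C ≤ C₁)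
    (hK : K = 2 ^ (k + 1) * ((6 + C) * C)) (hKC₁ : K ≤ C₁)
    (hC₂ : C₂ = C₁ + 2 ^ (k + 1) * ((6 + C₁) * C₁))
    (hB : DerivBound (1 / c - c) ν C (k + 1) (fun t => (w t)⁻¹))
    (bw : DerivBound (1 / c - c) ν C₁ (k + 2) w) :
    DerivBound (1 / c - c) ν C₂ (k + 2) (fun t => (w t)⁻¹) := by
  have hC₁0 : 0 ≤ C₁ := hC.trans hCC₁
  obtain ⟨hΔ, hΔ1, -, -⟩ := strength_facts S
  obtain ⟨sw, sΦ, sψ⟩ := h.sys.contDiff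
  have hC12 : C₁ ≤ C₂ := by
    have : 0 ≤ 2 ^ (k + 1) * ((6 + C₁) * C₁) := by positivity
    linarith
  have hW : ∀ t, Real.exp (-ν * |t|) ≤ 1 := fun t => by
    rw [Real.exp_le_one_iff]; nlinarith [abs_nonneg t]
  have hW0 : ∀ t : ℝ, 0 ≤ Real.exp (-ν * |t|) := fun t => (Real.exp_pos _).le
  have sA : ContDiff ℝ ∞ (fun t => (w t)⁻¹) := sw.inv fun t => (h.sys.pos t).ne'
  set Δ := 1 / c - c
  refine (hB.mono hΔ.le (hCC₁.trans hC12)).succ fun t => ?_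
  have hd : deriv (fun t => (w t)⁻¹) = fun t => -(((w t)⁻¹ * (w t)⁻¹) * deriv w t) := by
    funext s
    have h1 := (h.sys.hw s).differentiableAt.hasDerivAt
    have := (h.sys.pos s).ne'
    rw [(h1.fun_inv this).deriv]; field_simp
  rw [iteratedDeriv_succ', hd, iteratedDeriv_fun_neg, abs_neg]
  have hA6 : ∀ s, |(w s)⁻¹| ≤ 6 * 1 := fun s => by
    rw [mul_one]; exact (h.size_bounds S s).2.2.2.2.1
  have hA2 : |(w t)⁻¹ * (w t)⁻¹| ≤ 6 * 1 := by
    have := (h.volume_mem S t).1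
    have h2 : (w t)⁻¹ ≤ 2 := inv_le_of_inv_le₀ (by norm_num) (by linarith)
    have h3 : 0 < (w t)⁻¹ := by have := h.sys.pos t; positivity
    rw [abs_of_pos (by positivity)]; nlinarith
  have hsq : ∀ l, 1 ≤ l → l ≤ k + 1 → |iteratedDeriv l (fun t => (w t)⁻¹ * (w t)⁻¹) t|
      ≤ C₁ * Δ ^ (l + 1) * Real.exp (-ν * |t|) := by
    intro l h1 h2
    obtain ⟨m, rfl⟩ : ∃ m, l = m + 1 := ⟨l - 1, by omega⟩
    have := abs_iteratedDeriv_mul_le (n := m) (M := 6) (θ := 1) sA sA (by norm_num) hC hΔ.le hΔ1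
      (hW0 t) (hW t) (hA6 t) (hA6 t) (fun i i1 i2 => hB i i1 (by omega) t)
      (fun i i1 i2 => hB i i1 (by omega) t)
    refine this.trans ?_
    rw [one_mul, mul_assoc C₁]
    refine mul_le_mul_of_nonneg_right (le_trans ?_ hKC₁) (by have := hW0 t; positivity)
    rw [hK]
    exact mul_le_mul_of_nonneg_right (pow_le_pow_right₀ (by norm_num) h2) (by positivity)
  have := abs_iteratedDeriv_mul_deriv_le (n := k + 1) (M := 6) (θ := 1) (sA.mul sA) sw
    (by norm_num) hC₁0 hΔ.le hΔ1 (hW0 t) (hW t) hA2 hsq (fun i i1 i2 => bw i i1 i2 t)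
  refine this.trans ?_
  rw [one_mul, mul_assoc C₂]
  exact mul_le_mul_of_nonneg_right (by linarith) (by have := hW0 t; positivity)

theorem exp_bound_succ (S : SmallShock T a A σ r κ c) (h : CenteredProfile T a r c w Φ ψ)
    {k : ℕ} {C C₁ C₂ ν : ℝ} (hν0 : 0 ≤ ν) (hC : 0 ≤ C) (hCC₁ : C ≤ C₁)
    (hC₂ : C₂ = C₁ + 2 ^ (k + 1) * ((6 + C₁) * C₁))
    (hB : DerivBound (1 / c - c) ν C (k + 1) (fun t => Real.exp (Φ t)))
    (bΦ : DerivBound (1 / c - c) ν C₁ (k + 2) Φ) :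
    DerivBound (1 / c - c) ν C₂ (k + 2) (fun t => Real.exp (Φ t)) := by
  have hC₁0 : 0 ≤ C₁ := hC.trans hCC₁
  obtain ⟨hΔ, hΔ1, -, -⟩ := strength_facts S
  obtain ⟨sw, sΦ, sψ⟩ := h.sys.contDiff
  have hC12 : C₁ ≤ C₂ := by
    have : 0 ≤ 2 ^ (k + 1) * ((6 + C₁) * C₁) := by positivity
    linarith
  have hW : ∀ t, Real.exp (-ν * |t|) ≤ 1 := fun t => by
    rw [Real.exp_le_one_iff]; nlinarith [abs_nonneg t]
  have hW0 : ∀ t : ℝ, 0 ≤ Real.exp (-ν * |t|) := fun t => (Real.exp_pos _).le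
  set Δ := 1 / c - c
  refine (hB.mono hΔ.le (hCC₁.trans hC12)).succ fun t => ?_
  have hd : deriv (fun t => Real.exp (Φ t)) = fun t => Real.exp (Φ t) * deriv Φ t := by
    funext s
    exact (h.sys.hΦ s).differentiableAt.hasDerivAt.exp.deriv
  rw [iteratedDeriv_succ', hd]
  have := abs_iteratedDeriv_mul_deriv_le (n := k + 1) (M := 6) (θ := 1) sΦ.exp sΦ
    (by norm_num) hC₁0 hΔ.le hΔ1 (hW0 t) (hW t)
    (by rw [mul_one]; exact (h.size_bounds S t).2.2.2.2.2)
    (fun i i1 i2 => (hB.mono hΔ.le hCC₁) i i1 i2 t) (fun i i1 i2 => bΦ i i1 i2 t)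
  refine this.trans ?_
  rw [one_mul, mul_assoc C₂]
  exact mul_le_mul_of_nonneg_right (by linarith) (by have := hW0 t; positivity)

theorem exists_profileBound_succ {T A : ℝ} (hT : 0 ≤ T) (hA : 0 < A) {C : ℝ} (hC : 0 ≤ C) (k : ℕ) :
    ∃ C', 0 ≤ C' ∧ ∀ {a σ r κ c : ℝ} {w Φ ψ : ℝ → ℝ}, SmallShock T a A σ r κ c →
      CenteredProfile T a r c w Φ ψ →
      ProfileBound (1 / c - c) (a * (T + 1) / 8 * (1 / c - c)) C (k + 1) w Φ ψ →
      ProfileBound (1 / c - c) (a * (T + 1) / 8 * (1 / c - c)) C' (k + 2) w Φ ψ := by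
  obtain ⟨K, hK⟩ : ∃ K, K = 2 ^ (k + 1) * ((6 + C) * C) := ⟨_, rfl⟩
  obtain ⟨L, hL⟩ : ∃ L, L = 4 * (1 + A) ^ 2 * (T + 4) * K := ⟨_, rfl⟩
  obtain ⟨C₁, hC₁⟩ : ∃ C₁, C₁ = C + K + (1 + A) * (L + (T + 2) * K) := ⟨_, rfl⟩
  obtain ⟨C₂, hC₂⟩ : ∃ C₂, C₂ = C₁ + 2 ^ (k + 1) * ((6 + C₁) * C₁) := ⟨_, rfl⟩
  have hK0 : 0 ≤ K := by rw [hK]; positivity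
  have hL0 : 0 ≤ L := by rw [hL]; positivity
  have hin : 0 ≤ (1 + A) * (L + (T + 2) * K) := by positivity
  have hCC₁ : C ≤ C₁ := by rw [hC₁]; linarith
  have hKC₁ : K ≤ C₁ := by rw [hC₁]; linarith
  have hC₁0 : 0 ≤ C₁ := hC.trans hCC₁
  have hC12 : C₁ ≤ C₂ := by
    have : 0 ≤ 2 ^ (k + 1) * ((6 + C₁) * C₁) := by positivity
    linarith
  refine ⟨C₂, hC₁0.trans hC12, fun {a σ r κ c w Φ ψ} S h hB => ?_⟩
  obtain ⟨hΔ, -, hν0, -⟩ := strength_facts S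
  obtain ⟨bw, bΦ, bψ⟩ := h.system_bounds_succ S hC hK hL hC₁ hB
  exact ⟨bw.mono hΔ.le hC12, h.density_bound_succ S hν0 hC hCC₁ hK hKC₁ hC₂ hB.density bw,
    bΦ.mono hΔ.le hC12, h.exp_bound_succ S hν0 hC hCC₁ hC₂ hB.density' bΦ, bψ.mono hΔ.le hC12⟩

/-- Bounds of all derivatives, uniformly in the strength of the shock. -/
theorem exists_profileBound {T A : ℝ} (hT : 0 ≤ T) (hA : 0 < A) (k : ℕ) :
    ∃ C, 0 ≤ C ∧ ∀ {a σ r κ c : ℝ} {w Φ ψ : ℝ → ℝ}, SmallShock T a A σ r κ c →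
      CenteredProfile T a r c w Φ ψ →
      ProfileBound (1 / c - c) (a * (T + 1) / 8 * (1 / c - c)) C (k + 1) w Φ ψ := by
  induction k with
  | zero => exact ⟨120 * A * (T + 1), by positivity, fun S h => h.profileBound_one S⟩
  | succ k ih =>
    obtain ⟨C, hC, h⟩ := ih
    obtain ⟨C', hC', h'⟩ := exists_profileBound_succ hT hA hC k
    exact ⟨C', hC', fun S hp => h' S hp (h S hp)⟩

end CenteredProfile

/-- The right-hand side of the volume equation, up to the factor `-a`. -/
noncomputable def stressDefect (T c w Φ ψ : ℝ) : ℝ :=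
  (T + 1) * w + T / w + Real.exp Φ - ψ ^ 2 / 2 - (T + 1) * (c + 1 / c)

/-- A Lyapunov function of the normalised system. -/
noncomputable def profileEnergy (T c w Φ ψ : ℝ) : ℝ :=
  (T + 1) * w ^ 2 / 2 - T * Real.log w + Φ - w * stressDefect T c w Φ ψ

/-- Lower bound of a function over one time step, from a lower bound of its second derivative. -/
theorem le_of_second_deriv_ge {Φ ψ G H ψ' : ℝ → ℝ} {t s m γ b : ℝ} (hs : 0 < s) (hm : 0 ≤ m)
    (hΦ : ∀ x, HasDerivAt Φ (ψ x) x) (hψ : ∀ x, HasDerivAt ψ (ψ' x) x)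
    (hG : ∀ x, HasDerivAt G (Φ x - H x) x) (hψ' : ∀ x ∈ Set.Icc t (t + s), -m ≤ ψ' x)
    (hH : ∀ x ∈ Set.Icc t (t + s), H x ≤ b) (hγ : G (t + s) - G t ≤ γ) (h0 : 0 ≤ ψ t) :
    Φ t ≤ b + m * s ^ 2 + γ / s := by
  have hts : t ≤ t + s := by linarith
  have mono : ∀ {f f' : ℝ → ℝ} {d : ℝ}, (∀ x, HasDerivAt f (f' x) x) →
      (∀ x ∈ Set.Icc t (t + s), d ≤ f' x) → ∀ x ∈ Set.Icc t (t + s), f t + d * (x - t) ≤ f x := by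
    intro f f' d hf hd x hx
    have := (convex_Icc t (t + s)).mul_sub_le_image_sub_of_le_deriv (f := f) (C := d)
      (fun x _ => (hf x).continuousAt.continuousWithinAt)
      (fun x _ => (hf x).differentiableAt.differentiableWithinAt)
      (fun x hx => by rw [(hf x).deriv]; exact hd x (interior_subset hx)) t
      (Set.left_mem_Icc.2 hts) x hx hx.1
    linarith
  have h1 : ∀ x ∈ Set.Icc t (t + s), -(m * s) ≤ ψ x := fun x hx => by
    have := mono hψ hψ' x hx
    have h2 : x - t ≤ s := by linarith [hx.2]
    nlinarith [hx.1]
  have h2 : ∀ x ∈ Set.Icc t (t + s), Φ t - m * s ^ 2 ≤ Φ x := fun x hx => by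
    have := mono hΦ h1 x hx
    have h2 : x - t ≤ s := by linarith [hx.2]
    have h3 := mul_le_mul_of_nonneg_left h2 (by positivity : 0 ≤ m * s)
    nlinarith
  have h3 := mono hG (d := Φ t - m * s ^ 2 - b)
    (fun x hx => by linarith [h2 x hx, hH x hx]) (t + s) (Set.right_mem_Icc.2 hts)
  rw [add_sub_cancel_left] at h3
  have h4 : Φ t - m * s ^ 2 - b ≤ γ / s := by
    rw [le_div_iff₀ hs]; linarith
  linarith

theorem le_of_second_deriv_ge' {Φ ψ G H ψ' : ℝ → ℝ} {t s m γ b : ℝ} (hs : 0 < s) (hm : 0 ≤ m)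
    (hΦ : ∀ x, HasDerivAt Φ (ψ x) x) (hψ : ∀ x, HasDerivAt ψ (ψ' x) x)
    (hG : ∀ x, HasDerivAt G (Φ x - H x) x) (hψ' : ∀ x ∈ Set.Icc (t - s) (t + s), -m ≤ ψ' x)
    (hH : ∀ x ∈ Set.Icc (t - s) (t + s), H x ≤ b)
    (hγ : ∀ x ∈ Set.Icc (t - s) (t + s), |G x - G t| ≤ γ) :
    Φ t ≤ b + m * s ^ 2 + γ / s := by
  rcases le_total 0 (ψ t) with h0 | h0
  · refine le_of_second_deriv_ge hs hm hΦ hψ hG (fun x hx => hψ' x ⟨by linarith [hx.1], hx.2⟩)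
      (fun x hx => hH x ⟨by linarith [hx.1], hx.2⟩)
      ((le_abs_self _).trans (hγ _ ⟨by linarith, le_rfl⟩)) h0
  · have := le_of_second_deriv_ge (Φ := fun x => Φ (-x)) (ψ := fun x => -ψ (-x))
      (G := fun x => -G (-x)) (H := fun x => H (-x)) (ψ' := fun x => ψ' (-x)) (t := -t) (b := b)
      (γ := γ) hs hm
      (fun x => ((hΦ (-x)).scomp x (hasDerivAt_neg x)).congr_deriv (by simp))
      (fun x => ((hψ (-x)).scomp x (hasDerivAt_neg x)).neg.congr_deriv (by simp))
      (fun x => ((hG (-x)).scomp x (hasDerivAt_neg x)).neg.congr_deriv (by simp))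
      (fun x hx => hψ' (-x) ⟨by linarith [hx.2], by linarith [hx.1]⟩)
      (fun x hx => hH (-x) ⟨by linarith [hx.2], by linarith [hx.1]⟩)
      (by
        have h2 := hγ (t - s) ⟨le_rfl, by linarith⟩
        have h3 := neg_abs_le (G (t - s) - G t)
        rw [show -(-t + s) = t - s by ring, neg_neg]
        linarith)
      (by simpa using h0)
    simpa using this

/-- The derivative is controlled by the oscillation of the function and the second derivative. -/
theorem abs_deriv_le_of_osc {Φ ψ ψ' : ℝ → ℝ} {t s m γ : ℝ} (hs : 0 < s)
    (hΦ : ∀ x, HasDerivAt Φ (ψ x) x) (hψ : ∀ x, HasDerivAt ψ (ψ' x) x)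
    (hψ' : ∀ x ∈ Set.Icc t (t + s), |ψ' x| ≤ m) (hγ : |Φ (t + s) - Φ t| ≤ γ) :
    |ψ t| ≤ γ / s + m * s := by
  obtain ⟨ξ, hξ, he⟩ := exists_hasDerivAt_eq_slope Φ ψ (by linarith : t < t + s)
    (fun x _ => (hΦ x).continuousAt.continuousWithinAt) (fun x _ => hΦ x)
  rw [add_sub_cancel_left] at he
  have h1 : |ψ ξ| ≤ γ / s := by
    rw [he, abs_div, abs_of_pos hs]; gcongr
  have h2 : |ψ ξ - ψ t| ≤ m * (ξ - t) := by
    have := (convex_Icc t (t + s)).norm_image_sub_le_of_norm_hasDerivWithin_le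
      (fun x _ => (hψ x).hasDerivWithinAt) hψ' (Set.left_mem_Icc.2 (by linarith))
      (Set.Ioo_subset_Icc_self hξ)
    rwa [Real.norm_eq_abs, Real.norm_eq_abs, abs_of_pos (by linarith [hξ.1] : 0 < ξ - t)] at this
  have hm : 0 ≤ m := (abs_nonneg _).trans (hψ' t (Set.left_mem_Icc.2 (by linarith)))
  have h3 : m * (ξ - t) ≤ m * s := mul_le_mul_of_nonneg_left (by linarith [hξ.2]) hm
  have h4 := abs_sub_abs_le_abs_sub (ψ t) (ψ ξ)
  rw [abs_sub_comm] at h4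
  linarith

namespace NormalisedSystem

variable {T a c : ℝ} {w Φ ψ : ℝ → ℝ}

theorem hasDerivAt_volume (h : NormalisedSystem T a c w Φ ψ) (t : ℝ) :
    HasDerivAt w (-a * stressDefect T c (w t) (Φ t) (ψ t)) t := h.hw t

theorem hasDerivAt_energy (h : NormalisedSystem T a c w Φ ψ) (t : ℝ) :
    HasDerivAt (fun t => profileEnergy T c (w t) (Φ t) (ψ t))
      (a * stressDefect T c (w t) (Φ t) (ψ t) ^ 2) t := by
  have hw := h.hasDerivAt_volume t
  have hpos := h.pos t
  have hne := hpos.ne'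
  have hR : HasDerivAt (fun t => stressDefect T c (w t) (Φ t) (ψ t))
      (((T + 1) - T / w t ^ 2) * (-a * stressDefect T c (w t) (Φ t) (ψ t)) + ψ t / w t) t := by
    refine (((((hw.const_mul (T + 1)).add ((hasDerivAt_const t T).div hw hne)).add
      (h.hΦ t).exp).sub (((h.hψ t).pow 2).div_const 2)).sub_const _).congr_deriv ?_
    field_simp
    push_cast
    ring
  have hlog := (hw.log hne).const_mul T
  refine ((((((hw.pow 2).const_mul (T + 1)).div_const 2).sub hlog).add (h.hΦ t)).sub
    (hw.mul hR)).congr_deriv ?_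
  field_simp
  push_cast
  ring

/-- The energy controls the oscillation of the volume. -/
theorem abs_volume_sub_le (h : NormalisedSystem T a c w Φ ψ) (ha : 0 < a) {α η e₀ : ℝ}
    (hα : 0 < α) (hE : ∀ t, |profileEnergy T c (w t) (Φ t) (ψ t) - e₀| ≤ η) (x y : ℝ) :
    |w x - w y| ≤ α * a * η + |x - y| / (2 * α) := by
  have key : ∀ δ : ℝ, |δ| = 1 → ∀ x y, x ≤ y →
      δ * (w y - w x) ≤ α * a * η + (y - x) / (2 * α) := by
    intro δ hδ x y hxy
    have hδ2 : δ ^ 2 = 1 := by rw [← sq_abs, hδ, one_pow]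
    have hd : ∀ t, HasDerivAt
        (fun t => α * a / 2 * profileEnergy T c (w t) (Φ t) (ψ t) + t / (2 * α) - δ * w t)
        (α * a / 2 * (a * stressDefect T c (w t) (Φ t) (ψ t) ^ 2) + 1 / (2 * α)
          - δ * (-a * stressDefect T c (w t) (Φ t) (ψ t))) t := fun t =>
      (((h.hasDerivAt_energy t).const_mul _).add ((hasDerivAt_id t).div_const _)).sub
        ((h.hasDerivAt_volume t).const_mul δ)
    have hmono : Monotone
        (fun t => α * a / 2 * profileEnergy T c (w t) (Φ t) (ψ t) + t / (2 * α) - δ * w t) := by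
      refine monotone_of_deriv_nonneg (fun t => (hd t).differentiableAt) fun t => ?_
      rw [(hd t).deriv]
      have : α * a / 2 * (a * stressDefect T c (w t) (Φ t) (ψ t) ^ 2) + 1 / (2 * α)
          - δ * (-a * stressDefect T c (w t) (Φ t) (ψ t))
          = (α * a * stressDefect T c (w t) (Φ t) (ψ t) + δ) ^ 2 / (2 * α) := by
        field_simp
        linear_combination (-1 : ℝ) * hδ2
      rw [this]; positivity
    have h1 := hmono hxy
    simp only at h1
    have h2 := (abs_le.1 (hE x)).1
    have h3 := (abs_le.1 (hE y)).2
    have h4 : α * a / 2 * (profileEnergy T c (w y) (Φ y) (ψ y) - profileEnergy T c (w x) (Φ x) (ψ x))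
        ≤ α * a / 2 * (2 * η) := mul_le_mul_of_nonneg_left (by linarith) (by positivity)
    have h5 : (y - x) / (2 * α) = y / (2 * α) - x / (2 * α) := by ring
    rw [h5]; linarith
  have main : ∀ x y, x ≤ y → |w y - w x| ≤ α * a * η + (y - x) / (2 * α) := fun x y hxy => by
    have h1 := key 1 (by simp) x y hxy
    have h2 := key (-1) (by simp) x y hxy
    exact abs_le.2 ⟨by linarith, by linarith⟩
  rcases le_total x y with hxy | hxy
  · rw [abs_sub_comm, abs_sub_comm x y, abs_of_nonneg (sub_nonneg.2 hxy)]; exact main x y hxy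
  · rw [abs_of_nonneg (sub_nonneg.2 hxy)]; exact main y x hxy

end NormalisedSystem

theorem abs_entropy_sub_le {T x y : ℝ} (hT : 0 ≤ T) (hx : x ∈ Set.Icc (1 / 2 : ℝ) (3 / 2))
    (hy : y ∈ Set.Icc (1 / 2 : ℝ) (3 / 2)) :
    |((T + 1) * x ^ 2 / 2 - T * Real.log x) - ((T + 1) * y ^ 2 / 2 - T * Real.log y)|
      ≤ 4 * (T + 1) * |x - y| := by
  have hd : ∀ z ∈ Set.Icc (1 / 2 : ℝ) (3 / 2), HasDerivWithinAt
      (fun z => (T + 1) * z ^ 2 / 2 - T * Real.log z) ((T + 1) * z - T * z⁻¹)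
      (Set.Icc (1 / 2) (3 / 2)) z := fun z hz => by
    have hz0 : z ≠ 0 := by linarith [hz.1]
    exact (((((hasDerivAt_pow 2 z).const_mul (T + 1)).div_const 2).sub
      ((Real.hasDerivAt_log hz0).const_mul T)).congr_deriv
      (by push_cast; ring)).hasDerivWithinAt
  refine (convex_Icc (1 / 2 : ℝ) (3 / 2)).norm_image_sub_le_of_norm_hasDerivWithin_le hd
    (fun z hz => ?_) hy hx
  have hz0 : 0 < z := by linarith [hz.1]
  have h1 : z⁻¹ ≤ 2 := inv_le_of_inv_le₀ (by norm_num) (by linarith [hz.1])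
  have h2 : 0 < z⁻¹ := by positivity
  rw [Real.norm_eq_abs]
  refine abs_le.2 ⟨?_, ?_⟩ <;> nlinarith [hz.1, hz.2, mul_nonneg hT h2.le]

set_option maxHeartbeats 1600000 in
/-- A profile whose energy is almost constant is, near every time at which the volume is close to
`1`, almost at rest. -/
theorem NormalisedSystem.exists_window_bound {T a₁ A : ℝ} (hT : 0 ≤ T) (ha₁ : 0 < a₁) (hA : 0 < A) :
    ∃ K, 0 < K ∧ ∀ s, 0 < s → K * s ≤ 1 → ∀ {a c : ℝ} {w Φ ψ : ℝ → ℝ}, a₁ ≤ a → a ≤ A →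
      NormalisedSystem T a c w Φ ψ → |(T + 1) * (c + 1 / c - 2)| ≤ s →
      (∀ t, |profileEnergy T c (w t) (Φ t) (ψ t) - (T + 1) / 2| ≤ s ^ 6) →
      ∀ t₀, |w t₀ - 1| ≤ 1 / 4 → (w t₀ - 1) ^ 2 ≤ K * s ∧
        |Φ t₀ - ((T + 1) / 2 - ((T + 1) * w t₀ ^ 2 / 2 - T * Real.log (w t₀)))| ≤ K * s ∧
        |ψ t₀| ≤ K * s := by
  obtain ⟨B₀, hB₀⟩ : ∃ B₀, B₀ = A + 3 := ⟨_, rfl⟩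
  obtain ⟨K₁, hK₁⟩ : ∃ K₁, K₁ = 1 + 4 * (T + 1) * B₀ := ⟨_, rfl⟩
  obtain ⟨K₂, hK₂⟩ : ∃ K₂, K₂ = 3 * B₀ / (2 * a₁) := ⟨_, rfl⟩
  obtain ⟨K₄, hK₄⟩ : ∃ K₄, K₄ = Real.exp (T + 2) + 2 := ⟨_, rfl⟩
  obtain ⟨K₅, hK₅⟩ : ∃ K₅, K₅ = K₁ + K₄ + K₂ := ⟨_, rfl⟩
  obtain ⟨K₆, hK₆⟩ : ∃ K₆, K₆ = 2 * K₅ + K₄ := ⟨_, rfl⟩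
  obtain ⟨K₇, hK₇⟩ : ∃ K₇, K₇ = 2 * (K₅ + K₁) + 5 * K₆ + 1 := ⟨_, rfl⟩
  have pB₀ : 0 < B₀ := by linarith
  have pK₁ : 0 < K₁ := by rw [hK₁]; positivity
  have pK₂ : 0 < K₂ := by rw [hK₂]; positivity
  have pK₄ : 2 < K₄ := by rw [hK₄]; linarith [Real.exp_pos (T + 2)]
  have pK₅ : 0 < K₅ := by linarith
  have pK₆ : 0 < K₆ := by linarith
  have pK₇ : 0 < K₇ := by linarith
  refine ⟨3 * K₇ + 2 * B₀ ^ 2 + 4 * B₀ + 2, by positivity, ?_⟩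
  intro s hs hKs a c w Φ ψ ha haA h hc hE t₀ ht₀
  have pa : 0 < a := ha₁.trans_le ha
  have hB2 : 0 ≤ B₀ ^ 2 * s := by positivity
  have pK₇s := mul_pos pK₇ hs
  have pB₀s := mul_pos pB₀ hs
  have hexp : (3 * K₇ + 2 * B₀ ^ 2 + 4 * B₀ + 2) * s
      = 3 * (K₇ * s) + 2 * (B₀ ^ 2 * s) + 4 * (B₀ * s) + 2 * s := by ring
  rw [hexp] at hKs ⊢
  have sB₀ : B₀ * s ≤ 1 / 4 := by linarith
  have sK₇ : K₇ * s ≤ 1 := by linarith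
  have s_half : s ≤ 1 / 2 := by linarith
  have hs2 : s ^ 2 ≤ s := pow_le_of_le_one hs.le (by linarith) two_ne_zero
  have hs3 : s ^ 3 ≤ s ^ 2 := pow_le_pow_of_le_one hs.le (by linarith) (by norm_num)
  have hs6 : s ^ 6 ≤ s ^ 3 := pow_le_pow_of_le_one hs.le (by linarith) (by norm_num)
  have hs30 : 0 < s ^ 3 := by positivity
  -- the volume hardly varies
  have hw : ∀ x y, |x - y| ≤ 6 → |w x - w y| ≤ B₀ * s ^ 3 := fun x y hxy => by
    refine (h.abs_volume_sub_le pa (α := 1 / s ^ 3) (by positivity) hE x y).trans ?_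
    have e : 1 / s ^ 3 * a * s ^ 6 + |x - y| / (2 * (1 / s ^ 3)) = (a + |x - y| / 2) * s ^ 3 := by
      field_simp
    rw [e]
    exact mul_le_mul_of_nonneg_right (by linarith) hs30.le
  have hBs : B₀ * s ^ 3 ≤ 1 / 4 :=
    (mul_le_mul_of_nonneg_left (hs3.trans hs2) pB₀.le).trans sB₀
  have hmem : ∀ x, |x - t₀| ≤ 3 → w x ∈ Set.Icc (1 / 2 : ℝ) (3 / 2) := fun x hx => by
    have h1 := abs_le.1 (hw x t₀ (by linarith))
    have h2 := abs_le.1 ht₀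
    exact ⟨by linarith [h1.1, h2.1], by linarith [h1.2, h2.2]⟩
  have hmem₀ := hmem t₀ (by simp)
  set F : ℝ → ℝ := fun z => (T + 1) * z ^ 2 / 2 - T * Real.log z with hF
  set c₀ := (T + 1) / 2 - F (w t₀) with hc₀
  set H : ℝ → ℝ := fun x => profileEnergy T c (w x) (Φ x) (ψ x) - F (w x) with hH
  have hHb : ∀ x, |x - t₀| ≤ 3 → |H x - c₀| ≤ K₁ * s ^ 3 := fun x hx => by
    have h1 := abs_entropy_sub_le hT (hmem x hx) hmem₀
    have h2 := mul_le_mul_of_nonneg_left (hw x t₀ (by linarith)) (by linarith : 0 ≤ 4 * (T + 1))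
    have e : H x - c₀ = (profileEnergy T c (w x) (Φ x) (ψ x) - (T + 1) / 2)
        - (F (w x) - F (w t₀)) := by simp only [hH, hc₀]; ring
    rw [e, hK₁]
    refine (abs_sub _ _).trans ?_
    have h3 : |F (w x) - F (w t₀)| ≤ 4 * (T + 1) * |w x - w t₀| := h1
    linarith [hE x]
  have hdef : ∀ x, Φ x - H x = w x * stressDefect T c (w x) (Φ x) (ψ x) := fun x => by
    simp only [hH, hF, profileEnergy]; ring
  have hG : ∀ x, HasDerivAt (fun x => -(w x ^ 2) / (2 * a)) (Φ x - H x) x := fun x => by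
    rw [hdef]
    refine ((((h.hasDerivAt_volume x).pow 2).neg).div_const (2 * a)).congr_deriv ?_
    field_simp
    push_cast
    ring
  have hGb : ∀ x y, |x - t₀| ≤ 3 → |y - t₀| ≤ 3 →
      |-(w x ^ 2) / (2 * a) - -(w y ^ 2) / (2 * a)| ≤ K₂ * s ^ 3 := fun x y hx hy => by
    have hxy : |x - y| ≤ 6 := by
      have := _root_.abs_sub_le x t₀ y
      rw [abs_sub_comm t₀ y] at this
      linarith
    have h1 := hw x y hxy
    have mx := hmem x hx
    have my := hmem y hy
    have e : -(w x ^ 2) / (2 * a) - -(w y ^ 2) / (2 * a)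
        = -((w x + w y) * (w x - w y)) / (2 * a) := by ring
    rw [e, abs_div, abs_neg, abs_mul, abs_of_pos (by linarith [mx.1, my.1] : 0 < w x + w y),
      abs_of_pos (by linarith : 0 < 2 * a)]
    have h2 : (w x + w y) * |w x - w y| ≤ 3 * (B₀ * s ^ 3) :=
      mul_le_mul (by linarith [mx.2, my.2]) h1 (abs_nonneg _) (by norm_num)
    have h3 : K₂ * s ^ 3 = 3 * (B₀ * s ^ 3) / (2 * a₁) := by rw [hK₂]; ring
    rw [h3]
    have h4 : 0 ≤ 3 * (B₀ * s ^ 3) := by positivity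
    exact div_le_div₀ h4 h2 (by positivity) (by linarith)
  have near : ∀ {x t d : ℝ}, |t - t₀| ≤ d → x ∈ Set.Icc (t - s) (t + s) → |x - t₀| ≤ d + s :=
    fun {x t d} ht hx => by
      have := abs_le.1 ht
      exact abs_le.2 ⟨by linarith [this.1, hx.1], by linarith [this.2, hx.2]⟩
  have hdiv : K₂ * s ^ 3 / s = K₂ * s ^ 2 := by field_simp
  -- upper bound of the potential
  have hup : ∀ t, |t - t₀| ≤ 2 → Φ t ≤ c₀ + K₁ * s ^ 3 + 2 * s ^ 2 + K₂ * s ^ 2 := fun t ht => by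
    have := le_of_second_deriv_ge' (t := t) (m := 2) (b := c₀ + K₁ * s ^ 3) (γ := K₂ * s ^ 3) hs
      (by norm_num) h.hΦ h.hψ hG
      (fun x hx => by
        have mx := hmem x ((near ht hx).trans (by linarith))
        have h1 : 1 / w x ≤ 2 := by
          rw [div_le_iff₀ (h.pos x)]; linarith [mx.1]
        linarith [Real.exp_pos (Φ x)])
      (fun x hx => by linarith [(abs_le.1 (hHb x ((near ht hx).trans (by linarith)))).2])
      (fun x hx => hGb x t ((near ht hx).trans (by linarith)) (by linarith))
    linarith
  have hc₀b : |c₀| ≤ T + 1 := by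
    have h1 := abs_entropy_sub_le hT (by norm_num : (1 : ℝ) ∈ Set.Icc (1 / 2 : ℝ) (3 / 2)) hmem₀
    have e : c₀ = ((T + 1) * 1 ^ 2 / 2 - T * Real.log 1) - F (w t₀) := by
      rw [hc₀, Real.log_one]; ring
    rw [e]
    refine h1.trans ?_
    rw [abs_sub_comm]
    have := mul_le_mul_of_nonneg_left ht₀ (by linarith : 0 ≤ 4 * (T + 1))
    linarith
  have hψ' : ∀ t, |t - t₀| ≤ 2 → |Real.exp (Φ t) - 1 / w t| ≤ K₄ := fun t ht => by
    have h1 := hup t ht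
    have mx := hmem t (by linarith)
    have h2 : K₁ * s ^ 3 + 2 * s ^ 2 + K₂ * s ^ 2 ≤ 1 := by
      have i1 : K₁ * s ^ 3 ≤ K₁ * s := mul_le_mul_of_nonneg_left (hs3.trans hs2) pK₁.le
      have i2 : K₂ * s ^ 2 ≤ K₂ * s := mul_le_mul_of_nonneg_left hs2 pK₂.le
      have i3 : (K₁ + 2 + K₂) * s ≤ K₇ * s := mul_le_mul_of_nonneg_right (by linarith) hs.le
      linarith
    have h3 : Real.exp (Φ t) ≤ Real.exp (T + 2) :=
      Real.exp_le_exp.2 (by linarith [(abs_le.1 hc₀b).2])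
    have h4 : 1 / w t ≤ 2 := by
      rw [div_le_iff₀ (h.pos t)]; linarith [mx.1]
    have h5 : 0 < 1 / w t := one_div_pos.2 (h.pos t)
    exact abs_le.2 ⟨by linarith [Real.exp_pos (Φ t)], by linarith⟩
  -- lower bound of the potential
  have hlow : ∀ t, |t - t₀| ≤ 1 → c₀ - K₁ * s ^ 3 - K₄ * s ^ 2 - K₂ * s ^ 2 ≤ Φ t := fun t ht => by
    have := le_of_second_deriv_ge' (t := t) (m := K₄) (b := -c₀ + K₁ * s ^ 3) (γ := K₂ * s ^ 3)
      (Φ := fun x => -Φ x) (ψ := fun x => -ψ x) (G := fun x => -(-(w x ^ 2) / (2 * a)))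
      (H := fun x => -H x) (ψ' := fun x => -(Real.exp (Φ x) - 1 / w x)) hs
      (by linarith) (fun x => (h.hΦ x).neg) (fun x => (h.hψ x).neg)
      (fun x => (hG x).neg.congr_deriv (by ring))
      (fun x hx => by linarith [(abs_le.1 (hψ' x ((near ht hx).trans (by linarith)))).2])
      (fun x hx => by linarith [(abs_le.1 (hHb x ((near ht hx).trans (by linarith)))).1])
      (fun x hx => by
        rw [neg_sub_neg, abs_sub_comm]
        exact hGb x t ((near ht hx).trans (by linarith)) (by linarith))
    linarith
  have hΦ : ∀ t, |t - t₀| ≤ 1 → |Φ t - c₀| ≤ K₅ * s ^ 2 := fun t ht => by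
    have h1 := hup t (by linarith)
    have h2 := hlow t ht
    have h3 : K₁ * s ^ 3 ≤ K₁ * s ^ 2 := mul_le_mul_of_nonneg_left hs3 pK₁.le
    have h4 : 2 * s ^ 2 ≤ K₄ * s ^ 2 := mul_le_mul_of_nonneg_right pK₄.le (by positivity)
    rw [hK₅]
    exact abs_le.2 ⟨by linarith, by linarith⟩
  have hψ : ∀ t, |t - t₀| ≤ 1 / 2 → |ψ t| ≤ K₆ * s := fun t ht => by
    have ht' := abs_le.1 ht
    have := abs_deriv_le_of_osc (t := t) (m := K₄) (γ := 2 * K₅ * s ^ 2) hs h.hΦ h.hψ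
      (fun x hx => hψ' x (by
        have := near ht (x := x) ⟨by linarith [hx.1], hx.2⟩
        linarith))
      (by
        have h1 := hΦ (t + s) (abs_le.2 ⟨by linarith [ht'.1], by linarith [ht'.2]⟩)
        have h2 := hΦ t (by linarith)
        rw [show Φ (t + s) - Φ t = (Φ (t + s) - c₀) - (Φ t - c₀) by ring]
        exact (abs_sub _ _).trans (by linarith))
    refine this.trans (le_of_eq ?_)
    rw [hK₆]; field_simp
  -- a time at which the Poisson equation is almost balanced
  obtain ⟨t', ht', he⟩ := exists_hasDerivAt_eq_slope ψ (fun x => Real.exp (Φ x) - 1 / w x)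
    (by linarith : t₀ < t₀ + 1 / 2) (fun x _ => (h.hψ x).continuousAt.continuousWithinAt)
    (fun x _ => h.hψ x)
  rw [add_sub_cancel_left] at he
  have hnear : |t' - t₀| ≤ 1 / 2 := abs_le.2 ⟨by linarith [ht'.1], by linarith [ht'.2]⟩
  have hbal : |Real.exp (Φ t') - 1 / w t'| ≤ 4 * K₆ * s := by
    rw [he, abs_div, abs_of_pos (by norm_num : (0 : ℝ) < 1 / 2), div_le_iff₀ (by norm_num)]
    have h1 := hψ (t₀ + 1 / 2) (by norm_num)
    have h2 := hψ t₀ (by simp)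
    exact (abs_sub _ _).trans (by linarith)
  have m' := hmem t' (by linarith)
  have hR : |stressDefect T c (w t') (Φ t') (ψ t')| ≤ 2 * (K₅ + K₁) * s := by
    have h1 : |w t' * stressDefect T c (w t') (Φ t') (ψ t')| ≤ (K₅ + K₁) * s := by
      rw [← hdef, show Φ t' - H t' = (Φ t' - c₀) - (H t' - c₀) by ring]
      refine (abs_sub _ _).trans ?_
      have h1 := hΦ t' (by linarith)
      have h2 := hHb t' (by linarith)
      have i1 : K₁ * s ^ 3 ≤ K₁ * s := mul_le_mul_of_nonneg_left (hs3.trans hs2) pK₁.le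
      have i2 : K₅ * s ^ 2 ≤ K₅ * s := mul_le_mul_of_nonneg_left hs2 pK₅.le
      linarith
    rw [abs_mul, abs_of_pos (h.pos t')] at h1
    have := mul_le_mul_of_nonneg_right m'.1 (abs_nonneg (stressDefect T c (w t') (Φ t') (ψ t')))
    linarith
  have hsq : (w t' - 1) ^ 2 ≤ 3 / 2 * (K₇ * s) := by
    have hne := (h.pos t').ne'
    have e : (T + 1) * ((w t' - 1) ^ 2 / w t') = stressDefect T c (w t') (Φ t') (ψ t')
        - (Real.exp (Φ t') - 1 / w t') + ψ t' ^ 2 / 2 + (T + 1) * (c + 1 / c - 2) := by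
      rw [stressDefect]; field_simp; ring
    have h1 := hψ t' hnear
    have h6 : K₆ * s ≤ 1 := (mul_le_mul_of_nonneg_right (by linarith) hs.le).trans sK₇
    have h2 : ψ t' ^ 2 ≤ K₆ * s := by
      rw [← sq_abs]
      exact (pow_le_pow_left₀ (abs_nonneg _) h1 2).trans
        (pow_le_of_le_one (mul_pos pK₆ hs).le h6 two_ne_zero)
    have h3 : (T + 1) * ((w t' - 1) ^ 2 / w t') ≤ K₇ * s := by
      rw [e, hK₇]
      linarith [(abs_le.1 hR).2, (abs_le.1 hbal).1, (abs_le.1 hc).2, mul_pos pK₆ hs]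
    have h4 : 0 ≤ (w t' - 1) ^ 2 / w t' := div_nonneg (sq_nonneg _) (h.pos t').le
    have h5 : (w t' - 1) ^ 2 / w t' ≤ K₇ * s :=
      (le_mul_of_one_le_left h4 (by linarith)).trans h3
    rw [div_le_iff₀ (h.pos t')] at h5
    have := mul_le_mul_of_nonneg_left m'.2 pK₇s.le
    linarith
  refine ⟨?_, ?_, ?_⟩
  · have h1 := hw t₀ t' (by rw [abs_sub_comm]; linarith)
    have h2 : (w t₀ - w t') ^ 2 ≤ B₀ ^ 2 * s := by
      rw [← sq_abs]
      have h3 : |w t₀ - w t'| ^ 2 ≤ (B₀ * s ^ 3) ^ 2 := pow_le_pow_left₀ (abs_nonneg _) h1 2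
      have h4 : s ^ 6 ≤ s := by linarith
      have h5 := mul_le_mul_of_nonneg_left h4 (sq_nonneg B₀)
      have h6 : (B₀ * s ^ 3) ^ 2 = B₀ ^ 2 * s ^ 6 := by ring
      linarith
    have h7 := sq_nonneg ((w t' - 1) - (w t₀ - w t'))
    have h8 : (w t₀ - 1) ^ 2 + ((w t' - 1) - (w t₀ - w t')) ^ 2
        = 2 * (w t' - 1) ^ 2 + 2 * (w t₀ - w t') ^ 2 := by ring
    linarith
  · have := hΦ t₀ (by simp)
    refine this.trans ?_
    have h5 : K₅ * s ^ 2 ≤ K₅ * s := mul_le_mul_of_nonneg_left hs2 pK₅.le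
    have h6 : K₅ * s ≤ K₇ * s := mul_le_mul_of_nonneg_right (by linarith) hs.le
    linarith
  · refine (hψ t₀ (by simp)).trans ?_
    have h6 : K₆ * s ≤ K₇ * s := mul_le_mul_of_nonneg_right (by linarith) hs.le
    linarith

/-- A solution of the normalised system connecting the two states of rest. -/
structure NormalisedProfile (T a c : ℝ) (w Φ ψ : ℝ → ℝ) : Prop
    extends NormalisedSystem T a c w Φ ψ where
  left_w : Tendsto w atBot (𝓝 c)
  left_Φ : Tendsto Φ atBot (𝓝 (-Real.log c))
  left_ψ : Tendsto ψ atBot (𝓝 0)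
  right_w : Tendsto w atTop (𝓝 (1 / c))
  right_Φ : Tendsto Φ atTop (𝓝 (Real.log c))
  right_ψ : Tendsto ψ atTop (𝓝 0)

namespace NormalisedProfile

variable {T a c : ℝ} {w Φ ψ : ℝ → ℝ}

theorem tendsto_energy {l : Filter ℝ} {w₀ Φ₀ : ℝ} (hw₀ : w₀ ≠ 0) (hw : Tendsto w l (𝓝 w₀))
    (hΦ : Tendsto Φ l (𝓝 Φ₀)) (hψ : Tendsto ψ l (𝓝 0)) :
    Tendsto (fun t => profileEnergy T c (w t) (Φ t) (ψ t)) l (𝓝 (profileEnergy T c w₀ Φ₀ 0)) := by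
  have hlog := (Real.continuousAt_log hw₀).tendsto.comp hw
  have hexp := (Real.continuous_exp.tendsto Φ₀).comp hΦ
  have hdiv := (tendsto_const_nhds (x := T) (f := l)).div hw hw₀
  have hS : Tendsto (fun t => stressDefect T c (w t) (Φ t) (ψ t)) l
      (𝓝 (stressDefect T c w₀ Φ₀ 0)) :=
    ((((hw.const_mul (T + 1)).add hdiv).add hexp).sub ((hψ.pow 2).div_const 2)).sub_const _
  exact (((((hw.pow 2).const_mul (T + 1)).div_const 2).sub (hlog.const_mul T)).add hΦ).sub
    (hw.mul hS)

theorem energy_mem (h : NormalisedProfile T a c w Φ ψ) (ha : 0 < a) (hc : 0 < c) (t : ℝ) :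
    (T + 1) * (c ^ 2 / 2 - Real.log c) ≤ profileEnergy T c (w t) (Φ t) (ψ t) ∧
    profileEnergy T c (w t) (Φ t) (ψ t) ≤ (T + 1) * (1 / (2 * c ^ 2) + Real.log c) := by
  have hd := h.toNormalisedSystem.hasDerivAt_energy
  have hmono : Monotone (fun t => profileEnergy T c (w t) (Φ t) (ψ t)) :=
    monotone_of_deriv_nonneg (fun t => (hd t).differentiableAt) fun t => by
      rw [(hd t).deriv]; positivity
  have hl := tendsto_energy (T := T) (c := c) hc.ne' h.left_w h.left_Φ h.left_ψ
  have hr := tendsto_energy (T := T) (c := c) (one_div_pos.2 hc).ne' h.right_w h.right_Φ h.right_ψ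
  have el : profileEnergy T c c (-Real.log c) 0 = (T + 1) * (c ^ 2 / 2 - Real.log c) := by
    rw [profileEnergy, stressDefect, Real.exp_neg, Real.exp_log hc]
    field_simp; ring
  have er : profileEnergy T c (1 / c) (Real.log c) 0
      = (T + 1) * (1 / (2 * c ^ 2) + Real.log c) := by
    rw [profileEnergy, stressDefect, Real.exp_log hc, one_div, Real.log_inv]
    field_simp; ring
  rw [el] at hl
  rw [er] at hr
  exact ⟨hmono.le_of_tendsto hl t, hmono.ge_of_tendsto hr t⟩

end NormalisedProfile

/-- Every profile between two close states stays in a small box. -/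
theorem eventually_inBox {T a₁ A r : ℝ} (hT : 0 ≤ T) (ha₁ : 0 < a₁) (hA : 0 < A) (hr : 0 < r) :
    ∀ᶠ c in 𝓝 (1 : ℝ), ∀ {a : ℝ} {w Φ ψ : ℝ → ℝ}, a₁ ≤ a → a ≤ A →
      NormalisedProfile T a c w Φ ψ → InBox r w Φ ψ := by
  obtain ⟨K, hK, hwin⟩ := NormalisedSystem.exists_window_bound hT ha₁ hA
  obtain ⟨ρ, hρ0, hρ1, hρ2⟩ : ∃ ρ, 0 < ρ ∧ ρ ≤ 1 / 8 ∧ 8 * (T + 1) * ρ ≤ r := by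
    refine ⟨min (1 / 8) (r / (8 * (T + 1))), by positivity, min_le_left _ _, ?_⟩
    rw [mul_comm, ← le_div_iff₀ (by positivity)]
    exact min_le_right _ _
  obtain ⟨s, hs, hs1, hs2, hs3⟩ : ∃ s, 0 < s ∧ K * s ≤ 1 ∧ K * s ≤ ρ ^ 2 ∧ K * s ≤ r / 2 := by
    refine ⟨min 1 (min (ρ ^ 2) (r / 2)) / K, by positivity, ?_, ?_, ?_⟩ <;>
      rw [mul_div_cancel₀ _ hK.ne']
    · exact min_le_left _ _
    · exact (min_le_right _ _).trans (min_le_left _ _)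
    · exact (min_le_right _ _).trans (min_le_right _ _)
  have hlog : ContinuousAt Real.log 1 := Real.continuousAt_log one_ne_zero
  have near : ∀ {f : ℝ → ℝ} {x δ : ℝ}, ContinuousAt f 1 → f 1 = x → 0 < δ →
      ∀ᶠ c in 𝓝 (1 : ℝ), |f c - x| < δ := fun {f x δ} hf hx hδ => by
    have := Metric.tendsto_nhds.1 hf.tendsto δ hδ
    rwa [hx] at this
  have e1 := near (f := fun c => (T + 1) * (c + 1 / c - 2)) (x := 0)
    (by fun_prop (disch := norm_num)) (by norm_num) hs
  have e2 := near (f := fun c => (T + 1) * (c ^ 2 / 2 - Real.log c)) (x := (T + 1) / 2)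
    (by fun_prop) (by simp; ring) (pow_pos hs 6)
  have e3 := near (f := fun c => (T + 1) * (1 / (2 * c ^ 2) + Real.log c)) (x := (T + 1) / 2)
    (by fun_prop (disch := norm_num)) (by simp; ring) (pow_pos hs 6)
  have e4 := near (f := fun c => c) (x := 1) (by fun_prop) rfl (by norm_num : (0 : ℝ) < 1 / 8)
  filter_upwards [e1, e2, e3, e4] with c h1 h2 h3 h4 a w Φ ψ ha haA h
  have hc : 0 < c := by linarith [(abs_lt.1 h4).1]
  have hE : ∀ t, |profileEnergy T c (w t) (Φ t) (ψ t) - (T + 1) / 2| ≤ s ^ 6 := fun t => by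
    obtain ⟨m1, m2⟩ := h.energy_mem (ha₁.trans_le ha) hc t
    exact abs_le.2 ⟨by linarith [(abs_lt.1 h2).1], by linarith [(abs_lt.1 h3).2]⟩
  rw [sub_zero] at h1
  have key := hwin s hs hs1 ha haA h.toNormalisedSystem h1.le hE
  have hcont : Continuous w := h.contDiff.1.continuous
  have hquarter : ∀ t, |w t - 1| < 1 / 4 := by
    by_contra! hcon
    have hlim := (h.left_w.sub_const 1).abs.eventually_lt_const
      (h4.trans (by norm_num : (1 / 8 : ℝ) < 1 / 4))
    obtain ⟨t, ht⟩ := hlim.exists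
    obtain ⟨x, hx : |w x - 1| = 1 / 4⟩ := mem_range_of_exists_le_of_exists_ge
      (hcont.sub continuous_const).abs ⟨t, ht.le⟩ hcon
    have h5 := (key x (le_of_eq hx)).1
    rw [← sq_abs, hx] at h5
    nlinarith
  intro t
  obtain ⟨k1, k2, k3⟩ := key t (hquarter t).le
  have b1 : |w t - 1| ≤ ρ := abs_le_of_sq_le_sq (k1.trans hs2) hρ0.le
  have b2 := abs_lt.1 (hquarter t)
  have b3 := abs_entropy_sub_le hT (x := w t) (y := 1) ⟨by linarith, by linarith⟩
    ⟨by norm_num, by norm_num⟩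
  simp only [one_pow, Real.log_one, mul_zero, sub_zero, mul_one] at b3
  have b4 : 4 * (T + 1) * |w t - 1| ≤ 4 * (T + 1) * ρ := mul_le_mul_of_nonneg_left b1 (by linarith)
  have b5 := abs_le.1 (b3.trans b4)
  have b6 := abs_le.1 (k2.trans hs3)
  have b7 : ρ ≤ 8 * (T + 1) * ρ := by nlinarith
  exact ⟨by linarith, abs_le.2 ⟨by linarith, by linarith⟩, by linarith⟩

/-- Uniqueness up to a shift in the box. -/
theorem CenteredProfile.exists_shift {T a A σ r κ c : ℝ} {w Φ ψ w' Φ' ψ' : ℝ → ℝ}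
    (S : SmallShock T a A σ r κ c) (h : CenteredProfile T a r c w Φ ψ)
    (h' : NormalisedProfile T a c w' Φ' ψ') (hb' : InBox r w' Φ' ψ') :
    ∃ s, ∀ t, w' t = w (t + s) ∧ Φ' t = Φ (t + s) := by
  have hlt : c < 1 / c := S.c_lt.trans S.one_lt
  have hl := h'.left_w.add (h'.left_ψ.const_mul a)
  have hr := h'.right_w.add (h'.right_ψ.const_mul a)
  rw [mul_zero, add_zero] at hl hr
  obtain ⟨x, hx⟩ := (hl.eventually_lt_const (by linarith : c < (c + 1 / c) / 2)).exists
  obtain ⟨y, hy⟩ := (hr.eventually_const_lt (by linarith : (c + 1 / c) / 2 < 1 / c)).exists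
  obtain ⟨d1, -, d3⟩ := h'.contDiff
  obtain ⟨t₁, ht₁⟩ := mem_range_of_exists_le_of_exists_ge
    (d1.continuous.add (continuous_const.mul d3.continuous)) ⟨x, hx.le⟩ ⟨y, hy.le⟩
  refine ⟨-t₁, fun t => ?_⟩
  have := (h'.comp_add t₁).eq_of_eq S.toParams (fun t => hb' (t + t₁)) h.sys h.box (t₀ := 0)
    (by rw [zero_add, h.mid]; exact ht₁) (t + -t₁)
  simpa using this

/-- A profile is a travelling wave of the system. -/
theorem IsProfile.solvesNSP {T μ lam s nm um np up : ℝ} {n u φ : ℝ → ℝ}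
    (h : IsProfile T μ lam s nm um np up n u φ) :
    SolvesNSP T μ lam (fun t x => n (x - s * t)) (fun t x => u (x - s * t))
      (fun t x => φ (x - s * t)) := by
  have hlin : ContDiff ℝ ∞ (fun p : ℝ × ℝ => p.2 - s * p.1) := by fun_prop
  have htime : ∀ {f : ℝ → ℝ}, ContDiff ℝ ∞ f → ∀ t x,
      deriv (fun τ => f (x - s * τ)) t = -s * deriv f (x - s * t) := fun {f} hf t x => by
    have h1 : HasDerivAt (fun τ => x - s * τ) (-s) t := by
      simpa using ((hasDerivAt_id t).const_mul s).const_sub x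
    have h2 := ((contDiff_infty_iff_deriv.1 hf).1 (x - s * t)).hasDerivAt
    exact (h2.comp t h1).deriv.trans (mul_comm _ _)
  refine ⟨h.smooth_n.comp hlin, h.smooth_u.comp hlin, h.smooth_φ.comp hlin, fun t x => h.pos _,
    fun t x => ?_, fun t x => ?_, fun t x => ?_⟩
  · rw [htime h.smooth_n, deriv_comp_sub_const (fun η => n η * u η)]
    exact h.mass _
  · rw [htime (h.smooth_n.mul h.smooth_u),
      deriv_comp_sub_const (fun η => n η * u η ^ 2 + T * n η), iteratedDeriv_comp_sub_const,
      deriv_comp_sub_const]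
    exact h.momentum _
  · rw [iteratedDeriv_comp_sub_const]
    exact h.poisson _

/-- The relations between the shock, in the physical variables, and its normalisation: `n₀` is the
geometric mean of the densities, `j` the mass flux, `ς` the inverse length, and `c` is the square
root of the ratio of the densities. -/
structure Normalisation (T μ lam s nm um np up n₀ j ς a c : ℝ) : Prop where
  μ_pos : 0 < μ
  n₀_pos : 0 < n₀
  j_pos : 0 < j
  ς_pos : 0 < ς
  a_pos : 0 < a
  c_pos : 0 < c
  left_n : n₀ / c = nm
  right_n : n₀ * c = np
  left_u : s - j / n₀ * c = um
  right_u : s - j / n₀ * (1 / c) = up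
  flux : j ^ 2 = (T + 1) * n₀ ^ 2
  debye : lam ^ 2 * ς ^ 2 = n₀
  viscosity : μ * j * ς * a = n₀ ^ 2

namespace Normalisation

variable {T μ lam s nm um np up n₀ j ς a c : ℝ}

theorem hasDerivAt_comp {f : ℝ → ℝ} {f' ξ : ℝ} (hf : HasDerivAt f f' (ς * ξ)) :
    HasDerivAt (fun ξ => f (ς * ξ)) (ς * f') ξ := by
  have h1 : HasDerivAt (fun ξ => ς * ξ) ς ξ := by simpa using (hasDerivAt_id ξ).const_mul ς
  exact (hf.comp ξ h1).congr_deriv (mul_comm _ _)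

section Forward

variable {w Φ ψ : ℝ → ℝ}

theorem hasDerivAt_density (h : NormalisedSystem T a c w Φ ψ) (ξ : ℝ) :
    HasDerivAt (fun ξ => n₀ * (w (ς * ξ))⁻¹)
      (-n₀ * ς * deriv w (ς * ξ) / w (ς * ξ) ^ 2) ξ := by
  have := hasDerivAt_comp (ς := ς) (h.hw (ς * ξ)).differentiableAt.hasDerivAt
  exact ((this.inv (h.pos _).ne').const_mul n₀).congr_deriv (by ring)

theorem hasDerivAt_velocity (h : NormalisedSystem T a c w Φ ψ) (ξ : ℝ) :
    HasDerivAt (fun ξ => s - j / n₀ * w (ς * ξ)) (-(j / n₀) * ς * deriv w (ς * ξ)) ξ := by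
  have := hasDerivAt_comp (ς := ς) (h.hw (ς * ξ)).differentiableAt.hasDerivAt
  exact ((this.const_mul (j / n₀)).const_sub s).congr_deriv (by ring)

theorem hasDerivAt_potential (h : NormalisedSystem T a c w Φ ψ) (ξ : ℝ) :
    HasDerivAt (fun ξ => Real.log n₀ + Φ (ς * ξ)) (ς * ψ (ς * ξ)) ξ :=
  (hasDerivAt_comp (ς := ς) (h.hΦ (ς * ξ))).const_add _

theorem log_left (N : Normalisation T μ lam s nm um np up n₀ j ς a c) :
    Real.log nm = Real.log n₀ - Real.log c := by
  rw [← N.left_n, Real.log_div N.n₀_pos.ne' N.c_pos.ne']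

theorem log_right (N : Normalisation T μ lam s nm um np up n₀ j ς a c) :
    Real.log np = Real.log n₀ + Real.log c := by
  rw [← N.right_n, Real.log_mul N.n₀_pos.ne' N.c_pos.ne']

theorem hasDerivAt_deriv_volume (h : NormalisedSystem T a c w Φ ψ) (t : ℝ) :
    HasDerivAt (deriv w) (-a * (((T + 1) - T / w t ^ 2) * deriv w t + ψ t / w t)) t := by
  rw [show deriv w = fun t => -a * stressDefect T c (w t) (Φ t) (ψ t) from
    funext fun t => (h.hasDerivAt_volume t).deriv]
  have hw := h.hasDerivAt_volume t
  have hne := (h.pos t).ne'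
  refine (((((((hw.const_mul (T + 1)).add ((hasDerivAt_const t T).div hw hne)).add
    (h.hΦ t).exp).sub (((h.hψ t).pow 2).div_const 2)).sub_const _)).const_mul (-a)).congr_deriv ?_
  field_simp
  push_cast
  ring

theorem isProfile (N : Normalisation T μ lam s nm um np up n₀ j ς a c)
    (h : NormalisedSystem T a c w Φ ψ) (hwl : Tendsto w atBot (𝓝 c))
    (hΦl : Tendsto Φ atBot (𝓝 (-Real.log c))) (hwr : Tendsto w atTop (𝓝 (1 / c)))
    (hΦr : Tendsto Φ atTop (𝓝 (Real.log c))) :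
    IsProfile T μ lam s nm um np up (fun ξ => n₀ * (w (ς * ξ))⁻¹) (fun ξ => s - j / n₀ * w (ς * ξ))
      (fun ξ => Real.log n₀ + Φ (ς * ξ)) := by
  obtain ⟨cw, cΦ, -⟩ := h.contDiff
  have hlin : ContDiff ℝ ∞ (fun ξ : ℝ => ς * ξ) := by fun_prop
  have hn := N.n₀_pos.ne'
  have hc := N.c_pos.ne'
  have sn := hasDerivAt_density (n₀ := n₀) (ς := ς) h
  have su := hasDerivAt_velocity (n₀ := n₀) (s := s) (j := j) (ς := ς) h
  have sφ := hasDerivAt_potential (n₀ := n₀) (ς := ς) h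
  have hne : ∀ ξ, w ξ ≠ 0 := fun ξ => (h.pos ξ).ne'
  have enu : (fun η => n₀ * (w (ς * η))⁻¹ * (s - j / n₀ * w (ς * η)))
      = fun η => s * (n₀ * (w (ς * η))⁻¹) - j := funext fun η => by
    have := hne (ς * η)
    field_simp
  have dnu : ∀ ξ, deriv (fun η => n₀ * (w (ς * η))⁻¹ * (s - j / n₀ * w (ς * η))) ξ
      = s * (-n₀ * ς * deriv w (ς * ξ) / w (ς * ξ) ^ 2) := fun ξ => by
    rw [enu]; exact (((sn ξ).const_mul s).sub_const j).deriv
  have bot : Tendsto (fun ξ => ς * ξ) atBot atBot := tendsto_id.const_mul_atBot N.ς_pos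
  have top : Tendsto (fun ξ => ς * ξ) atTop atTop := tendsto_id.const_mul_atTop N.ς_pos
  refine ⟨contDiff_const.mul ((cw.comp hlin).inv fun ξ => hne _),
    contDiff_const.sub (contDiff_const.mul (cw.comp hlin)), contDiff_const.add (cΦ.comp hlin),
    fun ξ => mul_pos N.n₀_pos (inv_pos.2 (h.pos _)), fun ξ => ?_, fun ξ => ?_, fun ξ => ?_,
    ?_, ?_, ?_, ?_, ?_, ?_⟩
  · rw [dnu, (sn ξ).deriv]; ring
  · have e2 : (fun η => n₀ * (w (ς * η))⁻¹ * (s - j / n₀ * w (ς * η)) ^ 2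
        + T * (n₀ * (w (ς * η))⁻¹)) = fun η => (s ^ 2 + T) * (n₀ * (w (ς * η))⁻¹)
          + (j * (s - j / n₀ * w (ς * η)) * (-1) - s * j) := funext fun η => by
      have := hne (ς * η)
      field_simp
      ring
    have d2 := ((sn ξ).const_mul (s ^ 2 + T)).fun_add
      ((((su ξ).const_mul j).mul_const (-1)).sub_const (s * j))
    have d3 := (hasDerivAt_comp (ς := ς) (hasDerivAt_deriv_volume h (ς * ξ))).const_mul
      (-(j / n₀) * ς)
    rw [dnu, e2, d2.deriv, iteratedDeriv_succ, iteratedDeriv_one,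
      show deriv (fun ξ => s - j / n₀ * w (ς * ξ)) = fun ξ => -(j / n₀) * ς * deriv w (ς * ξ) from
        funext fun ξ => (su ξ).deriv, d3.deriv, (sφ ξ).deriv]
    have := hne (ς * ξ)
    set W := w (ς * ξ)
    set D := deriv w (ς * ξ)
    have e : μ * (-(j / n₀) * ς * (ς * (-a * ((T + 1 - T / W ^ 2) * D + ψ (ς * ξ) / W))))
        = (μ * j * ς * a) / n₀ * ς * ((T + 1 - T / W ^ 2) * D + ψ (ς * ξ) / W) := by ring
    rw [e, N.viscosity]
    field_simp
    linear_combination ς * D * W ^ 2 * N.flux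
  · rw [iteratedDeriv_succ, iteratedDeriv_one,
      show deriv (fun ξ => Real.log n₀ + Φ (ς * ξ)) = fun ξ => ς * ψ (ς * ξ) from
        funext fun ξ => (sφ ξ).deriv,
      ((hasDerivAt_comp (ς := ς) (h.hψ (ς * ξ))).const_mul ς).deriv, Real.exp_add,
      Real.exp_log N.n₀_pos]
    have := hne (ς * ξ)
    linear_combination (-(Real.exp (Φ (ς * ξ)) - 1 / w (ς * ξ))) * N.debye
  · have := ((hwl.comp bot).inv₀ hc).const_mul n₀
    rwa [← div_eq_mul_inv, N.left_n] at this
  · have := ((hwl.comp bot).const_mul (j / n₀)).const_sub s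
    rwa [N.left_u] at this
  · have := (hΦl.comp bot).const_add (Real.log n₀)
    rwa [← sub_eq_add_neg, ← N.log_left] at this
  · have := ((hwr.comp top).inv₀ (one_div_ne_zero hc)).const_mul n₀
    rwa [one_div, inv_inv, N.right_n] at this
  · have := ((hwr.comp top).const_mul (j / n₀)).const_sub s
    rwa [N.right_u] at this
  · have := (hΦr.comp top).const_add (Real.log n₀)
    rwa [← N.log_right] at this

end Forward

end Normalisation

/-- If a function converges at infinity and its second derivative tends to zero, then so does its
first derivative. -/
theorem tendsto_deriv_atTop_zero {f g h : ℝ → ℝ} {x : ℝ} (hf : ∀ t, HasDerivAt f (g t) t)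
    (hg : ∀ t, HasDerivAt g (h t) t) (hlim : Tendsto f atTop (𝓝 x))
    (hh : Tendsto h atTop (𝓝 0)) : Tendsto g atTop (𝓝 0) := by
  refine Metric.tendsto_nhds.2 fun ε hε => ?_
  have h1 : Tendsto (fun t => f (t + 1) - f t) atTop (𝓝 0) := by
    simpa using (hlim.comp (tendsto_atTop_add_const_right atTop 1 tendsto_id)).sub hlim
  have e1 := Metric.tendsto_nhds.1 h1 (ε / 3) (by positivity)
  have e2 := Metric.tendsto_nhds.1 hh (ε / 3) (by positivity)
  obtain ⟨M, hM⟩ := eventually_atTop.1 e2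
  filter_upwards [e1, eventually_ge_atTop M] with t ht htM
  rw [Real.dist_0_eq_abs] at ht ⊢
  have := abs_deriv_le_of_osc one_pos hf hg (t := t) (m := ε / 3) (fun y hy => by
    have := hM y (htM.trans hy.1)
    rw [Real.dist_0_eq_abs] at this
    exact this.le) ht.le
  linarith

theorem tendsto_deriv_atBot_zero {f g h : ℝ → ℝ} {x : ℝ} (hf : ∀ t, HasDerivAt f (g t) t)
    (hg : ∀ t, HasDerivAt g (h t) t) (hlim : Tendsto f atBot (𝓝 x))
    (hh : Tendsto h atBot (𝓝 0)) : Tendsto g atBot (𝓝 0) := by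
  have := tendsto_deriv_atTop_zero (f := fun t => f (-t)) (g := fun t => -g (-t))
    (h := fun t => h (-t)) (fun t => ((hf (-t)).scomp t (hasDerivAt_neg t)).congr_deriv (by simp))
    (fun t => ((hg (-t)).scomp t (hasDerivAt_neg t)).neg.congr_deriv (by simp))
    (hlim.comp tendsto_neg_atTop_atBot) (hh.comp tendsto_neg_atTop_atBot)
  simpa [Function.comp_def] using (this.comp tendsto_neg_atBot_atTop).neg

/-- If a function and its derivative converge at `-∞`, then the derivative tends to zero. -/
theorem eq_zero_of_tendsto_deriv_atBot {f g : ℝ → ℝ} {x L : ℝ} (hf : ∀ t, HasDerivAt f (g t) t)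
    (hlim : Tendsto f atBot (𝓝 x)) (hg : Tendsto g atBot (𝓝 L)) : L = 0 := by
  have h1 : Tendsto (fun t => f (t + 1) - f t) atBot (𝓝 0) := by
    simpa using (hlim.comp (tendsto_atBot_add_const_right atBot 1 tendsto_id)).sub hlim
  have h2 : ∀ t, ∃ y, y ≤ t + 1 ∧ g y = f (t + 1) - f t := fun t => by
    obtain ⟨y, hy, he⟩ := exists_hasDerivAt_eq_slope f g (by linarith : t < t + 1)
      (fun y _ => (hf y).continuousAt.continuousWithinAt) (fun y _ => hf y)
    exact ⟨y, hy.2.le, by rw [he, add_sub_cancel_left, div_one]⟩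
  choose y hy he using h2
  have h3 : Tendsto y atBot atBot :=
    tendsto_atBot_mono hy (tendsto_atBot_add_const_right atBot 1 tendsto_id)
  exact tendsto_nhds_unique ((hg.comp h3).congr he) h1

namespace Normalisation

variable {T μ lam s nm um np up n₀ j ς a c : ℝ} {n u φ : ℝ → ℝ}

section Backward

theorem eq_of_isProfile (N : Normalisation T μ lam s nm um np up n₀ j ς a c)
    (h : IsProfile T μ lam s nm um np up n u φ) (ξ : ℝ) : n ξ * (s - u ξ) = j := by
  have dn := fun ξ => ((contDiff_infty_iff_deriv.1 h.smooth_n).1 ξ).hasDerivAt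
  have dnu := fun ξ => ((contDiff_infty_iff_deriv.1 (h.smooth_n.mul h.smooth_u)).1 ξ).hasDerivAt
  have hd : ∀ ξ, HasDerivAt (fun ξ => s * n ξ - n ξ * u ξ) 0 ξ := fun ξ =>
    (((dn ξ).const_mul s).sub (dnu ξ)).congr_deriv (by linarith [h.mass ξ])
  have hl : Tendsto (fun ξ => s * n ξ - n ξ * u ξ) atBot (𝓝 (s * nm - nm * um)) :=
    (h.left_n.const_mul s).sub (h.left_n.mul h.left_u)
  have hconst : Tendsto (fun ξ => s * n ξ - n ξ * u ξ) atBot (𝓝 (s * n ξ - n ξ * u ξ)) := by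
    refine tendsto_const_nhds.congr fun η => ?_
    exact is_const_of_deriv_eq_zero (fun ξ => (hd ξ).differentiableAt) (fun ξ => (hd ξ).deriv) ξ η
  have := tendsto_nhds_unique hconst hl
  rw [← N.left_n, ← N.left_u] at this
  have hn := N.n₀_pos.ne'
  have hc := N.c_pos.ne'
  have e : s * (n₀ / c) - n₀ / c * (s - j / n₀ * c) = j := by field_simp; ring
  linarith

theorem poisson_eq (hlam : lam ≠ 0)
    (h : IsProfile T μ lam s nm um np up n u φ) (ξ : ℝ) :
    HasDerivAt (deriv φ) ((Real.exp (φ ξ) - n ξ) / lam ^ 2) ξ := by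
  have d := ((contDiff_infty_iff_deriv.1 (contDiff_infty_iff_deriv.1 h.smooth_φ).2).1 ξ).hasDerivAt
  refine d.congr_deriv ?_
  have := h.poisson ξ
  rw [iteratedDeriv_succ, iteratedDeriv_one] at this
  field_simp
  linarith

theorem tendsto_poisson {l : Filter ℝ} {x : ℝ} (hx : 0 < x)
    (hn : Tendsto n l (𝓝 x)) (hφ : Tendsto φ l (𝓝 (Real.log x))) :
    Tendsto (fun ξ => (Real.exp (φ ξ) - n ξ) / lam ^ 2) l (𝓝 0) := by
  have := (((Real.continuous_exp.tendsto _).comp hφ).sub hn).div_const (lam ^ 2)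
  rw [Real.exp_log hx] at this
  simpa using this

theorem lam_ne_zero (N : Normalisation T μ lam s nm um np up n₀ j ς a c) : lam ≠ 0 := by
  rintro rfl
  have := N.debye
  have := N.n₀_pos
  norm_num at *
  linarith

theorem nm_pos (N : Normalisation T μ lam s nm um np up n₀ j ς a c) : 0 < nm := by
  rw [← N.left_n]; exact div_pos N.n₀_pos N.c_pos

theorem np_pos (N : Normalisation T μ lam s nm um np up n₀ j ς a c) : 0 < np := by
  rw [← N.right_n]; exact mul_pos N.n₀_pos N.c_pos

/-- The momentum equation, integrated once. -/
theorem momentum_integrated (N : Normalisation T μ lam s nm um np up n₀ j ς a c)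
    (h : IsProfile T μ lam s nm um np up n u φ) (ξ : ℝ) :
    μ * deriv u ξ = j * (s - u ξ) + T * n ξ + Real.exp (φ ξ) - lam ^ 2 * deriv φ ξ ^ 2 / 2
      - (T + 1) * n₀ * (c + 1 / c) := by
  have hlam := N.lam_ne_zero
  have cu' := (contDiff_infty_iff_deriv.1 h.smooth_u).2
  have du := fun ξ => ((contDiff_infty_iff_deriv.1 h.smooth_u).1 ξ).hasDerivAt
  have du' := fun ξ => ((contDiff_infty_iff_deriv.1 cu').1 ξ).hasDerivAt
  have dn := fun ξ => ((contDiff_infty_iff_deriv.1 h.smooth_n).1 ξ).hasDerivAt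
  have dφ := fun ξ => ((contDiff_infty_iff_deriv.1 h.smooth_φ).1 ξ).hasDerivAt
  have dφ' := poisson_eq hlam h
  have dnu := fun ξ => ((contDiff_infty_iff_deriv.1 (h.smooth_n.mul h.smooth_u)).1 ξ).hasDerivAt
  have dm := fun ξ => ((contDiff_infty_iff_deriv.1 ((h.smooth_n.mul (h.smooth_u.pow 2)).add
    (contDiff_const.mul h.smooth_n))).1 ξ).hasDerivAt (f := fun η => n η * u η ^ 2 + T * n η)
  have eflux := N.eq_of_isProfile h
  have eF : (fun ξ => -s * (n ξ * u ξ) + (n ξ * u ξ ^ 2 + T * n ξ))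
      = fun ξ => -j * u ξ + T * n ξ := funext fun ξ => by
    rw [← eflux ξ]; ring
  have dF : ∀ ξ, HasDerivAt (fun ξ => -j * u ξ + T * n ξ)
      (μ * deriv (deriv u) ξ - n ξ * deriv φ ξ) ξ := fun ξ => by
    rw [← eF]
    refine (((dnu ξ).const_mul (-s)).add (dm ξ)).congr_deriv ?_
    have := h.momentum ξ
    rw [iteratedDeriv_succ, iteratedDeriv_one] at this
    exact this
  obtain ⟨G, hG⟩ : ∃ G : ℝ → ℝ, G = fun ξ => -j * u ξ + T * n ξ + Real.exp (φ ξ)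
    - lam ^ 2 * deriv φ ξ ^ 2 / 2 - μ * deriv u ξ := ⟨_, rfl⟩
  have dG : ∀ ξ, HasDerivAt G 0 ξ := fun ξ => by
    rw [hG]
    refine ((((dF ξ).add (dφ ξ).exp).sub ((((dφ' ξ).pow 2).const_mul (lam ^ 2)).div_const 2)).sub
      ((du' ξ).const_mul μ)).congr_deriv ?_
    field_simp
    push_cast
    ring
  have Gconst : ∀ η, G η = G ξ := fun η =>
    is_const_of_deriv_eq_zero (fun ξ => (dG ξ).differentiableAt) (fun ξ => (dG ξ).deriv) η ξ
  have lφ' := tendsto_deriv_atBot_zero dφ dφ' h.left_φ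
    (tendsto_poisson N.nm_pos h.left_n h.left_φ)
  have lP : Tendsto (fun ξ => -j * u ξ + T * n ξ + Real.exp (φ ξ)
      - lam ^ 2 * deriv φ ξ ^ 2 / 2) atBot (𝓝 (-j * um + T * nm + nm)) := by
    have := (((h.left_u.const_mul (-j)).add (h.left_n.const_mul T)).add
      ((Real.continuous_exp.tendsto _).comp h.left_φ)).sub
      (((lφ'.pow 2).const_mul (lam ^ 2)).div_const 2)
    rw [Real.exp_log N.nm_pos] at this
    simpa using this
  have lu' : Tendsto (deriv u) atBot (𝓝 ((-j * um + T * nm + nm - G ξ) / μ)) := by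
    refine ((lP.sub_const (G ξ)).div_const μ).congr fun η => ?_
    have hμ := N.μ_pos.ne'
    rw [← Gconst η, hG]
    field_simp
    ring
  have h0 := eq_zero_of_tendsto_deriv_atBot du h.left_u lu'
  rw [div_eq_zero_iff, or_iff_left N.μ_pos.ne', hG, ← N.left_n, ← N.left_u] at h0
  simp only at h0
  have hn := N.n₀_pos.ne'
  have hc := N.c_pos.ne'
  have e : -j * (s - j / n₀ * c) + T * (n₀ / c) + n₀ / c
      = -j * s + (T + 1) * n₀ * (c + 1 / c) := by
    field_simp
    linear_combination c ^ 2 * N.flux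
  linarith

theorem normalisedProfile (N : Normalisation T μ lam s nm um np up n₀ j ς a c)
    (h : IsProfile T μ lam s nm um np up n u φ) :
    NormalisedProfile T a c (fun t => n₀ * (n (ς⁻¹ * t))⁻¹)
      (fun t => φ (ς⁻¹ * t) - Real.log n₀) (fun t => ς⁻¹ * deriv φ (ς⁻¹ * t)) := by
  have hlam := N.lam_ne_zero
  have hn := N.n₀_pos.ne'
  have hc := N.c_pos.ne'
  have hj := N.j_pos.ne'
  have hς := N.ς_pos.ne'
  have hμ := N.μ_pos.ne'
  have du := fun ξ => ((contDiff_infty_iff_deriv.1 h.smooth_u).1 ξ).hasDerivAt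
  have dφ := fun ξ => ((contDiff_infty_iff_deriv.1 h.smooth_φ).1 ξ).hasDerivAt
  have dφ' := poisson_eq hlam h
  have flux := N.eq_of_isProfile h
  have hne : ∀ ξ, n ξ ≠ 0 := fun ξ => (h.pos ξ).ne'
  have es : ∀ ξ, s - u ξ = j / n ξ := fun ξ => by rw [eq_div_iff (hne ξ), ← flux ξ]; ring
  have bot : Tendsto (fun t => ς⁻¹ * t) atBot atBot :=
    tendsto_id.const_mul_atBot (inv_pos.2 N.ς_pos)
  have top : Tendsto (fun t => ς⁻¹ * t) atTop atTop :=
    tendsto_id.const_mul_atTop (inv_pos.2 N.ς_pos)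
  have lφ := tendsto_deriv_atBot_zero dφ dφ' h.left_φ
    (tendsto_poisson N.nm_pos h.left_n h.left_φ)
  have rφ := tendsto_deriv_atTop_zero dφ dφ' h.right_φ
    (tendsto_poisson N.np_pos h.right_n h.right_φ)
  have ew : (fun t => n₀ * (n (ς⁻¹ * t))⁻¹) = fun t => n₀ / j * (s - u (ς⁻¹ * t)) :=
    funext fun t => by
      have := hne (ς⁻¹ * t)
      rw [es]
      field_simp
  have exp_eq : ∀ x, Real.exp (φ x - Real.log n₀) = Real.exp (φ x) / n₀ := fun x => by
    rw [Real.exp_sub, Real.exp_log N.n₀_pos]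
  refine ⟨⟨fun t => mul_pos N.n₀_pos (inv_pos.2 (h.pos _)), fun t => ?_, fun t => ?_,
    fun t => ?_⟩, ?_, ?_, ?_, ?_, ?_, ?_⟩
  · rw [ew]
    refine (((hasDerivAt_comp (du (ς⁻¹ * t))).const_sub s).const_mul (n₀ / j)).congr_deriv ?_
    have hm := N.momentum_integrated h (ς⁻¹ * t)
    have hx := hne (ς⁻¹ * t)
    rw [es] at hm
    rw [exp_eq]
    set x := ς⁻¹ * t
    have hψ : (ς⁻¹ * deriv φ x) ^ 2 = lam ^ 2 * deriv φ x ^ 2 / n₀ := by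
      rw [← N.debye]; field_simp
    have hu : deriv u x = (j * (j / n x) + T * n x + Real.exp (φ x) - lam ^ 2 * deriv φ x ^ 2 / 2
      - (T + 1) * n₀ * (c + 1 / c)) / μ := by rw [eq_div_iff hμ, ← hm]; ring
    have ea : a = n₀ ^ 2 / (μ * j * ς) := by
      rw [eq_div_iff (by positivity), ← N.viscosity]; ring
    have ej : j * (j / n x) = (T + 1) * n₀ ^ 2 / n x := by rw [← N.flux]; ring
    rw [hu, hψ, ea, ej]
    field_simp
  · exact (hasDerivAt_comp (dφ (ς⁻¹ * t))).sub_const _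
  · refine ((hasDerivAt_comp (dφ' (ς⁻¹ * t))).const_mul ς⁻¹).congr_deriv ?_
    have hx := hne (ς⁻¹ * t)
    rw [exp_eq, ← N.debye]
    field_simp
  · have := ((h.left_n.comp bot).inv₀ N.nm_pos.ne').const_mul n₀
    rwa [← N.left_n, inv_div, mul_div_cancel₀ _ hn] at this
  · have := (h.left_φ.comp bot).sub_const (Real.log n₀)
    rwa [N.log_left, show Real.log n₀ - Real.log c - Real.log n₀ = -Real.log c by ring] at this
  · simpa using (lφ.comp bot).const_mul ς⁻¹
  · have := ((h.right_n.comp top).inv₀ N.np_pos.ne').const_mul n₀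
    rwa [← N.right_n, show n₀ * (n₀ * c)⁻¹ = 1 / c by field_simp] at this
  · have := (h.right_φ.comp top).sub_const (Real.log n₀)
    rwa [N.log_right, add_sub_cancel_left] at this
  · simpa using (rφ.comp top).const_mul ς⁻¹

end Backward

end Normalisation

theorem iteratedDeriv_succ_sub_const (k : ℕ) (F : ℝ → ℝ) (x : ℝ) :
    iteratedDeriv (k + 1) (fun t => F t - x) = iteratedDeriv (k + 1) F := by
  rw [iteratedDeriv_succ', iteratedDeriv_succ']
  congr 1
  exact funext fun t => deriv_sub_const x

/-- The `k`-th derivatives at `t` of the deviations of the normalised variables. -/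
def DeviationBound (k : ℕ) (w Φ : ℝ → ℝ) (w₀ Φ₀ t B : ℝ) : Prop :=
  |iteratedDeriv k (fun t => (w t)⁻¹ - w₀⁻¹) t| ≤ B ∧ |iteratedDeriv k (fun t => w t - w₀) t| ≤ B ∧
    |iteratedDeriv k (fun t => Φ t - Φ₀) t| ≤ B

theorem deviationBound_zero {w Φ : ℝ → ℝ} {w₀ Φ₀ t B : ℝ} (hw : 1 / 2 ≤ w t) (hw₀ : 1 / 2 ≤ w₀)
    (hb : |w t - w₀| ≤ 5 / 4 * B) (hΦ : |Φ t - Φ₀| ≤ 2 * B) :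
    DeviationBound 0 w Φ w₀ Φ₀ t (5 * B) := by
  have hB : 0 ≤ B := by linarith [abs_nonneg (w t - w₀)]
  simp only [DeviationBound, iteratedDeriv_zero]
  refine ⟨?_, by linarith, by linarith⟩
  have hpos : 0 < w t * w₀ := by positivity
  have h1 : w t ≠ 0 := by positivity
  have h2 : w₀ ≠ 0 := by positivity
  have e : (w t)⁻¹ - w₀⁻¹ = -(w t - w₀) / (w t * w₀) := by field_simp; ring
  rw [e, abs_div, abs_neg, abs_of_pos hpos, div_le_iff₀ hpos]
  nlinarith [mul_le_mul hw hw₀ (by norm_num) (by positivity)]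

namespace CenteredProfile

theorem exists_deviationBound {T A : ℝ} (hT : 0 ≤ T) (hA : 0 < A) (k : ℕ) :
    ∃ D, 0 < D ∧ ∀ {a σ r κ c : ℝ} {w Φ ψ : ℝ → ℝ}, SmallShock T a A σ r κ c → 1 / 2 ≤ c →
      CenteredProfile T a r c w Φ ψ →
      (∀ t ≤ 0, DeviationBound k w Φ c (-Real.log c) t
        (D * ((1 / c - c) ^ (k + 1) * Real.exp (-(a * (T + 1) / 8 * (1 / c - c)) * |t|)))) ∧
      (∀ t, 0 ≤ t → DeviationBound k w Φ (1 / c) (Real.log c) t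
        (D * ((1 / c - c) ^ (k + 1) * Real.exp (-(a * (T + 1) / 8 * (1 / c - c)) * |t|)))) := by
  cases k with
  | zero =>
    refine ⟨5, by norm_num, fun {a σ r κ c w Φ ψ} S hc h => ⟨fun t ht => ?_, fun t ht => ?_⟩⟩
    · obtain ⟨h1, h2, h3, -⟩ := h.left_bounds S t
      have h4 := h.left_decay S ht
      have h5 := sub_pos.2 (h.left_lt t)
      rw [abs_of_nonpos ht, neg_mul_neg, zero_add, pow_one]
      refine deviationBound_zero (h.volume_mem S t).1 hc ?_ ?_
      · rw [abs_of_nonneg (by linarith)]; linarith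
      · rw [sub_neg_eq_add]; linarith
    · obtain ⟨h1, h2, h3, -⟩ := h.right_bounds S t
      have h4 := h.right_decay S ht
      have h5 := sub_pos.2 (h.lt_right t)
      rw [abs_of_nonneg ht, zero_add, pow_one]
      refine deviationBound_zero (h.volume_mem S t).1 (by linarith [S.one_lt]) ?_ ?_
      · rw [abs_sub_comm, abs_of_nonneg (by linarith)]; linarith
      · linarith
  | succ k =>
    obtain ⟨C, hC, hB⟩ := exists_profileBound hT hA k
    refine ⟨C + 1, by linarith, fun {a σ r κ c w Φ ψ} S hc h => ?_⟩
    have hb := hB S h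
    have hΔ := (strength_facts S).1
    have key : ∀ w₀ Φ₀ t, DeviationBound (k + 1) w Φ w₀ Φ₀ t ((C + 1) * ((1 / c - c) ^ (k + 1 + 1)
        * Real.exp (-(a * (T + 1) / 8 * (1 / c - c)) * |t|))) := fun w₀ Φ₀ t => by
      have red : ∀ {F : ℝ → ℝ}, DerivBound (1 / c - c) (a * (T + 1) / 8 * (1 / c - c)) C (k + 1) F →
          |iteratedDeriv (k + 1) F t| ≤ (C + 1) * ((1 / c - c) ^ (k + 1 + 1)
            * Real.exp (-(a * (T + 1) / 8 * (1 / c - c)) * |t|)) := fun hF => by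
        refine (hF (k + 1) (by omega) le_rfl t).trans ?_
        rw [mul_assoc]
        exact mul_le_mul_of_nonneg_right (by linarith) (by positivity)
      refine ⟨?_, ?_, ?_⟩ <;> rw [iteratedDeriv_succ_sub_const]
      · exact red hb.density
      · exact red hb.volume
      · exact red hb.potential
    exact ⟨fun t _ => key _ _ t, fun t _ => key _ _ t⟩

end CenteredProfile

theorem abs_iteratedDeriv_rescale {F G : ℝ → ℝ} {α ς : ℝ} (hF : ContDiff ℝ ∞ F) (hς : 0 < ς)
    (hG : ∀ ξ, G ξ = α * F (ς * ξ)) (k : ℕ) (ξ : ℝ) :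
    |iteratedDeriv k G ξ| = |α| * (ς ^ k * |iteratedDeriv k F (ς * ξ)|) := by
  rw [funext hG, iteratedDeriv_const_mul_field,
    iteratedDeriv_comp_const_mul (hF.of_le (by exact_mod_cast le_top)), abs_mul, abs_mul,
    abs_of_pos (pow_pos hς k)]

theorem deviation_le {T a c n₀ j s ς nl ul w₀ Φ₀ ξ B : ℝ} {k : ℕ} {w Φ ψ : ℝ → ℝ}
    (h : NormalisedSystem T a c w Φ ψ) (hn₀ : 0 < n₀) (hj : 0 < j) (hς : 0 < ς)
    (hn : nl = n₀ * w₀⁻¹) (hu : ul = s - j / n₀ * w₀) (hφ : Real.log nl = Real.log n₀ + Φ₀)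
    (hB : DeviationBound k w Φ w₀ Φ₀ (ς * ξ) B) :
    deviation k (fun ξ => n₀ * (w (ς * ξ))⁻¹) (fun ξ => s - j / n₀ * w (ς * ξ))
      (fun ξ => Real.log n₀ + Φ (ς * ξ)) nl ul ξ ≤ (n₀ + j / n₀ + 1) * (ς ^ k * B) := by
  obtain ⟨cw, cΦ, -⟩ := h.contDiff
  obtain ⟨b1, b2, b3⟩ := hB
  have hj' : 0 < j / n₀ := div_pos hj hn₀
  rw [deviation,
    abs_iteratedDeriv_rescale (F := fun t => (w t)⁻¹ - w₀⁻¹) (α := n₀) (ς := ς)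
      ((cw.inv fun t => (h.pos t).ne').sub contDiff_const) hς (fun ξ => by rw [hn]; ring) k ξ,
    abs_iteratedDeriv_rescale (F := fun t => w t - w₀) (α := -(j / n₀)) (ς := ς)
      (cw.sub contDiff_const) hς (fun ξ => by rw [hu]; ring) k ξ,
    abs_iteratedDeriv_rescale (F := fun t => Φ t - Φ₀) (α := 1) (ς := ς)
      (cΦ.sub contDiff_const) hς (fun ξ => by rw [hφ]; ring) k ξ,
    abs_neg, abs_one, abs_of_pos hn₀, abs_of_pos hj']
  have m : ∀ {x : ℝ}, x ≤ B → ς ^ k * x ≤ ς ^ k * B := fun hx =>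
    mul_le_mul_of_nonneg_left hx (by positivity)
  have m1 := mul_le_mul_of_nonneg_left (m b1) hn₀.le
  have m2 := mul_le_mul_of_nonneg_left (m b2) hj'.le
  have m3 := m b3
  linarith

/-- Normalisation of the shocks of the second family. -/
theorem RankineHugoniot.normalisation {T μ lam s nm um np up c : ℝ}
    (h : RankineHugoniot T s nm um np up) (hT : 0 ≤ T) (hμ : 0 < μ) (hlam : 0 < lam)
    (hnm : 0 < nm) (hs : um < s) (hc : 0 < c) (hc1 : c < 1) (hnp : np = c ^ 2 * nm) :
    Normalisation T μ lam s nm um np up (c * nm) (√(T + 1) * (c * nm)) (√(c * nm) / lam)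
      (lam * √(c * nm) / (μ * √(T + 1))) c ∧ √(T + 1) * (c * nm) = nm * |um - s| := by
  obtain ⟨h1, h2⟩ := h
  have hn₀ : 0 < c * nm := mul_pos hc hnm
  have hq : 0 < √(T + 1) := Real.sqrt_pos.2 (by linarith)
  have hq2 : √(T + 1) ^ 2 = T + 1 := Real.sq_sqrt (by linarith)
  have hm : 0 < √(c * nm) := Real.sqrt_pos.2 hn₀
  have hm2 : √(c * nm) ^ 2 = c * nm := Real.sq_sqrt hn₀.le
  have hj : √(T + 1) * (c * nm) = nm * (s - um) := by
    have hlt : np - nm ≠ 0 := by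
      have : c ^ 2 * nm < 1 * nm := mul_lt_mul_of_pos_right (by nlinarith) hnm
      rw [hnp]; linarith
    have e : (nm * (s - um)) ^ 2 * (np - nm) = (T + 1) * (np * nm) * (np - nm) := by
      linear_combination (-nm * np) * h2 + ((nm * um - nm * s) * nm + nm * np * up) * h1
    have e2 := mul_right_cancel₀ hlt e
    refine (sq_eq_sq₀ (by positivity) (mul_nonneg hnm.le (by linarith))).1 ?_
    rw [e2, mul_pow, hq2, hnp]; ring
  have hns : np * (s - up) = nm * (s - um) := by linarith
  refine ⟨⟨hμ, hn₀, by positivity, by positivity, by positivity, hc, by field_simp, ?_, ?_, ?_, ?_,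
    ?_, ?_⟩, ?_⟩
  · rw [hnp]; ring
  · rw [hj]; field_simp; ring
  · rw [hj, ← hns, hnp]; field_simp; ring
  · rw [mul_pow, hq2]
  · rw [div_pow, hm2]; field_simp
  · field_simp
    linear_combination hm2
  · rw [hj, abs_of_neg (by linarith), neg_sub]

/-- The box and the smallness of the fast rates can be chosen uniformly. -/
theorem exists_smallShock {T a₁ A : ℝ} (hT : 0 ≤ T) (ha₁ : 0 < a₁) (hA : 0 < A) :
    ∃ r κ δ : ℝ, 0 < δ ∧ ∀ c a, 1 - δ < c → c < 1 → 1 / 2 ≤ c → a₁ ≤ a → a ≤ A →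
      (∃ σ, SmallShock T a A σ r κ c) ∧
      ∀ {w Φ ψ : ℝ → ℝ}, NormalisedProfile T a c w Φ ψ → InBox r w Φ ψ := by
  obtain ⟨κ, hκ⟩ : ∃ κ, κ = 1 / (16 * (1 + A)) := ⟨_, rfl⟩
  obtain ⟨r, hr⟩ : ∃ r, r = κ / (800 * (1 + A) ^ 3 * (T + 1)) := ⟨_, rfl⟩
  have hκ0 : 0 < κ := by rw [hκ]; positivity
  have hr0 : 0 < r := by rw [hr]; positivity
  have e1 : ∀ᶠ c in 𝓝 (1 : ℝ), 10 * (1 + A) * (1 / c - 1) < r := by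
    have : ContinuousAt (fun c : ℝ => 10 * (1 + A) * (1 / c - 1)) 1 := by
      fun_prop (disch := norm_num)
    exact this.tendsto.eventually_lt_const (by simpa using hr0)
  obtain ⟨δ, hδ, hball⟩ := Metric.eventually_nhds_iff.1 (e1.and (eventually_inBox hT ha₁ hA hr0))
  refine ⟨r, κ, δ, hδ, fun c a h1 h2 h3 h4 h5 => ?_⟩
  obtain ⟨b1, b2⟩ := hball (y := c) (by
    rw [Real.dist_eq, abs_of_neg (by linarith)]; linarith)
  refine ⟨⟨(-a + √(a ^ 2 + 4)) / 2, ⟨hT, ha₁.trans_le h4, h5, ?_, ?_, hr0, hκ0, ?_, ?_⟩,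
    by linarith, h2, ?_, b1.le⟩, fun h => b2 h4 h5 h⟩
  · have : a < √(a ^ 2 + 4) := Real.lt_sqrt_of_sq_lt (by linarith)
    linarith
  · have : √(a ^ 2 + 4) ^ 2 = a ^ 2 + 4 := Real.sq_sqrt (by positivity)
    linear_combination this / 4
  · rw [hκ, div_le_div_iff₀ (by positivity) two_pos]; linarith
  · rw [hr, mul_div_cancel₀ _ (by positivity)]
  · rw [hκ, mul_one_div_cancel (by positivity)]

namespace Normalisation

variable {T μ lam s nm um np up n₀ j ς a c : ℝ} {w Φ ψ : ℝ → ℝ}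

theorem strength_eq (N : Normalisation T μ lam s nm um np up n₀ j ς a c) :
    1 / c - c = (nm - np) / n₀ := by
  have := N.n₀_pos.ne'
  have := N.c_pos.ne'
  rw [← N.left_n, ← N.right_n]
  field_simp

/-- The exponential rate, in the physical variables. -/
theorem rate_eq (N : Normalisation T μ lam s nm um np up n₀ j ς a c) (hT : 0 ≤ T) (ξ : ℝ) :
    -(a * (T + 1) / 8 * (1 / c - c)) * |ς * ξ| = -(√(T + 1) / (8 * μ)) * (nm - np) * |ξ| := by
  have hn := N.n₀_pos
  have hμ := N.μ_pos
  have hq2 : √(T + 1) ^ 2 = T + 1 := Real.sq_sqrt (by linarith)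
  have hq : 0 < √(T + 1) := Real.sqrt_pos.2 (by linarith)
  have hj : j = √(T + 1) * n₀ := by
    refine (sq_eq_sq₀ N.j_pos.le (by positivity)).1 ?_
    rw [N.flux, mul_pow, hq2]
  have hv := N.viscosity
  rw [hj] at hv
  have hv2 : ς * a = n₀ / (μ * √(T + 1)) := by
    rw [eq_div_iff (by positivity)]
    refine mul_right_cancel₀ hn.ne' ?_
    linear_combination hv
  rw [N.strength_eq, abs_mul, abs_of_pos N.ς_pos]
  calc _ = -((ς * a) * (T + 1) / 8 * ((nm - np) / n₀)) * |ξ| := by ring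
    _ = _ := by
      rw [hv2]
      field_simp
      rw [hq2]

theorem monotonicity (N : Normalisation T μ lam s nm um np up n₀ j ς a c) {A σ r κ : ℝ}
    (S : SmallShock T a A σ r κ c) (h : CenteredProfile T a r c w Φ ψ) (hn₀ : nm / 2 ≤ n₀)
    (hn₀' : n₀ ≤ nm) (hj : j = nm * |um - s|) (ξ : ℝ) :
    deriv (fun ξ => n₀ * (w (ς * ξ))⁻¹) ξ = (n₀ * (w (ς * ξ))⁻¹) ^ 2
        * deriv (fun ξ => s - j / n₀ * w (ς * ξ)) ξ / (nm * |um - s|) ∧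
      16 / nm * deriv (fun ξ => n₀ * (w (ς * ξ))⁻¹) ξ
        ≤ deriv (fun ξ => Real.log n₀ + Φ (ς * ξ)) ξ ∧
      deriv (fun ξ => Real.log n₀ + Φ (ς * ξ)) ξ
        ≤ 1 / (8 * nm) * deriv (fun ξ => n₀ * (w (ς * ξ))⁻¹) ξ ∧
      1 / (8 * nm) * deriv (fun ξ => n₀ * (w (ς * ξ))⁻¹) ξ < 0 := by
  have hn := N.n₀_pos
  have hς := N.ς_pos
  have hjp := N.j_pos
  have hnm := N.nm_pos
  rw [(hasDerivAt_density h.sys ξ).deriv, (hasDerivAt_velocity h.sys ξ).deriv,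
    (hasDerivAt_potential h.sys ξ).deriv, ← hj]
  obtain ⟨d1, -, -, d2, d3⟩ := h.deriv_bounds S (ς * ξ)
  obtain ⟨w1, w2⟩ := h.volume_mem S (ς * ξ)
  set W := w (ς * ξ)
  set D := deriv w (ς * ξ)
  set P := ψ (ς * ξ)
  have hW : 0 < W := by linarith
  have hq1 : D / 4 ≤ D / W ^ 2 := div_le_div_of_nonneg_left d1.le (by positivity) (by nlinarith)
  have hq2 : D / W ^ 2 ≤ 4 * D := by
    have : 1 / 4 ≤ W ^ 2 := by nlinarith
    rw [div_le_iff₀ (by positivity)]; nlinarith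
  have hq3 : 0 < D / W ^ 2 := by positivity
  have e : -n₀ * ς * D / W ^ 2 = -(ς * (n₀ * (D / W ^ 2))) := by ring
  have hm1 : nm / 2 * (D / W ^ 2) ≤ n₀ * (D / W ^ 2) := mul_le_mul_of_nonneg_right hn₀ hq3.le
  have hm2 : n₀ * (D / W ^ 2) ≤ nm * (D / W ^ 2) := mul_le_mul_of_nonneg_right hn₀' hq3.le
  refine ⟨by field_simp, ?_, ?_, ?_⟩
  · have h1 : -P ≤ 16 / nm * (n₀ * (D / W ^ 2)) := by
      rw [div_mul_eq_mul_div, le_div_iff₀ hnm]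
      nlinarith
    rw [e]
    nlinarith [mul_le_mul_of_nonneg_left h1 hς.le]
  · have h1 : 1 / (8 * nm) * (n₀ * (D / W ^ 2)) ≤ -P := by
      rw [div_mul_eq_mul_div, div_le_iff₀ (by positivity)]
      nlinarith
    rw [e]
    nlinarith [mul_le_mul_of_nonneg_left h1 hς.le]
  · rw [e]
    have : 0 < 1 / (8 * nm) * (ς * (n₀ * (D / W ^ 2))) := by positivity
    linarith

theorem exists_shift (N : Normalisation T μ lam s nm um np up n₀ j ς a c) {A σ r κ : ℝ}
    (S : SmallShock T a A σ r κ c) (h : CenteredProfile T a r c w Φ ψ)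
    (hbox : ∀ {w Φ ψ : ℝ → ℝ}, NormalisedProfile T a c w Φ ψ → InBox r w Φ ψ)
    {n u φ : ℝ → ℝ} (h' : IsProfile T μ lam s nm um np up n u φ) :
    ∃ x, ∀ ξ, n ξ = n₀ * (w (ς * (ξ + x)))⁻¹ ∧ u ξ = s - j / n₀ * w (ς * (ξ + x)) ∧
      φ ξ = Real.log n₀ + Φ (ς * (ξ + x)) := by
  have hp := N.normalisedProfile h'
  obtain ⟨y, hy⟩ := h.exists_shift S hp (hbox hp)
  refine ⟨ς⁻¹ * y, fun ξ => ?_⟩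
  have hn := N.n₀_pos.ne'
  have hς := N.ς_pos.ne'
  have hnξ := (h'.pos ξ).ne'
  have e1 : ς * (ξ + ς⁻¹ * y) = ς * ξ + y := by field_simp
  obtain ⟨h1, h2⟩ := hy (ς * ξ)
  rw [inv_mul_cancel_left₀ hς] at h1 h2
  rw [e1, ← h1, ← h2]
  refine ⟨by field_simp, ?_, by ring⟩
  have := N.eq_of_isProfile h' ξ
  field_simp
  linarith

end Normalisation

theorem theorem1p1 (T μ lam : ℝ) (hT : 0 ≤ T) (hμ : 0 < μ) (hlam : 0 < lam)
    (nm um : ℝ) (hnm : 0 < nm) :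
    ∃ (ε₀ Cup Clow θ : ℝ) (C : ℕ → ℝ),
      0 < ε₀ ∧ 0 < Cup ∧ 0 < Clow ∧ 0 < θ ∧ (∀ k, 0 < C k) ∧
      ∀ np up s : ℝ, RankineHugoniot T s nm um np up →
        -- the shock belongs to the second characteristic family
        um < s →
        np < nm → |np - nm| ≤ ε₀ →
        ∃ n u φ : ℝ → ℝ,
          -- existence, for the profile equations and for the system itself
          IsProfile T μ lam s nm um np up n u φ ∧
          SolvesNSP T μ lam (fun t x => n (x - s * t)) (fun t x => u (x - s * t))
            (fun t x => φ (x - s * t)) ∧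
          -- uniqueness up to a shift
          (∀ n' u' φ' : ℝ → ℝ, IsProfile T μ lam s nm um np up n' u' φ' →
            ∃ h : ℝ, ∀ ξ, n' ξ = n (ξ + h) ∧ u' ξ = u (ξ + h) ∧ φ' ξ = φ (ξ + h)) ∧
          -- monotonicity
          (∀ ξ, deriv n ξ = n ξ ^ 2 * deriv u ξ / (nm * |um - s|) ∧
            Clow * deriv n ξ ≤ deriv φ ξ ∧ deriv φ ξ ≤ Cup * deriv n ξ ∧
            Cup * deriv n ξ < 0) ∧
          -- decay of all derivatives
          (∀ (k : ℕ) (ξ : ℝ), ξ < 0 →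
            deviation k n u φ nm um ξ
              ≤ C k * |np - nm| ^ (k + 1) * Real.exp (-θ * |np - nm| * |ξ|)) ∧
          (∀ (k : ℕ) (ξ : ℝ), 0 < ξ →
            deviation k n u φ np up ξ
              ≤ C k * |np - nm| ^ (k + 1) * Real.exp (-θ * |np - nm| * |ξ|)) := by
  have hq : 0 < √(T + 1) := Real.sqrt_pos.2 (by linarith)
  have ha₁ : 0 < lam * √(nm / 2) / (μ * √(T + 1)) := by positivity
  have hA : 0 < lam * √nm / (μ * √(T + 1)) := by positivity
  obtain ⟨r, κ, δ, hδ, hsmall⟩ := exists_smallShock hT ha₁ hA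
  choose D hD hdev using CenteredProfile.exists_deviationBound hT hA
  refine ⟨nm * min (1 / 2) (δ / 2), 1 / (8 * nm), 16 / nm, √(T + 1) / (8 * μ),
    fun k => (nm + √(T + 1) + 1) * ((√nm / lam) ^ k * (D k * (2 / nm) ^ (k + 1))),
    by positivity, by positivity, by positivity, by positivity,
    fun k => by have := hD k; positivity, fun np up s hRH hs hlt hstr => ?_⟩
  rw [abs_sub_comm np nm, abs_of_pos (sub_pos.2 hlt)] at hstr ⊢
  beta_reduce
  have hm1 : nm - np ≤ nm * (1 / 2) :=
    hstr.trans (mul_le_mul_of_nonneg_left (min_le_left _ _) hnm.le)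
  have hm2 : nm - np ≤ nm * (δ / 2) :=
    hstr.trans (mul_le_mul_of_nonneg_left (min_le_right _ _) hnm.le)
  obtain ⟨c, hc⟩ : ∃ c, c = √(np / nm) := ⟨_, rfl⟩
  have hnp : 0 < np := by linarith
  have hc0 : 0 < c := by rw [hc]; positivity
  have hnp2 : np = c ^ 2 * nm := by
    rw [hc, Real.sq_sqrt (by positivity), div_mul_cancel₀ _ hnm.ne']
  have hc1 : c < 1 := by
    rw [hc, Real.sqrt_lt' one_pos, one_pow, div_lt_one hnm]
    exact hlt
  have hcsq : c ^ 2 ≤ c := by nlinarith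
  have hchalf : 1 / 2 ≤ c := by
    by_contra! hcon
    nlinarith
  have hcδ : 1 - δ < c := by
    by_contra! hcon
    nlinarith
  obtain ⟨N, hj⟩ := hRH.normalisation hT hμ hlam hnm hs hc0 hc1 hnp2
  have hn₀ : nm / 2 ≤ c * nm := by nlinarith
  have hn₀' : c * nm ≤ nm := by nlinarith
  obtain ⟨⟨σ, S⟩, hbox⟩ := hsmall c (lam * √(c * nm) / (μ * √(T + 1))) hcδ hc1 hchalf
    (by gcongr) (by gcongr)
  obtain ⟨w, Φ, ψ, hsys, hin, hmid, hlr⟩ := S.exists_solution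
  have h : CenteredProfile T _ r c w Φ ψ := ⟨hsys, hin, hmid, fun t => (hlr t).1, fun t => (hlr t).2⟩
  obtain ⟨lw, lΦ⟩ := h.tendsto_left S
  obtain ⟨rw', rΦ⟩ := h.tendsto_right S
  have hprof := N.isProfile hsys lw lΦ rw' rΦ
  have hς := N.ς_pos
  have hbound : ∀ (k : ℕ) (ξ : ℝ), (c * nm + √(T + 1) * (c * nm) / (c * nm) + 1)
      * ((√(c * nm) / lam) ^ k * (D k * ((1 / c - c) ^ (k + 1)
        * Real.exp (-(lam * √(c * nm) / (μ * √(T + 1)) * (T + 1) / 8 * (1 / c - c))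
          * |√(c * nm) / lam * ξ|))))
      ≤ (nm + √(T + 1) + 1) * ((√nm / lam) ^ k * (D k * (2 / nm) ^ (k + 1)))
        * (nm - np) ^ (k + 1) * Real.exp (-(√(T + 1) / (8 * μ)) * (nm - np) * |ξ|) := fun k ξ => by
    have hD' := hD k
    have hΔ : 1 / c - c ≤ 2 / nm * (nm - np) := by
      rw [N.strength_eq, div_mul_eq_mul_div, div_le_div_iff₀ N.n₀_pos hnm]
      nlinarith
    have hΔ0 : 0 < 1 / c - c := (CenteredProfile.strength_facts S).1
    rw [N.rate_eq hT, mul_div_cancel_right₀ _ N.n₀_pos.ne']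
    calc _ ≤ (nm + √(T + 1) + 1) * ((√nm / lam) ^ k * (D k * ((2 / nm * (nm - np)) ^ (k + 1)
          * Real.exp (-(√(T + 1) / (8 * μ)) * (nm - np) * |ξ|)))) := by gcongr
      _ = _ := by rw [mul_pow]; ring
  refine ⟨_, _, _, hprof, hprof.solvesNSP, fun n' u' φ' h' => N.exists_shift S h hbox h',
    fun ξ => N.monotonicity S h hn₀ hn₀' hj ξ, fun k ξ hξ => ?_, fun k ξ hξ => ?_⟩
  · refine (deviation_le hsys N.n₀_pos N.j_pos hς ?_ N.left_u.symm
      (by rw [N.log_left, sub_eq_add_neg]) ((hdev k S hchalf h).1 _ ?_)).trans (hbound k ξ)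
    · rw [← div_eq_mul_inv, N.left_n]
    · exact (mul_neg_of_pos_of_neg hς hξ).le
  · refine (deviation_le hsys N.n₀_pos N.j_pos hς ?_ N.right_u.symm
      N.log_right ((hdev k S hchalf h).2 _ (mul_pos hς hξ).le)).trans (hbound k ξ)
    rw [one_div, inv_inv, N.right_n]
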